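/- A graph is biconnected if it is connected and has no cut vertex, and outerplanar if it has a planar drawing (edges drawn as simple polygonal curves) in which every vertex lies on the boundary of the outer face. In a planar straight-line drawing, a segment is a class of edges under the equivalence relation generated by "two edges $uv$, $vw$ share a vertex $v$ that lies in the interior of the line segment from $u$ to $w$". A drawing is monotone if every two vertices are joined by a path $P$ for which there is a line $\ell$ such that the orthogonal projections of the vertices of $P$ to $\ell$ are distinct and appear along $\ell$ in the order induced by $P$. Corollary. Every biconnected outerplanar graph with $n$ vertices has a planar monotone straight-line drawing with at most $(3n-3)/2$ segments on an $O(n)\times O(n^2)$ grid, and such a drawing can be computed in $O(n)$ time. More precisely, there are an absolute constant $C$ and a word-RAM program such that, for every biconnected outerplanar graph $G$ with vertex set $\{0,\dots,n-1\}$, given as a list of its edges in any order, and every word length $w$ with $Cn^2\le 2^w$, the program stops after at most $Cn$ steps and outputs, for each vertex, a point of $\{0,\dots,Cn\}\times\{0,\dots,Cn^2\}$ such that placing the vertices at these points gives a planar monotone straight-line drawing of $G$ with at most $(3n-3)/2$ segments. -/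

import Mathlib

/-! ## Graphs and drawings in the plane -/

/-- A graph is biconnected if it is connected and has no cut vertex. -/
def Biconnected {V : Type*} (G : SimpleGraph V) : Prop :=
  G.Connected ∧ ∀ v : V, (G.induce {v}ᶜ).Preconnected

/-- `PolygonalArc a b S`: the set `S` is a simple polygonal curve with the two ends `a ≠ b`. -/
inductive PolygonalArc : ℝ × ℝ → ℝ × ℝ → Set (ℝ × ℝ) → Prop
  | single {a b : ℝ × ℝ} (hab : a ≠ b) : PolygonalArc a b (segment ℝ a b)
  | cons {a b c : ℝ × ℝ} {S : Set (ℝ × ℝ)} (hab : a ≠ b) (hS : PolygonalArc b c S)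
      (hinter : segment ℝ a b ∩ S = {b}) : PolygonalArc a c (segment ℝ a b ∪ S)

/-- A planar (crossing-free) drawing of `G`: the vertices are distinct points, each edge is a
simple polygonal curve joining its ends and containing no other vertex, and two edges meet
only in common ends. -/
structure IsPlanarDrawing {V : Type*} (G : SimpleGraph V) (pos : V → ℝ × ℝ)
    (arc : Sym2 V → Set (ℝ × ℝ)) : Prop where
  pos_injective : Function.Injective pos
  arc_joins : ∀ u v : V, G.Adj u v → PolygonalArc (pos u) (pos v) (arc s(u, v))
  vertex_on_arc : ∀ e ∈ G.edgeSet, ∀ w : V, pos w ∈ arc e → w ∈ e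
  arc_inter : ∀ e ∈ G.edgeSet, ∀ f ∈ G.edgeSet, e ≠ f →
    arc e ∩ arc f ⊆ pos '' {w : V | w ∈ e ∧ w ∈ f}

/-- The point set covered by a drawing. -/
def drawingSet {V : Type*} (G : SimpleGraph V) (pos : V → ℝ × ℝ)
    (arc : Sym2 V → Set (ℝ × ℝ)) : Set (ℝ × ℝ) :=
  Set.range pos ∪ ⋃ e ∈ G.edgeSet, arc e

/-- The outer face of a drawing: the union of the unbounded connected components of the complement
of `D` (there is exactly one such component when `D` is bounded). -/
def outerFace (D : Set (ℝ × ℝ)) : Set (ℝ × ℝ) :=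
  {x | ¬ Bornology.IsBounded (connectedComponentIn Dᶜ x)}

/-- A graph is outerplanar if it has a planar drawing in which every vertex is on the boundary of
the outer face. -/
def Outerplanar {V : Type*} (G : SimpleGraph V) : Prop :=
  ∃ (pos : V → ℝ × ℝ) (arc : Sym2 V → Set (ℝ × ℝ)), IsPlanarDrawing G pos arc ∧
    ∀ v : V, pos v ∈ closure (outerFace (drawingSet G pos arc))

/-! ## Straight-line drawings -/

/-- In a straight-line drawing, the edge `uv` is the segment between the points of `u` and `v`. -/
def straightArc {V : Type*} (pos : V → ℝ × ℝ) : Sym2 V → Set (ℝ × ℝ) :=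
  Sym2.lift ⟨fun u v => segment ℝ (pos u) (pos v), fun u v => segment_symm ℝ (pos u) (pos v)⟩

/-- A planar straight-line drawing. -/
def IsPlanarStraightLine {V : Type*} (G : SimpleGraph V) (pos : V → ℝ × ℝ) : Prop :=
  IsPlanarDrawing G pos (straightArc pos)

/-- A path is monotone if, for some direction `d ≠ 0`, the projections of its vertices to a line
of direction `d` appear in the order in which the path visits them. -/
def IsMonotonePath {V : Type*} {G : SimpleGraph V} (pos : V → ℝ × ℝ) {u v : V}
    (P : G.Walk u v) : Prop :=
  P.IsPath ∧ ∃ d : ℝ × ℝ, d ≠ 0 ∧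
    P.support.Pairwise
      (fun a b => d.1 * (pos a).1 + d.2 * (pos a).2 < d.1 * (pos b).1 + d.2 * (pos b).2)

/-- A drawing is monotone if every two vertices are joined by a monotone path. -/
def IsMonotoneDrawing {V : Type*} (G : SimpleGraph V) (pos : V → ℝ × ℝ) : Prop :=
  ∀ u v : V, ∃ P : G.Walk u v, IsMonotonePath pos P

/-- Two edges `uv` and `vw` continue each other straight through their common vertex `v`. -/
def ContinuesStraight {V : Type*} (G : SimpleGraph V) (pos : V → ℝ × ℝ) (e f : G.edgeSet) : Prop :=
  ∃ u v w : V, (e : Sym2 V) = s(u, v) ∧ (f : Sym2 V) = s(v, w) ∧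
    pos v ∈ openSegment ℝ (pos u) (pos w)

/-- The number of segments formed by the edges of a straight-line drawing. Two edges are on the same
segment if they are linked by a chain of edges each of which continues the previous one
straight; `Quot` takes the classes of the generated equivalence relation. -/
noncomputable def segmentCount {V : Type*} (G : SimpleGraph V) (pos : V → ℝ × ℝ) : ℕ :=
  Nat.card (Quot (ContinuesStraight G pos))

/-- The points of the plane with given natural-number coordinates. -/
def gridPos {V : Type*} (q : V → ℕ × ℕ) : V → ℝ × ℝ :=
  fun v => (((q v).1 : ℝ), ((q v).2 : ℝ))

/-! ## Word RAM with step count -/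

namespace WordRAM

/-- A state: registers and a random-access memory, both holding natural numbers. -/
structure State where
  reg : ℕ → ℕ
  mem : ℕ → ℕ

/-- Arithmetic operations. -/
inductive Op
  | add | sub | mul | div

/-- Value of an operation on words of `w` bits: sums and products are taken modulo `2 ^ w`,
the difference is cut off at `0`, the quotient is rounded down. -/
def Op.eval (w : ℕ) : Op → ℕ → ℕ → ℕ
  | .add, x, y => (x + y) % 2 ^ w
  | .sub, x, y => x - y
  | .mul, x, y => (x * y) % 2 ^ w
  | .div, x, y => x / y

/-- Elementary instructions; `r`, `a`, `b` are names of registers. -/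
inductive Instr
  /-- `r := k` -/
  | const (r k : ℕ)
  /-- `r := a op b` -/
  | arith (op : Op) (r a b : ℕ)
  /-- `r := mem[a]` -/
  | load (r a : ℕ)
  /-- `mem[a] := r` -/
  | store (a r : ℕ)

/-- Effect of an elementary instruction. -/
def Instr.run (w : ℕ) : Instr → State → State
  | .const r k, s => { s with reg := Function.update s.reg r (k % 2 ^ w) }
  | .arith op r a b, s => { s with reg := Function.update s.reg r (op.eval w (s.reg a) (s.reg b)) }
  | .load r a, s => { s with reg := Function.update s.reg r (s.mem (s.reg a)) }
  | .store a r, s => { s with mem := Function.update s.mem (s.reg a) (s.reg r) }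

/-- Programs. The tests are of the form `a < b` for two registers `a`, `b`. -/
inductive Program
  | skip
  | instr (i : Instr)
  | seq (p q : Program)
  | ifLt (a b : ℕ) (p q : Program)
  | whileLt (a b : ℕ) (p : Program)

/-- `Runs w p s t s'`: on words of `w` bits, the program `p` started in state `s` stops in state
`s'` after exactly `t` steps, where each elementary instruction and each test is one step. -/
inductive Runs (w : ℕ) : Program → State → ℕ → State → Prop
  | skip {s : State} : Runs w .skip s 0 s
  | instr {i : Instr} {s : State} : Runs w (.instr i) s 1 (i.run w s)
  | seq {p q : Program} {s s' s'' : State} {t t' : ℕ} (hp : Runs w p s t s')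
      (hq : Runs w q s' t' s'') : Runs w (.seq p q) s (t + t') s''
  | ifTrue {a b : ℕ} {p q : Program} {s s' : State} {t : ℕ} (hab : s.reg a < s.reg b)
      (hp : Runs w p s t s') : Runs w (.ifLt a b p q) s (1 + t) s'
  | ifFalse {a b : ℕ} {p q : Program} {s s' : State} {t : ℕ} (hab : ¬ s.reg a < s.reg b)
      (hq : Runs w q s t s') : Runs w (.ifLt a b p q) s (1 + t) s'
  | whileTrue {a b : ℕ} {p : Program} {s s' s'' : State} {t t' : ℕ} (hab : s.reg a < s.reg b)
      (hp : Runs w p s t s') (hloop : Runs w (.whileLt a b p) s' t' s'') :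
      Runs w (.whileLt a b p) s (1 + t + t') s''
  | whileFalse {a b : ℕ} {p : Program} {s : State} (hab : ¬ s.reg a < s.reg b) :
      Runs w (.whileLt a b p) s 1 s

end WordRAM

/-- `L` lists every edge of `G` exactly once, in any order and with either order of its ends. -/
def IsEdgeList {n : ℕ} (G : SimpleGraph (Fin n)) (L : List (Fin n × Fin n)) : Prop :=
  (L.map (fun x => s(x.1, x.2))).Nodup ∧
    ∀ e : Sym2 (Fin n), e ∈ G.edgeSet ↔ e ∈ L.map (fun x => s(x.1, x.2))

/-- The input word sequence `n, m, u₁, v₁, …, uₘ, vₘ` of a graph with `n` vertices and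
the edge list `(u₁, v₁), …, (uₘ, vₘ)`. -/
def inputWords {n : ℕ} (L : List (Fin n × Fin n)) : List ℕ :=
  n :: L.length :: L.flatMap (fun x => [(x.1 : ℕ), (x.2 : ℕ)])

/-- The initial state: the input is in the memory cells `0, 1, 2, …`, all else is `0`. -/
def inputState {n : ℕ} (L : List (Fin n × Fin n)) : WordRAM.State where
  reg := fun _ => 0
  mem := fun i => (inputWords L).getD i 0

/-- The placement of the vertices that is read from the memory: vertex `v` gets the coordinates in
the cells `2 v` and `2 v + 1`. -/
def outputPlacement (n : ℕ) (s : WordRAM.State) : Fin n → ℕ × ℕ :=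
  fun v => (s.mem (2 * (v : ℕ)), s.mem (2 * (v : ℕ) + 1))

/-! ## Non-planarity of `K₃,₃` and `K₅` for continuous drawings -/

section Nonplanarity

open Complex

/-! Graph theory. Outerplanarity is used only to obtain a Hamiltonian cycle with non-crossing chords
(`exists_cycOrder`). For disjoint curves e, f the difference f(t) - e(s) has a continuous logarithm
on the parameter square; going once around the boundary yields an integer equation between turning
numbers (`turnAt_square`), and modulo 2 the equations for all pairs of disjoint edges of K₃,₃ or K₅
are contradictory. In an outerplanar drawing a point far outside can be joined to every vertex
(`exists_apex`), so a subdivided K₂,₃ or K₄ would extend to a forbidden K₃,₃ or K₅. If a cycle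
misses a vertex of a biconnected graph, then an ear is attached to it: either the ear lengthens the
cycle or the two form a subdivided K₂,₃. Two crossing chords of a Hamiltonian cycle would form a
subdivided K₄.

Drawing. Number the vertices 0, …, n-1 along the cycle and use the number as first coordinate; the
Hamiltonian path is then monotone, and so is the drawing. Join each j ≥ 1 to its smallest neighbour
p(j) to get a tree, and draw this tree edge with slope c(j), the number of tree edges that pass over
j. Slopes grow under nested edges, so everything below an edge in the nesting is drawn strictly
above its segment (`above_edge`), which gives planarity. The slopes are at most n, so the heights
are at most n². Every vertex i ≥ 1 is the lower end of at most one non-tree edge, and the tree edge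
to its largest child has the slope of the tree edge to i. So there are at most (2n-3) - t segments
if t vertices i ≥ 1 have children (`IsNumbering.segmentCount_le`). Reading the cycle backwards gives
a second tree with t', and t + t' ≥ n-3 by non-crossing (`card_inner_add_card_inner`); the better of
the two satisfies the bound (3n-3)/2.

Algorithm. A vertex of degree two has its two cycle neighbours as neighbours, and such vertices
exist as long as three vertices are left. They are removed one by one from a queue, with the two
neighbours made adjacent, and then put back in reverse order into a cyclic successor function.
Adjacency is tested in a matrix that needs no initialisation because the memory starts with zeros.
The two neighbours are found in constant time from the sum of the neighbours and the sum of their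
squares, with a table of square roots. The slopes satisfy c(j+1) = c(j) + (number of children of j)
- 1 (`slope_succ`), so all heights are computed in one pass. The program has no nested loops and
each loop makes at most 2n iterations, whence linear time. -/

/-- The number of full turns of `g` around `0` between the times `0` and `1`, relative to the
principal arguments of the ends. -/
theorem exists_turn (g : ℝ → ℂ) (hg : Continuous g) (h0 : ∀ t, g t ≠ 0) :
    ∃ k : ℤ, ∀ L : ℝ → ℂ, Continuous L → (∀ t, exp (L t) = g t) →
      (L 1).im - (L 0).im = arg (g 1) - arg (g 0) + 2 * Real.pi * k := by
  have hsc : IsSimplyConnected (Set.univ : Set ℝ) := by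
    have : ContractibleSpace (Set.univ : Set ℝ) := convex_univ.contractibleSpace ⟨0, trivial⟩
    exact SimplyConnectedSpace.ofContractible _
  obtain ⟨L, hL, hLg⟩ := exists_continuousOn_eqOn_exp_comp hsc isOpen_univ hg.continuousOn
    (by rintro ⟨t, -, ht⟩; exact h0 t ht)
  have hL' : Continuous L := by rwa [← continuousOn_univ]
  have hLg' : ∀ t, exp (L t) = g t := fun t => hLg (Set.mem_univ t)
  have key : ∀ t, ∃ m : ℤ, (L t).im = arg (g t) + 2 * Real.pi * m := by
    intro t
    have h1 : exp (L t) = exp (log (g t)) := by rw [hLg', exp_log (h0 t)]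
    obtain ⟨m, hm⟩ := exp_eq_exp_iff_exists_int.1 h1
    refine ⟨m, ?_⟩
    have := congrArg Complex.im hm
    simp [log_im] at this
    linarith
  obtain ⟨m0, hm0⟩ := key 0
  obtain ⟨m1, hm1⟩ := key 1
  refine ⟨m1 - m0, fun L' hLc' hLe' => ?_⟩
  -- Two logarithms of the same curve differ by integer multiples of 2πi, and a continuous
  -- integer-valued function on the line is constant. So the turning number does not depend on the
  -- lift.
  have hd : ∀ t, ∃ m : ℤ, L' t - L t = m * (2 * Real.pi * I) := by
    intro t
    have h1 : exp (L' t) = exp (L t) := by rw [hLg', hLe']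
    obtain ⟨m, hm⟩ := exp_eq_exp_iff_exists_int.1 h1
    exact ⟨m, by rw [hm]; ring⟩
  have hconst : ∃ m : ℤ, ∀ t, (L' t).im - (L t).im = m * (2 * Real.pi) := by
    choose m hm using hd
    have him : ∀ t, (L' t).im - (L t).im = m t * (2 * Real.pi) := by
      intro t
      have := congrArg Complex.im (hm t)
      simpa using this
    have hc : Continuous fun t => (m t : ℝ) := by
      have : (fun t => (m t : ℝ)) = fun t => ((L' t).im - (L t).im) / (2 * Real.pi) := by
        funext t
        rw [him]
        field_simp
      rw [this]
      fun_prop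
    have hc' : Continuous m := (Int.isClosedEmbedding_coe_real.isInducing).continuous_iff.2 hc
    refine ⟨m 0, fun t => ?_⟩
    rw [him, PreconnectedSpace.constant (f := m) inferInstance hc' (x := t) (y := 0)]
  obtain ⟨m, hm⟩ := hconst
  have e0 := hm 0
  have e1 := hm 1
  push_cast
  linarith

open Classical in
/-- The turning number of a curve that avoids `0`. -/
noncomputable def turn (g : ℝ → ℂ) : ℤ :=
  if h : ∃ k : ℤ, ∀ L : ℝ → ℂ, Continuous L → (∀ t, exp (L t) = g t) →
      (L 1).im - (L 0).im = arg (g 1) - arg (g 0) + 2 * Real.pi * k then h.choose else 0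

theorem turn_spec {g : ℝ → ℂ} (hg : Continuous g) (h0 : ∀ t, g t ≠ 0) {L : ℝ → ℂ}
    (hL : Continuous L) (he : ∀ t, exp (L t) = g t) :
    (L 1).im - (L 0).im = arg (g 1) - arg (g 0) + 2 * Real.pi * turn g := by
  have h := exists_turn g hg h0
  rw [turn, dif_pos h]
  exact h.choose_spec L hL he

/-- `1` if the direction from `x` to `y` has positive argument, otherwise `0`. -/
noncomputable def argSign (x y : ℂ) : ℤ := if 0 < arg (y - x) then 1 else 0

/-- Negation changes the principal argument by π or by -π, depending on the half-plane; `argSign`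
records which, so that the ambiguity is an integer multiple of 2π. -/
theorem arg_sub_swap {x y : ℂ} (h : x ≠ y) :
    arg (x - y) = arg (y - x) + Real.pi - 2 * Real.pi * argSign x y := by
  have hne : y - x ≠ 0 := sub_ne_zero.2 h.symm
  rw [show x - y = -(y - x) by ring]
  simp only [argSign]
  generalize y - x = z at *
  rcases lt_trichotomy z.im 0 with hi | hi | hi
  · rw [arg_neg_eq_arg_add_pi_of_im_neg hi, if_neg (by rw [not_lt]; exact (arg_neg_iff.2 hi).le)]
    simp
  · rcases lt_trichotomy z.re 0 with hr | hr | hr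
    · have : arg z = Real.pi := arg_eq_pi_iff.2 ⟨hr, hi⟩
      have h2 : arg (-z) = 0 := by rw [arg_eq_zero_iff]; simp [hi, hr.le]
      rw [h2, this, if_pos Real.pi_pos]; push_cast; ring
    · exact absurd (Complex.ext hr hi) hne
    · have : arg z = 0 := by rw [arg_eq_zero_iff]; simp [hi, hr.le]
      have h2 : arg (-z) = Real.pi := by rw [arg_eq_pi_iff]; simp [hi, hr]
      rw [h2, this, if_neg (lt_irrefl _)]; push_cast; ring
  · rw [arg_neg_eq_arg_sub_pi_of_im_pos hi, if_pos]
    · push_cast; ring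
    · refine lt_of_le_of_ne (arg_nonneg_iff.2 hi.le) fun h0 => ?_
      have := (arg_eq_zero_iff.1 h0.symm).2
      linarith

/-- Add the two instances of `arg_sub_swap`. The odd value 1 is the source of the parity
contradictions below. -/
theorem argSign_add_swap {x y : ℂ} (h : x ≠ y) : argSign x y + argSign y x = 1 := by
  have h1 := arg_sub_swap h
  have h2 := arg_sub_swap h.symm
  have : (2 * Real.pi) * ((argSign x y + argSign y x : ℤ) : ℝ) = 2 * Real.pi * 1 := by
    push_cast; linarith
  have := mul_left_cancel₀ (by positivity) this
  exact_mod_cast this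

/-- The turning number of the curve `f` around the point `v`. -/
noncomputable def turnAt (v : ℂ) (f : ℝ → ℂ) : ℤ := turn fun t => f t - v

/-- The function f t - e s has no zero, so it has a continuous logarithm on the simply connected
plane of parameters, and the total change around the unit square is 0. Each side of the square shows
one curve as seen from an end of the other; the `argSign` terms are what remains of the principal
arguments at the four corners. -/
theorem turnAt_square {e f : ℝ → ℂ} (he : Continuous e) (hf : Continuous f)
    (hd : ∀ s t, e s ≠ f t) :
    turnAt (e 1) f - turnAt (e 0) f - turnAt (f 1) e + turnAt (f 0) e + argSign (e 1) (f 1)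
      - argSign (e 1) (f 0) - argSign (e 0) (f 1) + argSign (e 0) (f 0) = 0 := by
  have hsc : IsSimplyConnected (Set.univ : Set (ℝ × ℝ)) := by
    have : ContractibleSpace (Set.univ : Set (ℝ × ℝ)) := convex_univ.contractibleSpace ⟨0, trivial⟩
    exact SimplyConnectedSpace.ofContractible _
  obtain ⟨L, hL, hLg⟩ := exists_continuousOn_eqOn_exp_comp hsc isOpen_univ
    (g := fun p : ℝ × ℝ => f p.2 - e p.1) (by fun_prop)
    (by rintro ⟨t, -, ht⟩; exact hd t.1 t.2 (sub_eq_zero.1 ht).symm)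
  have hL' : Continuous L := by rwa [← continuousOn_univ]
  have hLg' : ∀ s t, exp (L (s, t)) = f t - e s := fun s t => hLg (Set.mem_univ (s, t))
  have a1 := turn_spec (g := fun t => f t - e 1) (by fun_prop)
    (fun t => sub_ne_zero.2 (hd _ _).symm) (L := fun t => L (1, t)) (by fun_prop)
    (fun t => hLg' _ _)
  have a0 := turn_spec (g := fun t => f t - e 0) (by fun_prop)
    (fun t => sub_ne_zero.2 (hd _ _).symm) (L := fun t => L (0, t)) (by fun_prop)
    (fun t => hLg' _ _)
  -- On these two sides the roles of the curves are exchanged; adding πi turns a logarithm of f - e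
  -- into one of e - f.
  have b1 := turn_spec (g := fun t => e t - f 1) (by fun_prop)
    (fun t => sub_ne_zero.2 (hd _ _)) (L := fun t => L (t, 1) + Real.pi * I) (by fun_prop)
    (fun t => by rw [exp_add, hLg', exp_pi_mul_I]; ring)
  have b0 := turn_spec (g := fun t => e t - f 0) (by fun_prop)
    (fun t => sub_ne_zero.2 (hd _ _)) (L := fun t => L (t, 0) + Real.pi * I) (by fun_prop)
    (fun t => by rw [exp_add, hLg', exp_pi_mul_I]; ring)
  have s11 := arg_sub_swap (hd 1 1)
  have s10 := arg_sub_swap (hd 1 0)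
  have s01 := arg_sub_swap (hd 0 1)
  have s00 := arg_sub_swap (hd 0 0)
  simp only [add_im] at a1 a0 b1 b0
  rw [← @Int.cast_inj ℝ]
  push_cast
  have : (2 * Real.pi) * (turnAt (e 1) f - turnAt (e 0) f - turnAt (f 1) e + turnAt (f 0) e
      + argSign (e 1) (f 1) - argSign (e 1) (f 0) - argSign (e 0) (f 1) + argSign (e 0) (f 0) : ℝ)
      = 2 * Real.pi * 0 := by
    simp only [turnAt]
    linarith
  exact mul_left_cancel₀ (by positivity) this

/-- `K₃,₃` has no continuous drawing in which disjoint edges are drawn disjointly. -/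
theorem not_drawing_K33 (a b : Fin 3 → ℂ) (e : Fin 3 → Fin 3 → ℝ → ℂ)
    (hc : ∀ i j, Continuous (e i j)) (h0 : ∀ i j, e i j 0 = a i) (h1 : ∀ i j, e i j 1 = b j)
    (hd : ∀ i i' j j', i ≠ i' → j ≠ j' → ∀ s t, e i j s ≠ e i' j' t) : False := by
  have sq : ∀ i i' j j', i ≠ i' → j ≠ j' →
      turnAt (b j) (e i' j') - turnAt (a i) (e i' j') - turnAt (b j') (e i j)
      + turnAt (a i') (e i j) + argSign (b j) (b j') - argSign (b j) (a i')
      - argSign (a i) (b j') + argSign (a i) (a i') = 0 := by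
    intro i i' j j' hi hj
    have := turnAt_square (hc i j) (hc i' j') (hd i i' j j' hi hj)
    simpa only [h0, h1] using this
  have hb : ∀ j j', j ≠ j' → argSign (b j) (b j') + argSign (b j') (b j) = 1 := by
    intro j j' hj
    refine argSign_add_swap ?_
    have := hd 0 1 j j' (by decide) hj 1 1
    rwa [h1, h1] at this
  have p := fun j j' hj => sq 0 1 j j' (by decide) hj
  have q := fun j j' hj => sq 0 2 j j' (by decide) hj
  have r := fun j j' hj => sq 1 2 j j' (by decide) hj
  have p01 := p 0 1 (by decide); have p10 := p 1 0 (by decide)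
  have p02 := p 0 2 (by decide); have p20 := p 2 0 (by decide)
  have p12 := p 1 2 (by decide); have p21 := p 2 1 (by decide)
  have q01 := q 0 1 (by decide); have q10 := q 1 0 (by decide)
  have q02 := q 0 2 (by decide); have q20 := q 2 0 (by decide)
  have q12 := q 1 2 (by decide); have q21 := q 2 1 (by decide)
  have r01 := r 0 1 (by decide); have r10 := r 1 0 (by decide)
  have r02 := r 0 2 (by decide); have r20 := r 2 0 (by decide)
  have r12 := r 1 2 (by decide); have r21 := r 2 1 (by decide)
  have b01 := hb 0 1 (by decide); have b02 := hb 0 2 (by decide); have b12 := hb 1 2 (by decide)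
  -- Modulo 2 the sum of the eighteen equations is odd: every turning number occurs twice, every
  -- `argSign` involving some `a i` an even number of times, and each of the three pairs in `b`
  -- occurs three times in either order, which gives 3 · 1.
  clear p q r sq hb hd h0 h1 hc
  omega

/-- `K₅` has no continuous drawing in which disjoint edges are drawn disjointly. -/
theorem not_drawing_K5 (a : Fin 5 → ℂ) (e : Fin 5 → Fin 5 → ℝ → ℂ)
    (hc : ∀ i j, i < j → Continuous (e i j)) (h0 : ∀ i j, i < j → e i j 0 = a i)
    (h1 : ∀ i j, i < j → e i j 1 = a j)
    (hd : ∀ i j i' j', i < j → i' < j' → i < i' → i' ≠ j → j ≠ j' →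
      ∀ s t, e i j s ≠ e i' j' t) : False := by
  have sq : ∀ i j i' j', i < j → i' < j' → i < i' → i' ≠ j → j ≠ j' →
      turnAt (a j) (e i' j') - turnAt (a i) (e i' j') - turnAt (a j') (e i j)
      + turnAt (a i') (e i j) + argSign (a j) (a j') - argSign (a j) (a i')
      - argSign (a i) (a j') + argSign (a i) (a i') = 0 := by
    intro i j i' j' h h' hi h2 h3
    have := turnAt_square (hc i j h) (hc i' j' h') (hd i j i' j' h h' hi h2 h3)
    simpa only [h0 i j h, h1 i j h, h0 i' j' h', h1 i' j' h'] using this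
  have hb : ∀ i j i' j', i < j → i' < j' → i < i' → i' ≠ j → j ≠ j' →
      argSign (a j) (a i') + argSign (a i') (a j) = 1 := by
    intro i j i' j' h h' hi h2 h3
    refine argSign_add_swap ?_
    have := hd i j i' j' h h' hi h2 h3 1 0
    rwa [h1 i j h, h0 i' j' h'] at this
  have q01_23 := sq 0 1 2 3 (by decide) (by decide) (by decide) (by decide) (by decide)
  have q02_13 := sq 0 2 1 3 (by decide) (by decide) (by decide) (by decide) (by decide)
  have q03_12 := sq 0 3 1 2 (by decide) (by decide) (by decide) (by decide) (by decide)
  have q01_24 := sq 0 1 2 4 (by decide) (by decide) (by decide) (by decide) (by decide)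
  have q02_14 := sq 0 2 1 4 (by decide) (by decide) (by decide) (by decide) (by decide)
  have q04_12 := sq 0 4 1 2 (by decide) (by decide) (by decide) (by decide) (by decide)
  have q01_34 := sq 0 1 3 4 (by decide) (by decide) (by decide) (by decide) (by decide)
  have q03_14 := sq 0 3 1 4 (by decide) (by decide) (by decide) (by decide) (by decide)
  have q04_13 := sq 0 4 1 3 (by decide) (by decide) (by decide) (by decide) (by decide)
  have q02_34 := sq 0 2 3 4 (by decide) (by decide) (by decide) (by decide) (by decide)
  have q03_24 := sq 0 3 2 4 (by decide) (by decide) (by decide) (by decide) (by decide)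
  have q04_23 := sq 0 4 2 3 (by decide) (by decide) (by decide) (by decide) (by decide)
  have q12_34 := sq 1 2 3 4 (by decide) (by decide) (by decide) (by decide) (by decide)
  have q13_24 := sq 1 3 2 4 (by decide) (by decide) (by decide) (by decide) (by decide)
  have q14_23 := sq 1 4 2 3 (by decide) (by decide) (by decide) (by decide) (by decide)
  have b12 := hb 0 1 2 3 (by decide) (by decide) (by decide) (by decide) (by decide)
  have b13 := hb 0 1 3 4 (by decide) (by decide) (by decide) (by decide) (by decide)
  have b23 := hb 0 2 3 4 (by decide) (by decide) (by decide) (by decide) (by decide)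
  have b24 := hb 0 4 2 3 (by decide) (by decide) (by decide) (by decide) (by decide)
  have b34 : argSign (a 3) (a 4) + argSign (a 4) (a 3) = 1 := by
    refine argSign_add_swap ?_
    have := hd 0 3 1 4 (by decide) (by decide) (by decide) (by decide) (by decide) 1 1
    rwa [h1 0 3 (by decide), h1 1 4 (by decide)] at this
  have b14 := hb 0 4 1 2 (by decide) (by decide) (by decide) (by decide) (by decide)
  -- In the sum of the fifteen equations every turning number occurs twice and every pair of
  -- vertices six times in an `argSign`. In each set of four vertices three of these terms have the
  -- larger index first, so modulo 2 the sum is 5 · 3, an odd number.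
  clear sq hb hd h0 h1 hc
  omega

end Nonplanarity

/-! ## Outerplanar drawings -/

section OuterDrawing

theorem exists_curve_of_joinedIn {S : Set (ℝ × ℝ)} {x y : ℝ × ℝ} (h : JoinedIn S x y) :
    ∃ f : ℝ → ℂ, Continuous f ∧ f 0 = Complex.equivRealProdCLM.symm x ∧
      f 1 = Complex.equivRealProdCLM.symm y ∧
      ∀ t, ∃ p ∈ S, f t = Complex.equivRealProdCLM.symm p := by
  obtain ⟨γ, hγ⟩ := h
  refine ⟨fun t => Complex.equivRealProdCLM.symm (γ.extend t), ?_, by simp, by simp, fun t => ?_⟩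
  · exact Complex.equivRealProdCLM.symm.continuous.comp γ.continuous_extend
  · exact ⟨_, hγ (Set.projIcc 0 1 zero_le_one t), rfl⟩

theorem not_joinedIn_K33 (a b : Fin 3 → ℝ × ℝ) (S : Fin 3 → Fin 3 → Set (ℝ × ℝ))
    (hj : ∀ i j, JoinedIn (S i j) (a i) (b j))
    (hd : ∀ i i' j j', i ≠ i' → j ≠ j' → Disjoint (S i j) (S i' j')) : False := by
  choose e hc h0 h1 hS using fun i j => exists_curve_of_joinedIn (hj i j)
  refine not_drawing_K33 _ _ e hc h0 h1 fun i i' j j' hi hj s t heq => ?_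
  obtain ⟨p, hp, hp'⟩ := hS i j s
  obtain ⟨q, hq, hq'⟩ := hS i' j' t
  rw [hp', hq'] at heq
  have := Complex.equivRealProdCLM.symm.injective heq
  subst this
  exact Set.disjoint_left.1 (hd i i' j j' hi hj) hp hq

theorem not_joinedIn_K5 (a : Fin 5 → ℝ × ℝ) (S : Fin 5 → Fin 5 → Set (ℝ × ℝ))
    (hj : ∀ i j, i < j → JoinedIn (S i j) (a i) (a j))
    (hd : ∀ i j i' j', i < j → i' < j' → i < i' → i' ≠ j → j ≠ j' →
      Disjoint (S i j) (S i' j')) : False := by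
  have : ∀ i j, ∃ f : ℝ → ℂ, i < j → Continuous f ∧ f 0 = Complex.equivRealProdCLM.symm (a i) ∧
      f 1 = Complex.equivRealProdCLM.symm (a j) ∧
      ∀ t, ∃ p ∈ S i j, f t = Complex.equivRealProdCLM.symm p := by
    intro i j
    by_cases h : i < j
    · obtain ⟨f, hf⟩ := exists_curve_of_joinedIn (hj i j h)
      exact ⟨f, fun _ => hf⟩
    · exact ⟨fun _ => 0, fun h' => absurd h' h⟩
  choose e he using this
  refine not_drawing_K5 _ e (fun i j h => (he i j h).1) (fun i j h => (he i j h).2.1)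
    (fun i j h => (he i j h).2.2.1) fun i j i' j' h h' h1 h2 h3 s t heq => ?_
  obtain ⟨p, hp, hp'⟩ := (he i j h).2.2.2 s
  obtain ⟨q, hq, hq'⟩ := (he i' j' h').2.2.2 t
  rw [hp', hq'] at heq
  have := Complex.equivRealProdCLM.symm.injective heq
  subst this
  exact Set.disjoint_left.1 (hd i j i' j' h h' h1 h2 h3) hp hq

theorem PolygonalArc.joinedIn {a b : ℝ × ℝ} {S : Set (ℝ × ℝ)} (h : PolygonalArc a b S) :
    JoinedIn S a b := by
  induction h with
  | single hab => exact JoinedIn.of_segment_subset subset_rfl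
  | cons hab hS hi ih =>
    exact (JoinedIn.of_segment_subset Set.subset_union_left).trans (ih.mono Set.subset_union_right)

theorem isCompact_real_segment (a b : ℝ × ℝ) : IsCompact (segment ℝ a b) := by
  rw [segment_eq_image_lineMap]
  exact isCompact_Icc.image AffineMap.lineMap_continuous

theorem PolygonalArc.isCompact {a b : ℝ × ℝ} {S : Set (ℝ × ℝ)} (h : PolygonalArc a b S) :
    IsCompact S := by
  induction h with
  | single hab => exact isCompact_real_segment _ _
  | cons hab hS hi ih => exact (isCompact_real_segment _ _).union ih

/-- The complement of a disc is connected. -/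
theorem isPreconnected_norm_gt {R : ℝ} (hR : 0 ≤ R) :
    IsPreconnected {z : ℝ × ℝ | R < ‖z‖} := by
  have hrk : 1 < Module.rank ℝ (ℝ × ℝ) := by
    rw [rank_prod']; simp; norm_num
  have h0 := (isConnected_compl_singleton_of_one_lt_rank hrk (0 : ℝ × ℝ)).isPreconnected
  -- The radial push z ↦ (1 + R / ‖z‖) z maps the punctured plane onto the exterior.
  have him := h0.image (fun z => (1 + R / ‖z‖) • z) (by
    refine ContinuousOn.smul (continuousOn_const.add (continuousOn_const.div
      continuous_norm.continuousOn ?_)) continuousOn_id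
    intro z hz
    exact norm_ne_zero_iff.2 hz)
  convert him using 1
  ext y
  constructor
  · intro hy
    have hy' : R < ‖y‖ := hy
    have hpos : 0 < ‖y‖ := hR.trans_lt hy'
    have hc : 0 < 1 - R / ‖y‖ := by rw [sub_pos, div_lt_one hpos]; exact hy'
    refine ⟨(1 - R / ‖y‖) • y, ?_, ?_⟩
    · simp only [Set.mem_compl_iff, Set.mem_singleton_iff, smul_eq_zero, not_or]
      exact ⟨hc.ne', norm_pos_iff.1 hpos⟩
    · simp only
      rw [norm_smul, Real.norm_of_nonneg hc.le, smul_smul]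
      have h2 : (1 - R / ‖y‖) * ‖y‖ = ‖y‖ - R := by field_simp
      have h3 : ‖y‖ - R ≠ 0 := by linarith
      have : (1 + R / ((1 - R / ‖y‖) * ‖y‖)) * (1 - R / ‖y‖) = 1 := by
        rw [h2]; field_simp; ring
      rw [this, one_smul]
  · rintro ⟨z, hz, rfl⟩
    have hpos : 0 < ‖z‖ := norm_pos_iff.2 hz
    have : (0 : ℝ) ≤ 1 + R / ‖z‖ := by positivity
    simp only [Set.mem_ofPred_eq]
    rw [norm_smul, Real.norm_of_nonneg this]
    have : (1 + R / ‖z‖) * ‖z‖ = ‖z‖ + R := by field_simp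
    linarith

variable {V : Type*} {G : SimpleGraph V} {pos : V → ℝ × ℝ} {arc : Sym2 V → Set (ℝ × ℝ)}

/-- The part of a drawing that is formed by the vertices in `X` and the edges between them. -/
def drawnRegion (G : SimpleGraph V) (pos : V → ℝ × ℝ) (arc : Sym2 V → Set (ℝ × ℝ))
    (X : Set V) : Set (ℝ × ℝ) :=
  pos '' X ∪ ⋃ e ∈ {e ∈ G.edgeSet | ∀ w ∈ e, w ∈ X}, arc e

theorem mem_drawnRegion {X : Set V} {z : ℝ × ℝ} : z ∈ drawnRegion G pos arc X ↔
    (∃ x ∈ X, pos x = z) ∨ ∃ e ∈ G.edgeSet, (∀ w ∈ e, w ∈ X) ∧ z ∈ arc e := by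
  simp [drawnRegion, and_assoc]

theorem drawnRegion_mono {X Y : Set V} (h : X ⊆ Y) :
    drawnRegion G pos arc X ⊆ drawnRegion G pos arc Y := by
  intro z
  rw [mem_drawnRegion, mem_drawnRegion]
  rintro (⟨x, hx, rfl⟩ | ⟨e, he, hX, hz⟩)
  · exact Or.inl ⟨x, h hx, rfl⟩
  · exact Or.inr ⟨e, he, fun w hw => h (hX w hw), hz⟩

theorem drawnRegion_univ : drawnRegion G pos arc Set.univ = drawingSet G pos arc := by
  ext z
  simp [mem_drawnRegion, drawingSet]

/-- A common point would lie on a vertex or on two edges, and planarity then provides a vertex that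
belongs to both sides. In this way topological disjointness reduces to disjointness of vertex sets.
-/
theorem IsPlanarDrawing.disjoint_drawnRegion (h : IsPlanarDrawing G pos arc) {X Y : Set V}
    (hXY : Disjoint X Y) : Disjoint (drawnRegion G pos arc X) (drawnRegion G pos arc Y) := by
  have hXY' := fun v (hX : v ∈ X) (hY : v ∈ Y) => Set.disjoint_left.1 hXY hX hY
  rw [Set.disjoint_left]
  intro z hX hY
  rw [mem_drawnRegion] at hX hY
  rcases hX with ⟨x, hx, rfl⟩ | ⟨e, he, heX, hz⟩ <;> rcases hY with ⟨y, hy, hxy⟩ | ⟨f, hf, hfY, hz'⟩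
  · have := h.pos_injective hxy
    subst this
    exact hXY' _ hx hy
  · exact hXY' x hx (hfY x (h.vertex_on_arc f hf x hz'))
  · subst hxy
    exact hXY' y (heX y (h.vertex_on_arc e he y hz)) hy
  · have hne : e ≠ f := by
      rintro rfl
      induction e with | _ u v => exact hXY' u (heX u (by simp)) (hfY u (by simp))
    obtain ⟨w, ⟨hwe, hwf⟩, -⟩ := h.arc_inter e he f hf hne ⟨hz, hz'⟩
    exact hXY' w (heX w hwe) (hfY w hwf)

theorem IsPlanarDrawing.isCompact_drawnRegion [Finite V] (h : IsPlanarDrawing G pos arc)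
    (X : Set V) : IsCompact (drawnRegion G pos arc X) := by
  refine ((Set.toFinite X).image pos).isCompact.union ?_
  refine (Set.toFinite _).isCompact_biUnion fun e he => ?_
  have he1 := he.1
  induction e with | _ u v => exact (h.arc_joins u v he1).isCompact

theorem IsPlanarDrawing.joinedIn_drawnRegion (h : IsPlanarDrawing G pos arc) {X : Set V}
    {u v : V} (huv : G.Adj u v) (hu : u ∈ X) (hv : v ∈ X) :
    JoinedIn (drawnRegion G pos arc X) (pos u) (pos v) := by
  refine (h.arc_joins u v huv).joinedIn.mono fun z hz => ?_
  rw [mem_drawnRegion]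
  refine Or.inr ⟨s(u, v), huv, fun w hw => ?_, hz⟩
  rcases Sym2.mem_iff.1 hw with rfl | rfl <;> assumption

/-! ### Access to all vertices from the outer face -/

/-- There is a point that can be joined to each vertex `x` by a curve that avoids everything in
the drawing except `x` and edges at `x`. -/
theorem IsPlanarDrawing.exists_apex [Finite V] (h : IsPlanarDrawing G pos arc)
    (ho : ∀ v : V, pos v ∈ closure (outerFace (drawingSet G pos arc))) :
    ∃ z : ℝ × ℝ, ∀ x : V, ∃ S, JoinedIn S z (pos x) ∧
      ∀ X : Set V, x ∉ X → Disjoint S (drawnRegion G pos arc X) := by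
  have hcomp : IsCompact (drawingSet G pos arc) := by
    rw [← drawnRegion_univ]; exact h.isCompact_drawnRegion _
  obtain ⟨R, hR0, hR⟩ := hcomp.isBounded.exists_pos_norm_le
  set D := drawingSet G pos arc with hD
  set O := {z : ℝ × ℝ | R < ‖z‖} with hO
  have hOpre : IsPreconnected O := isPreconnected_norm_gt hR0.le
  have hOD : O ⊆ Dᶜ := fun z hz hzD => absurd (hR z hzD) (not_le.2 hz)
  -- A fixed point outside a ball that contains the whole drawing.
  refine ⟨(R + 1, 0), fun x => ?_⟩
  have hz : ((R + 1, 0) : ℝ × ℝ) ∈ O := by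
    have : R + 1 ≤ ‖((R + 1, 0) : ℝ × ℝ)‖ := by
      refine le_trans (le_abs_self _) ?_
      rw [← Real.norm_eq_abs]
      exact norm_fst_le ((R + 1, 0) : ℝ × ℝ)
    show R < _
    linarith
  have hx : pos x ∉ drawnRegion G pos arc {x}ᶜ := by
    have hdis := h.disjoint_drawnRegion (X := {x}) (Y := {x}ᶜ) disjoint_compl_right
    exact Set.disjoint_left.1 hdis (mem_drawnRegion.2 (Or.inl ⟨x, rfl, rfl⟩))
  -- A ball around `pos x` that misses everything in the drawing that is not incident with x; the
  -- outer face enters this ball.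
  obtain ⟨ε, hε, hball⟩ := Metric.isOpen_iff.1
    (h.isCompact_drawnRegion {x}ᶜ).isClosed.isOpen_compl (pos x) hx
  obtain ⟨p, hpo, hpd⟩ := Metric.mem_closure_iff.1 (ho x) ε hε
  have hpo' : ¬ Bornology.IsBounded (connectedComponentIn Dᶜ p) := hpo
  have hpD : p ∈ Dᶜ := by
    by_contra hp
    rw [connectedComponentIn_eq_empty hp] at hpo'
    exact hpo' Bornology.isBounded_empty
  obtain ⟨q, hq, hqO⟩ : ∃ q ∈ connectedComponentIn Dᶜ p, q ∈ O := by
    by_contra hcon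
    push Not at hcon
    refine hpo' ((Metric.isBounded_closedBall (x := (0 : ℝ × ℝ)) (r := R)).subset fun q hq => ?_)
    have := hcon q hq
    simp only [hO, Set.mem_ofPred_eq, not_lt] at this
    simpa using this
  -- An unbounded component leaves the ball of radius R, and the exterior of this ball is connected
  -- and free of the drawing; so every such component contains the apex.
  have hzC : ((R + 1, 0) : ℝ × ℝ) ∈ connectedComponentIn Dᶜ p := by
    rw [connectedComponentIn_eq hq]
    exact hOpre.subset_connectedComponentIn hqO hOD hz
  have hCo : IsOpen (connectedComponentIn Dᶜ p) := hcomp.isClosed.isOpen_compl.connectedComponentIn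
  have hCc : IsConnected (connectedComponentIn Dᶜ p) := isConnected_connectedComponentIn_iff.2 hpD
  have hpath := hCo.isConnected_iff_isPathConnected.1 hCc
  have hj1 := hpath.joinedIn _ hzC p (mem_connectedComponentIn hpD)
  have hj2 : JoinedIn (Metric.ball (pos x) ε) p (pos x) :=
    JoinedIn.of_segment_subset ((convex_ball _ _).segment_subset
      (by rw [Metric.mem_ball']; exact hpd) (Metric.mem_ball_self hε))
  refine ⟨_, (hj1.mono Set.subset_union_left).trans (hj2.mono Set.subset_union_right), ?_⟩
  intro X hX
  have hsub : drawnRegion G pos arc X ⊆ drawnRegion G pos arc {x}ᶜ :=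
    drawnRegion_mono fun v hv hvx => hX (by rwa [Set.mem_singleton_iff.1 hvx] at hv)
  rw [Set.disjoint_union_left]
  constructor
  · refine Set.disjoint_left.2 fun v hv hvX => connectedComponentIn_subset _ _ hv ?_
    rw [hD, ← drawnRegion_univ]
    exact drawnRegion_mono (Set.subset_univ _) hvX
  · exact Set.disjoint_left.2 fun v hv hvX => hball hv (hsub hvX)

/-- In an outerplanar drawing there are no two vertices `a i` with three vertices `y j` and
connections between all `a i` and `y j` that are disjoint for disjoint pairs of ends. -/
theorem IsPlanarDrawing.not_outer_K23 [Finite V] (h : IsPlanarDrawing G pos arc)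
    (ho : ∀ v : V, pos v ∈ closure (outerFace (drawingSet G pos arc)))
    (a b : V) (y : Fin 3 → V) (X Y : Fin 3 → Set V)
    (hX : ∀ j, JoinedIn (drawnRegion G pos arc (X j)) (pos a) (pos (y j)))
    (hY : ∀ j, JoinedIn (drawnRegion G pos arc (Y j)) (pos b) (pos (y j)))
    (hXY : ∀ j j', j ≠ j' → Disjoint (X j) (Y j'))
    (hyX : ∀ j j', j ≠ j' → y j ∉ X j') (hyY : ∀ j j', j ≠ j' → y j ∉ Y j') : False := by
  obtain ⟨z, hz⟩ := h.exists_apex ho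
  choose S hS hSd using hz
  have hXYd := fun j j' hj => h.disjoint_drawnRegion (hXY j j' hj)
  -- The apex joins a and b as the third vertex of its side.
  refine not_joinedIn_K33 ![pos a, pos b, z] (fun j => pos (y j))
    ![fun j => drawnRegion G pos arc (X j), fun j => drawnRegion G pos arc (Y j),
      fun j => S (y j)] ?_ ?_
  · intro i j
    fin_cases i
    · exact hX j
    · exact hY j
    · exact hS _
  · intro i i' j j' hi hj
    fin_cases i <;> fin_cases i' <;> first | exact absurd rfl hi | skip
    · exact hXYd j j' hj
    · exact (hSd _ _ (hyX j' j hj.symm)).symm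
    · exact (hXYd j' j hj.symm).symm
    · exact (hSd _ _ (hyY j' j hj.symm)).symm
    · exact hSd _ _ (hyX j j' hj)
    · exact hSd _ _ (hyY j j' hj)

/-- In an outerplanar drawing there are no four vertices with six connections between them that
are disjoint for disjoint pairs of ends. -/
theorem IsPlanarDrawing.not_outer_K4 [Finite V] (h : IsPlanarDrawing G pos arc)
    (ho : ∀ v : V, pos v ∈ closure (outerFace (drawingSet G pos arc)))
    (x : Fin 4 → V) (X : Fin 4 → Fin 4 → Set V)
    (hX : ∀ i j, i < j → JoinedIn (drawnRegion G pos arc (X i j)) (pos (x i)) (pos (x j)))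
    (hXd : ∀ i j i' j', i < j → i' < j' → i < i' → i' ≠ j → j ≠ j' → Disjoint (X i j) (X i' j'))
    (hx : ∀ i j k, i < j → k ≠ i → k ≠ j → x k ∉ X i j) : False := by
  obtain ⟨z, hz⟩ := h.exists_apex ho
  choose S hS hSd using hz
  -- Index 4 is the apex. Connections are needed only for i < j, so the values ∅ are never used.
  refine not_joinedIn_K5 (fun i => if hi : (i : ℕ) < 4 then pos (x ⟨i, hi⟩) else z)
    (fun i j => if hj : (j : ℕ) < 4 then if hi : (i : ℕ) < 4 then
      drawnRegion G pos arc (X ⟨i, hi⟩ ⟨j, hj⟩) else ∅ else if hi : (i : ℕ) < 4 then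
      S (x ⟨i, hi⟩) else ∅) ?_ ?_
  · intro i j hij
    have hi : (i : ℕ) < 4 := by omega
    by_cases hj : (j : ℕ) < 4
    · simpa [hj, hi] using hX ⟨i, hi⟩ ⟨j, hj⟩ hij
    · simpa [hj, hi] using (hS (x ⟨i, hi⟩)).symm
  · intro i j i' j' hij hij' hii hi'j hjj
    have hi : (i : ℕ) < 4 := by omega
    have hi' : (i' : ℕ) < 4 := by omega
    by_cases hj : (j : ℕ) < 4
    · by_cases hj' : (j' : ℕ) < 4
      · simp only [hj, hi, hj', hi', dif_pos]
        exact h.disjoint_drawnRegion (hXd _ _ _ _ hij hij' hii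
          (by simpa [Fin.ext_iff] using hi'j) (by simpa [Fin.ext_iff] using hjj))
      · simp only [hj, hi, hj', hi', dif_pos, dif_neg, not_false_eq_true]
        exact (hSd _ _ (hx _ _ _ hij (by simpa [Fin.ext_iff] using (Fin.ne_of_lt hii).symm)
          (by simpa [Fin.ext_iff] using hi'j))).symm
    · have hj' : (j' : ℕ) < 4 := by
        have := Fin.val_ne_of_ne hjj
        omega
      simp only [hj, hi, hj', hi', dif_pos, dif_neg, not_false_eq_true]
      exact hSd _ _ (hx _ _ _ hij' (by simpa [Fin.ext_iff] using (Fin.ne_of_lt hii))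
          (by
            have := lt_trans hii hij'
            simpa [Fin.ext_iff] using (Fin.ne_of_lt this)))

end OuterDrawing

/-! ## Outerplanar graphs are Hamiltonian cycles with non-crossing chords -/

section Hamiltonian

/-- `o 0, …, o (k - 1)` is a cycle for the relation `R` (a single edge if `k = 2`). -/
structure IsCyc {V : Type*} (R : V → V → Prop) (k : ℕ) (o : ℕ → V) : Prop where
  two_le : 2 ≤ k
  inj : ∀ i < k, ∀ j < k, o i = o j → i = j
  cons : ∀ i, i + 1 < k → R (o i) (o (i + 1))
  close : R (o (k - 1)) (o 0)

/-- `o 0, …, o (k - 1)` is a Hamiltonian cycle with non-crossing chords for the relation `R`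
restricted to these elements. -/
structure CycOrder {V : Type*} (R : V → V → Prop) (k : ℕ) (o : ℕ → V) : Prop
    extends IsCyc R k o where
  symm : ∀ i < k, ∀ j < k, R (o i) (o j) → R (o j) (o i)
  irrefl : ∀ i < k, ¬ R (o i) (o i)
  closed : ∀ i < k, ∀ x, R (o i) x → ∃ j < k, o j = x
  nc : ∀ a b c d, a < b → b < c → c < d → d < k → ¬ (R (o a) (o c) ∧ R (o b) (o d))

theorem IsCyc.rotate {V : Type*} {R : V → V → Prop} {k : ℕ} {o : ℕ → V} (h : IsCyc R k o)
    {r : ℕ} (hr : r < k) : IsCyc R k fun i => o (if i + r < k then i + r else i + r - k) := by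
  have h2 := h.two_le
  refine ⟨h2, fun i hi j hj hij => ?_, fun i hi => ?_, ?_⟩
  · have := h.inj _ (by split_ifs <;> omega) _ (by split_ifs <;> omega) hij
    split_ifs at this <;> omega
  · rcases lt_trichotomy (i + r + 1) k with hc | hc | hc
    · rw [if_pos (by omega), if_pos (by omega), show i + 1 + r = i + r + 1 by omega]
      exact h.cons _ hc
    · rw [if_pos (by omega), if_neg (by omega), show i + 1 + r - k = 0 by omega,
        show i + r = k - 1 by omega]
      exact h.close
    · rw [if_neg (by omega), if_neg (by omega), show i + 1 + r - k = i + r - k + 1 by omega]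
      exact h.cons _ (by omega)
  · rcases Nat.eq_zero_or_pos r with rfl | hpos
    · rw [if_pos (by omega), if_pos (by omega)]
      exact h.close
    · rw [if_neg (by omega), if_pos (by omega), show k - 1 + r - k = r - 1 by omega,
        show 0 + r = r - 1 + 1 by omega]
      exact h.cons _ (by omega)

theorem IsCyc.le_card {V : Type*} [Finite V] {R : V → V → Prop} {k : ℕ} {o : ℕ → V}
    (h : IsCyc R k o) : k ≤ Nat.card V := by
  have : Function.Injective fun i : Fin k => o i := fun i j hij =>
    Fin.ext (h.inj _ i.2 _ j.2 hij)
  simpa using Nat.card_le_card_of_injective _ this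

variable {V : Type*} {G : SimpleGraph V}

/-- The walk is cut at its first entry into `C`. It avoids `c` throughout, so the entry vertex is
not `c`. -/
theorem exists_outside_path {C : Set V} {c : V} (H : SimpleGraph ({c}ᶜ : Set V))
    (hH : ∀ x y, H.Adj x y → G.Adj x y) {x y : ({c}ᶜ : Set V)} (p : H.Walk x y)
    (hx : (x : V) ∉ C) (hy : (y : V) ∈ C) :
    ∃ (s : ℕ) (f : ℕ → V), f 0 = x ∧ (∀ i < s, G.Adj (f i) (f (i + 1))) ∧ (∀ i ≤ s, f i ∉ C) ∧
      ∃ d ∈ C, d ≠ c ∧ G.Adj (f s) d := by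
  induction p with
  | nil => exact absurd hy hx
  | @cons u v w huv p ih =>
    by_cases hv : (v : V) ∈ C
    · exact ⟨0, fun _ => u, rfl, by simp, by simpa using hx, v, hv, v.2, hH _ _ huv⟩
    · obtain ⟨s, f, h0, h1, h2, h3⟩ := ih hv hy
      refine ⟨s + 1, fun i => if i = 0 then u else f (i - 1), by simp, fun i hi => ?_,
        fun i hi => ?_, by simpa using h3⟩
      · rcases Nat.eq_zero_or_pos i with rfl | hpos
        · simpa [h0] using hH _ _ huv
        · have := h1 (i - 1) (by omega)
          rw [show i - 1 + 1 = i by omega] at this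
          simpa [hpos.ne'] using this
      · rcases Nat.eq_zero_or_pos i with rfl | hpos
        · simpa using hx
        · simpa [hpos.ne'] using h2 (i - 1) (by omega)

/-- Between two visits of the same vertex the sequence can be shortened without changing its first
and last vertex; induction on the length. -/
theorem exists_injective_outside_path {C : Set V} {c : V} {x : V} {s : ℕ} {f : ℕ → V}
    (h0 : f 0 = x) (h1 : ∀ i < s, G.Adj (f i) (f (i + 1))) (h2 : ∀ i ≤ s, f i ∉ C)
    (h3 : ∃ d ∈ C, d ≠ c ∧ G.Adj (f s) d) :
    ∃ (s : ℕ) (f : ℕ → V), f 0 = x ∧ (∀ i < s, G.Adj (f i) (f (i + 1))) ∧ (∀ i ≤ s, f i ∉ C) ∧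
      (∃ d ∈ C, d ≠ c ∧ G.Adj (f s) d) ∧ ∀ i ≤ s, ∀ j ≤ s, f i = f j → i = j := by
  induction s using Nat.strong_induction_on generalizing f with
  | _ s ih =>
    by_cases hinj : ∀ i ≤ s, ∀ j ≤ s, f i = f j → i = j
    · exact ⟨s, f, h0, h1, h2, h3, hinj⟩
    · obtain ⟨i, j, hij, hj, heq⟩ : ∃ i j, i < j ∧ j ≤ s ∧ f i = f j := by
        push Not at hinj
        obtain ⟨i, hi, j, hj, heq, hne⟩ := hinj
        rcases Nat.lt_or_gt_of_ne hne with h | h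
        · exact ⟨i, j, h, hj, heq⟩
        · exact ⟨j, i, h, hi, heq.symm⟩
      refine ih (s - (j - i)) (by omega) (f := fun t => if t ≤ i then f t else f (t + (j - i)))
        (by simp [h0]) (fun t ht => ?_) (fun t ht => ?_) ?_
      · rcases lt_trichotomy t i with h | h | h
        · rw [if_pos h.le, if_pos (by omega)]
          exact h1 _ (by omega)
        · subst h
          rw [if_pos le_rfl, if_neg (by omega), heq, show t + 1 + (j - t) = j + 1 by omega]
          exact h1 _ (by omega)
        · rw [if_neg (by omega), if_neg (by omega), show t + 1 + (j - i) = t + (j - i) + 1 by omega]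
          exact h1 _ (by omega)
      · split_ifs
        · exact h2 _ (by omega)
        · exact h2 _ (by omega)
      · have : (if s - (j - i) ≤ i then f (s - (j - i)) else f (s - (j - i) + (j - i))) = f s := by
          split_ifs with h
          · rw [show s - (j - i) = i by omega, heq, show j = s by omega]
          · rw [show s - (j - i) + (j - i) = s by omega]
        simpa only [this] using h3

/-- Connectedness gives an edge that leaves the cycle at some `o a`. Since `o a` is not a cut
vertex, its outer end can still reach another cycle vertex in the graph without `o a`, so the first
return to the cycle happens elsewhere. -/
theorem Biconnected.exists_ear [Finite V] (hG : Biconnected G) {k : ℕ} {o : ℕ → V}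
    (h : IsCyc G.Adj k o) (hk : k < Nat.card V) :
    ∃ (a b s : ℕ) (f : ℕ → V), a < k ∧ b < k ∧ a ≠ b ∧ G.Adj (o a) (f 0) ∧
      (∀ i < s, G.Adj (f i) (f (i + 1))) ∧ (∀ i ≤ s, ∀ j < k, f i ≠ o j) ∧
      G.Adj (f s) (o b) ∧ ∀ i ≤ s, ∀ j ≤ s, f i = f j → i = j := by
  have h2 := h.two_le
  set C : Set V := o '' Set.Iio k with hC
  have hCcard : C.ncard ≤ k := by
    have := Set.ncard_image_le (f := o) (Set.finite_Iio k)
    rwa [Set.ncard_eq_toFinset_card' (Set.Iio k), Set.toFinset_Iio, Nat.card_Iio] at this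
  obtain ⟨y, hy⟩ : ∃ y, y ∉ C := by
    by_contra hcon
    push Not at hcon
    have : C = Set.univ := Set.eq_univ_of_forall hcon
    rw [this, Set.ncard_univ] at hCcard
    omega
  have h0C : o 0 ∈ C := ⟨0, by simp; omega, rfl⟩
  obtain ⟨p⟩ := hG.1.preconnected (o 0) y
  obtain ⟨d, -, hd1, hd2⟩ := p.exists_boundary_dart C h0C hy
  obtain ⟨a, ha, hao⟩ := hd1
  have hd := d.adj
  rw [← hao] at hd
  have ha' : a < k := ha
  set a' := if a = 0 then 1 else 0 with ha'def
  have haa : a' < k ∧ a' ≠ a := by rw [ha'def]; split_ifs <;> omega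
  have hne1 : d.snd ≠ o a := fun hcon => hd2 (hcon ▸ ⟨a, ha, rfl⟩)
  have hne2 : o a' ≠ o a := fun hcon => haa.2 (h.inj _ haa.1 _ ha' hcon)
  obtain ⟨q⟩ := hG.2 (o a) ⟨d.snd, hne1⟩ ⟨o a', hne2⟩
  obtain ⟨s, f, g0, g1, g2, g3⟩ := exists_outside_path (G := G) (C := C) _ (fun x y hxy => hxy) q hd2
    ⟨a', haa.1, rfl⟩
  obtain ⟨s, f, g0, g1, g2, ⟨e, ⟨b, hb, rfl⟩, he1, he2⟩, g4⟩ :=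
    exists_injective_outside_path g0 g1 g2 g3
  refine ⟨a, b, s, f, ha', hb, fun hab => he1 (by rw [hab]), by rw [g0]; exact hd, g1,
    fun i hi j hj heq => g2 i hi ⟨j, hj, heq.symm⟩, he2, g4⟩

theorem IsCyc.insert_ear {k : ℕ} {o : ℕ → V} (h : IsCyc G.Adj k o) {s : ℕ} {f : ℕ → V}
    (g0 : G.Adj (o (k - 1)) (f 0)) (g1 : ∀ i < s, G.Adj (f i) (f (i + 1)))
    (g2 : ∀ i ≤ s, ∀ j < k, f i ≠ o j) (g3 : G.Adj (f s) (o 0))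
    (g4 : ∀ i ≤ s, ∀ j ≤ s, f i = f j → i = j) :
    IsCyc G.Adj (k + s + 1) fun i => if i < k then o i else f (i - k) := by
  have h2 := h.two_le
  refine ⟨by omega, fun i hi j hj hij => ?_, fun i hi => ?_, ?_⟩
  · split_ifs at hij with h1 h3 h3
    · exact h.inj _ h1 _ h3 hij
    · exact absurd hij.symm (g2 _ (by omega) _ h1)
    · exact absurd hij (g2 _ (by omega) _ h3)
    · have := g4 _ (by omega) _ (by omega) hij
      omega
  · rcases lt_trichotomy (i + 1) k with hc | hc | hc
    · rw [if_pos (by omega), if_pos hc]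
      exact h.cons _ hc
    · rw [if_pos (by omega), if_neg (by omega), show i = k - 1 by omega,
        show k - 1 + 1 - k = 0 by omega]
      exact g0
    · rw [if_neg (by omega), if_neg (by omega), show i + 1 - k = i - k + 1 by omega]
      exact g1 _ (by omega)
  · rw [if_neg (by omega), if_pos (by omega), show k + s + 1 - 1 - k = s by omega]
    exact g3

/-- The old vertex `o (k - 2)` becomes the first one. So an ear from `o (k - 1)` to `o (k - 2)` also
becomes one that replaces the closing edge. -/
theorem IsCyc.reverse_keep_last {k : ℕ} {o : ℕ → V} (h : IsCyc G.Adj k o) :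
    IsCyc G.Adj k fun i => if i < k - 1 then o (k - 2 - i) else o (k - 1) := by
  have h2 := h.two_le
  refine ⟨h2, fun i hi j hj hij => ?_, fun i hi => ?_, ?_⟩
  · split_ifs at hij
    · have := h.inj _ (by omega) _ (by omega) hij; omega
    · have := h.inj _ (by omega) _ (by omega) hij; omega
    · have := h.inj _ (by omega) _ (by omega) hij; omega
    · omega
  · by_cases hc : i + 1 < k - 1
    · rw [if_pos (by omega), if_pos hc]
      have := h.cons (k - 2 - (i + 1)) (by omega)
      rw [show k - 2 - (i + 1) + 1 = k - 2 - i by omega] at this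
      exact this.symm
    · rw [if_pos (by omega), if_neg hc, show k - 2 - i = 0 by omega]
      exact h.close.symm
  · rw [if_neg (by omega), if_pos (by omega)]
    have := h.cons (k - 2) (by omega)
    rw [show k - 2 + 1 = k - 1 by omega] at this
    exact this.symm

variable {pos : V → ℝ × ℝ} {arc : Sym2 V → Set (ℝ × ℝ)}

theorem IsPlanarDrawing.joinedIn_seq (h : IsPlanarDrawing G pos arc) {X : Set V} {o : ℕ → V}
    {i j : ℕ} (hij : i ≤ j) (ha : ∀ t, i ≤ t → t < j → G.Adj (o t) (o (t + 1)))
    (hX : ∀ t, i ≤ t → t ≤ j → o t ∈ X) :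
    JoinedIn (drawnRegion G pos arc X) (pos (o i)) (pos (o j)) := by
  induction j, hij using Nat.le_induction with
  | base => exact JoinedIn.refl (mem_drawnRegion.2 (Or.inl ⟨_, hX i le_rfl le_rfl, rfl⟩))
  | succ j hij ih =>
    exact (ih (fun t h1 h2 => ha t h1 (by omega)) (fun t h1 h2 => hX t h1 (by omega))).trans
      (h.joinedIn_drawnRegion (ha j hij (by omega)) (hX _ hij (by omega)) (hX _ (by omega) le_rfl))

/-- An ear between consecutive vertices of the cycle can be inserted. Any other ear forms, together
with the two arcs of the cycle, three internally disjoint paths with inner vertices, that is a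
subdivided K₂,₃. -/
theorem IsPlanarDrawing.exists_longer_cyc [Finite V] (h : IsPlanarDrawing G pos arc)
    (ho : ∀ v : V, pos v ∈ closure (outerFace (drawingSet G pos arc))) (hG : Biconnected G)
    {k : ℕ} {o : ℕ → V} (hcyc : IsCyc G.Adj k o) (hk : k < Nat.card V) :
    ∃ k' > k, ∃ o' : ℕ → V, IsCyc G.Adj k' o' := by
  obtain ⟨a, b, s, f, ha, hb, hab, g0, g1, g2, g3, g4⟩ := hG.exists_ear hcyc hk
  have h2 := hcyc.two_le
  -- The cycle is rotated so that the ear starts at the last vertex `o (k - 1)`.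
  obtain ⟨o, hcyc, b, hb, g0, g2, g3⟩ : ∃ o : ℕ → V, IsCyc G.Adj k o ∧ ∃ b < k - 1,
      G.Adj (o (k - 1)) (f 0) ∧ (∀ i ≤ s, ∀ j < k, f i ≠ o j) ∧ G.Adj (f s) (o b) := by
    have hr : (if a = k - 1 then 0 else a + 1) < k := by split_ifs <;> omega
    refine ⟨_, hcyc.rotate hr, if a = k - 1 then b else if a < b then b - a - 1 else k + b - a - 1,
      by split_ifs <;> omega, ?_, fun i hi j hj => g2 i hi _ (by split_ifs <;> omega), ?_⟩
    · convert g0 using 2; split_ifs <;> omega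
    · convert g3 using 2; split_ifs <;> omega
  rcases Nat.eq_zero_or_pos b with rfl | hb0
  · exact ⟨k + s + 1, by omega, _, hcyc.insert_ear g0 g1 g2 g3 g4⟩
  rcases eq_or_ne b (k - 2) with hb1 | hb1
  · refine ⟨k + s + 1, by omega, _, hcyc.reverse_keep_last.insert_ear ?_ g1 ?_ ?_ g4⟩
    · simpa using g0
    · intro i hi j hj
      split_ifs
      · exact g2 _ hi _ (by omega)
      · exact g2 _ hi _ (by omega)
    · rw [if_pos (by omega), show k - 2 - 0 = b by omega]
      exact g3
  exfalso
  have hi := hcyc.inj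
  -- The three middle vertices are the neighbours of `o (k - 1)` on the three paths, so the
  -- connections at this end are single edges and those at `o b` are the remaining parts of the
  -- paths.
  refine h.not_outer_K23 ho (o (k - 1)) (o b) ![o 0, o (k - 2), f 0]
    ![{o (k - 1), o 0}, {o (k - 1), o (k - 2)}, {o (k - 1), f 0}]
    ![o '' Set.Icc 0 b, o '' Set.Icc b (k - 2), insert (o b) (f '' Set.Icc 0 s)] ?_ ?_ ?_ ?_ ?_
  · intro j
    fin_cases j
    · exact h.joinedIn_drawnRegion hcyc.close (by simp) (by simp)
    · refine h.joinedIn_drawnRegion ?_ (by simp) (by simp)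
      have := hcyc.cons (k - 2) (by omega)
      rw [show k - 2 + 1 = k - 1 by omega] at this
      exact this.symm
    · exact h.joinedIn_drawnRegion g0 (by simp) (by simp)
  · intro j
    fin_cases j
    · exact (h.joinedIn_seq (X := o '' Set.Icc 0 b) (i := 0) (j := b) (Nat.zero_le _)
        (fun t _ ht => hcyc.cons t (by omega))
        fun t _ ht => ⟨t, ⟨Nat.zero_le _, ht⟩, rfl⟩).symm
    · exact h.joinedIn_seq (by omega) (fun t _ ht => hcyc.cons t (by omega))
        fun t h1 ht => ⟨t, ⟨h1, ht⟩, rfl⟩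
    · refine (h.joinedIn_drawnRegion g3.symm (by simp) ?_).trans (h.joinedIn_seq (i := 0) (j := s)
        (Nat.zero_le _) (fun t _ ht => g1 t (by omega))
        fun t _ ht => Or.inr ⟨t, ⟨Nat.zero_le _, ht⟩, rfl⟩).symm
      exact Or.inr ⟨s, ⟨Nat.zero_le _, le_rfl⟩, rfl⟩
  · intro j j' hj
    rw [Set.disjoint_left]
    have key1 : ∀ i c d, i < k → c ≤ d → d < k → o i ∈ o '' Set.Icc c d → c ≤ i ∧ i ≤ d := by
      rintro i c d hik hcd hd ⟨t, ⟨h1, h2⟩, ht⟩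
      have := hi _ (by omega) _ hik ht
      omega
    have key2 : ∀ i, i < k → o i ∈ insert (o b) (f '' Set.Icc 0 s) → i = b := by
      rintro i hik (ht | ⟨t, ⟨h1, h2⟩, ht⟩)
      · exact hi _ hik _ (by omega) ht
      · exact absurd ht (g2 _ h2 _ hik)
    have key3 : ∀ c d, d < k → f 0 ∉ o '' Set.Icc c d := by
      rintro c d hd ⟨t, ⟨h1, h2⟩, ht⟩
      exact g2 0 (Nat.zero_le _) t (by omega) ht.symm
    fin_cases j <;> fin_cases j' <;> first | exact absurd rfl hj | skip
    · rintro v (rfl | rfl) hv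
      · have := key1 _ _ _ (by omega) (by omega) (by omega) hv; omega
      · have := key1 _ _ _ (by omega) (by omega) (by omega) hv; omega
    · rintro v (rfl | rfl) hv
      · have := key2 _ (by omega) hv; omega
      · have := key2 _ (by omega) hv; omega
    · rintro v (rfl | rfl) hv
      · have := key1 _ _ _ (by omega) (by omega) (by omega) hv; omega
      · have := key1 _ _ _ (by omega) (by omega) (by omega) hv; omega
    · rintro v (rfl | rfl) hv
      · have := key2 _ (by omega) hv; omega
      · have := key2 _ (by omega) hv; omega
    · rintro v (rfl | rfl) hv
      · have := key1 _ _ _ (by omega) (by omega) (by omega) hv; omega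
      · exact key3 _ _ (by omega) hv
    · rintro v (rfl | rfl) hv
      · have := key1 _ _ _ (by omega) (by omega) (by omega) hv; omega
      · exact key3 _ _ (by omega) hv
  · intro j j' hj
    have e1 : ∀ a b, a < k → b < k → a ≠ b → o a ≠ o b := fun a b ha hb hab hc =>
      hab (hi _ ha _ hb hc)
    have e2 := g2 0 (Nat.zero_le _)
    fin_cases j <;> fin_cases j' <;> first | exact absurd rfl hj | skip
    · rintro (hv | hv)
      · exact e1 _ _ (by omega) (by omega) (by omega) hv
      · exact e1 _ _ (by omega) (by omega) (by omega) hv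
    · rintro (hv | hv)
      · exact e1 _ _ (by omega) (by omega) (by omega) hv
      · exact e2 _ (by omega) hv.symm
    · rintro (hv | hv)
      · exact e1 _ _ (by omega) (by omega) (by omega) hv
      · exact e1 _ _ (by omega) (by omega) (by omega) hv
    · rintro (hv | hv)
      · exact e1 _ _ (by omega) (by omega) (by omega) hv
      · exact e2 _ (by omega) hv.symm
    · rintro (hv | hv)
      · exact e2 _ (by omega) hv
      · exact e2 _ (by omega) hv
    · rintro (hv | hv)
      · exact e2 _ (by omega) hv
      · exact e2 _ (by omega) hv
  · intro j j' hj
    have e2 := g2 0 (Nat.zero_le _)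
    fin_cases j <;> fin_cases j' <;> first | exact absurd rfl hj | skip
    · rintro ⟨t, ⟨h1, h2⟩, ht⟩
      have := hi _ (by omega) _ (by omega) ht; omega
    · rintro (hv | ⟨t, ⟨h1, h2⟩, ht⟩)
      · have := hi _ (by omega) _ (by omega) hv; omega
      · exact g2 _ h2 _ (by omega) ht
    · rintro ⟨t, ⟨h1, h2⟩, ht⟩
      have := hi _ (by omega) _ (by omega) ht; omega
    · rintro (hv | ⟨t, ⟨h1, h2⟩, ht⟩)
      · have := hi _ (by omega) _ (by omega) hv; omega
      · exact g2 _ h2 _ (by omega) ht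
    · rintro ⟨t, ⟨h1, h2⟩, ht⟩
      exact e2 _ (by omega) ht.symm
    · rintro ⟨t, ⟨h1, h2⟩, ht⟩
      exact e2 _ (by omega) ht.symm

/-- The four ends, the four arcs of the cycle between them and the two chords form a subdivided K₄.
-/
theorem IsPlanarDrawing.not_crossing_chords [Finite V] (h : IsPlanarDrawing G pos arc)
    (ho : ∀ v : V, pos v ∈ closure (outerFace (drawingSet G pos arc)))
    {k : ℕ} {o : ℕ → V} (hcyc : IsCyc G.Adj k o) {a b c d : ℕ} (hab : a < b) (hbc : b < c)
    (hcd : c < d) (hd : d < k) : ¬ (G.Adj (o a) (o c) ∧ G.Adj (o b) (o d)) := by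
  rintro ⟨hac, hbd⟩
  have hi := hcyc.inj
  -- The positions used by the six connections; the arc between a and d passes through the closing
  -- edge and therefore consists of two intervals.
  let J : Fin 4 → Fin 4 → Set ℕ := ![![∅, Set.Icc a b, {a, c}, Set.Icc 0 a ∪ Set.Icc d (k - 1)],
    ![∅, ∅, Set.Icc b c, {b, d}], ![∅, ∅, ∅, Set.Icc c d], ![∅, ∅, ∅, ∅]]
  have hlt : ∀ i j : Fin 4, i < j → (i = 0 ∧ j = 1) ∨ (i = 0 ∧ j = 2) ∨ (i = 0 ∧ j = 3) ∨
      (i = 1 ∧ j = 2) ∨ (i = 1 ∧ j = 3) ∨ (i = 2 ∧ j = 3) := by decide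
  have hpair : ∀ i j i' j' : Fin 4, i < j → i' < j' → i < i' → i' ≠ j → j ≠ j' →
      (i = 0 ∧ j = 1 ∧ i' = 2 ∧ j' = 3) ∨ (i = 0 ∧ j = 2 ∧ i' = 1 ∧ j' = 3) ∨
      (i = 0 ∧ j = 3 ∧ i' = 1 ∧ j' = 2) := by decide
  have hJk : ∀ i j, ∀ t ∈ J i j, t < k := by
    intro i j t ht
    fin_cases i <;> fin_cases j <;> simp [J] at ht <;> omega
  refine h.not_outer_K4 ho ![o a, o b, o c, o d] (fun i j => o '' J i j) ?_ ?_ ?_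
  · intro i j hij
    have hmem : ∀ i j t, t ∈ J i j → o t ∈ o '' J i j := fun i j t ht => ⟨t, ht, rfl⟩
    rcases hlt i j hij with ⟨rfl, rfl⟩ | ⟨rfl, rfl⟩ | ⟨rfl, rfl⟩ | ⟨rfl, rfl⟩ | ⟨rfl, rfl⟩ |
      ⟨rfl, rfl⟩
    · exact h.joinedIn_seq hab.le (fun t _ ht => hcyc.cons t (by omega))
        fun t h1 ht => hmem _ _ _ ⟨h1, ht⟩
    · exact h.joinedIn_drawnRegion hac (hmem _ _ _ (Or.inl rfl)) (hmem _ _ _ (Or.inr rfl))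
    · refine (h.joinedIn_seq (i := 0) (j := a) (Nat.zero_le _)
        (fun t _ ht => hcyc.cons t (by omega))
        fun t h1 ht => hmem 0 3 _ (Or.inl ⟨h1, ht⟩)).symm.trans ?_
      refine (h.joinedIn_drawnRegion hcyc.close (hmem 0 3 _ (Or.inr ⟨by omega, le_rfl⟩))
        (hmem 0 3 _ (Or.inl ⟨le_rfl, Nat.zero_le _⟩))).symm.trans ?_
      exact (h.joinedIn_seq (i := d) (j := k - 1) (by omega)
        (fun t _ ht => hcyc.cons t (by omega))
        fun t h1 ht => hmem 0 3 _ (Or.inr ⟨h1, ht⟩)).symm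
    · exact h.joinedIn_seq hbc.le (fun t _ ht => hcyc.cons t (by omega))
        fun t h1 ht => hmem _ _ _ ⟨h1, ht⟩
    · exact h.joinedIn_drawnRegion hbd (hmem _ _ _ (Or.inl rfl)) (hmem _ _ _ (Or.inr rfl))
    · exact h.joinedIn_seq hcd.le (fun t _ ht => hcyc.cons t (by omega))
        fun t h1 ht => hmem _ _ _ ⟨h1, ht⟩
  · intro i j i' j' h1 h2 h3 h4 h5
    rw [Set.disjoint_left]
    rintro v ⟨t, ht, rfl⟩ ⟨u, hu, huv⟩
    have := hi _ (hJk _ _ _ hu) _ (hJk _ _ _ ht) huv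
    subst this
    rcases hpair i j i' j' h1 h2 h3 h4 h5 with ⟨rfl, rfl, rfl, rfl⟩ | ⟨rfl, rfl, rfl, rfl⟩ |
      ⟨rfl, rfl, rfl, rfl⟩ <;> simp [J] at ht hu <;> omega
  · rintro i j l hij hli hlj ⟨t, ht, htv⟩
    have hl : ∃ u < k, (![o a, o b, o c, o d] : Fin 4 → V) l = o u ∧
        u = (![a, b, c, d] : Fin 4 → ℕ) l := by
      fin_cases l
      · exact ⟨a, by omega, rfl, rfl⟩
      · exact ⟨b, by omega, rfl, rfl⟩
      · exact ⟨c, by omega, rfl, rfl⟩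
      · exact ⟨d, by omega, rfl, rfl⟩
    obtain ⟨u, hu, hlu, hul⟩ := hl
    rw [hlu] at htv
    have := hi _ (hJk _ _ _ ht) _ hu htv
    subst this
    rcases hlt i j hij with ⟨rfl, rfl⟩ | ⟨rfl, rfl⟩ | ⟨rfl, rfl⟩ | ⟨rfl, rfl⟩ | ⟨rfl, rfl⟩ |
      ⟨rfl, rfl⟩ <;> fin_cases l <;> simp [J] at ht hul hli hlj <;> omega

/-- Biconnected outerplanar graphs have a Hamiltonian cycle with non-crossing chords. -/
theorem exists_cycOrder {n : ℕ} (hn : 2 ≤ n) {G : SimpleGraph (Fin n)} (hG : Biconnected G)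
    (hout : Outerplanar G) : ∃ o : ℕ → Fin n, CycOrder G.Adj n o := by
  obtain ⟨pos, arc, h, ho⟩ := hout
  -- A single edge counts as a cycle of length two, which starts the enlargement.
  have hstart : ∃ o : ℕ → Fin n, IsCyc G.Adj 2 o := by
    have : Nontrivial (Fin n) := Fin.nontrivial_iff_two_le.2 hn
    obtain ⟨v, hv⟩ := hG.1.preconnected.exists_adj_of_nontrivial (⟨0, by omega⟩ : Fin n)
    refine ⟨fun i => if i = 0 then ⟨0, by omega⟩ else v, le_rfl, ?_, ?_, ?_⟩
    · intro i hi j hj hij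
      have := hv.ne
      interval_cases i <;> interval_cases j <;> simp_all
    · intro i hi
      have : i = 0 := by omega
      simpa [this] using hv
    · simpa using hv.symm
  have hmax : ∀ m k, n - k = m → (∃ o : ℕ → Fin n, IsCyc G.Adj k o) →
      ∃ o : ℕ → Fin n, IsCyc G.Adj n o := by
    intro m
    induction m using Nat.strong_induction_on with
    | _ m ih =>
      rintro k hkm ⟨o, hc⟩
      have hle := hc.le_card
      rw [Nat.card_fin] at hle
      rcases hle.eq_or_lt with rfl | hlt
      · exact ⟨o, hc⟩
      · obtain ⟨k', hk', o', hc'⟩ := h.exists_longer_cyc ho hG hc (by rwa [Nat.card_fin])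
        have hle' := hc'.le_card
        rw [Nat.card_fin] at hle'
        exact ih (n - k') (by omega) k' rfl ⟨o', hc'⟩
  obtain ⟨o, hc⟩ := hmax _ 2 rfl hstart
  refine ⟨o, hc, fun i _ j _ => SimpleGraph.Adj.symm, fun i _ => G.irrefl, ?_,
    fun a b c d h1 h2 h3 h4 => h.not_crossing_chords ho hc h1 h2 h3 h4⟩
  intro i _ x _
  have hinj : Function.Injective fun i : Fin n => o i := fun i j hij =>
    Fin.ext (hc.inj _ i.2 _ j.2 hij)
  obtain ⟨j, hj⟩ := (Finite.injective_iff_surjective.1 hinj) x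
  exact ⟨j, j.2, hj⟩

end Hamiltonian

/-! ## The layout of a Hamiltonian cycle with non-crossing chords -/

section Layout

/-- A relation on `{0, …, n - 1}` that consists of the cycle `0, …, n - 1` and non-crossing
chords. -/
structure ChordOrder (n : ℕ) (E : ℕ → ℕ → Prop) : Prop where
  three_le : 3 ≤ n
  symm : ∀ i j, E i j → E j i
  irrefl : ∀ i, ¬ E i i
  lt : ∀ i j, E i j → j < n
  cons : ∀ i, i + 1 < n → E i (i + 1)
  close : E 0 (n - 1)
  nc : ∀ a b c d, a < b → b < c → c < d → E a c → E b d → False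

/-- `p j` is the smallest neighbour of `j`. -/
structure IsMinNeighbour (n : ℕ) (E : ℕ → ℕ → Prop) (p : ℕ → ℕ) : Prop where
  adj : ∀ j, 1 ≤ j → j < n → E (p j) j
  le : ∀ i j, E i j → p j ≤ i

/-- The heights `y` of the drawing: the tree of the edges from `p j` to `j` is drawn with the
slopes `c j`, where `c j` is the number of tree edges that span over `j`. -/
structure IsLayout (n : ℕ) (p c y : ℕ → ℕ) : Prop where
  slope : ∀ j, 1 ≤ j → j < n → c j = {v ∈ Finset.range n | j < v ∧ p v < j}.card
  zero : y 0 = 0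
  height : ∀ j, 1 ≤ j → j < n → y j = y (p j) + c j * (j - p j)

variable {n : ℕ} {E : ℕ → ℕ → Prop} {p c y : ℕ → ℕ}

namespace IsMinNeighbour

theorem lt (hE : ChordOrder n E) (hp : IsMinNeighbour n E p) {j : ℕ} (h1 : 1 ≤ j) (hj : j < n) :
    p j < j := by
  have h := hE.cons (j - 1) (by omega)
  rw [show j - 1 + 1 = j by omega] at h
  have := hp.le _ _ h
  omega

/-- If p k ≠ i, then the tree edge to k passes over i. For two such upper ends of edges from i, the
tree edge to the smaller one would cross the edge to the larger one. So a non-tree edge is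
determined by its lower end. -/
theorem tree_or_unique (hE : ChordOrder n E) (hp : IsMinNeighbour n E p) {i k : ℕ} (hik : i < k)
    (h : E i k) : p k = i ∨ (p k < i ∧ 1 ≤ i ∧ i < n - 1 ∧
      ∀ k', E i k' → i < k' → p k' < i → k' = k) := by
  have hk := hE.lt _ _ h
  rcases (hp.le _ _ h).eq_or_lt with h1 | h1
  · exact Or.inl h1
  · refine Or.inr ⟨h1, by omega, by omega, fun k' h' hik' hpk' => ?_⟩
    have hk' := hE.lt _ _ h'
    rcases lt_trichotomy k' k with h2 | h2 | h2
    · exact (hE.nc _ _ _ _ hpk' hik' h2 (hp.adj k' (by omega) hk') h).elim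
    · exact h2
    · exact (hE.nc _ _ _ _ h1 hik h2 (hp.adj k (by omega) hk) h').elim

end IsMinNeighbour

/-- Every tree edge over k also passes over j, since one starting between p k and k would cross the
tree edge to k; and this tree edge itself passes over j but not over k. -/
theorem slope_lt_of_tree (hE : ChordOrder n E) (hp : IsMinNeighbour n E p)
    (hl : IsLayout n p c y) {j k : ℕ} (hk : k < n) (h1 : p k < j) (h2 : j < k) :
    c k + 1 ≤ c j := by
  rw [hl.slope k (by omega) hk, hl.slope j (by omega) (by omega)]
  rw [← Finset.card_insert_of_notMem (a := k) (s := {v ∈ Finset.range n | k < v ∧ p v < k})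
    (by simp)]
  refine Finset.card_le_card fun v hv => ?_
  simp only [Finset.mem_insert, Finset.mem_filter, Finset.mem_range] at hv ⊢
  rcases hv with rfl | ⟨hv1, hv2, hv3⟩
  · exact ⟨hk, h2, h1⟩
  · refine ⟨hv1, by omega, ?_⟩
    by_contra hcon
    exact hE.nc _ _ _ _ (by omega) hv3 hv2 (hp.adj k (by omega) hk) (hp.adj v (by omega) hv1)

/-- Going from j to its parent and further down, one stays under the tree edge to k until p k is
reached, by non-crossing. All slopes on the way exceed c k, so the heights grow faster than along
that edge. -/
theorem above_tree (hE : ChordOrder n E) (hp : IsMinNeighbour n E p)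
    (hl : IsLayout n p c y) {j k : ℕ} (hk : k < n) (h1 : p k < j) (h2 : j < k) :
    y (p k) + c k * (j - p k) < y j := by
  induction j using Nat.strong_induction_on with
  | _ j ih =>
    have hc := slope_lt_of_tree hE hp hl hk h1 h2
    have hpj := hp.lt hE (j := j) (by omega) (by omega)
    have hge : p k ≤ p j := by
      by_contra hcon
      exact hE.nc _ _ _ _ (by omega) h1 h2 (hp.adj j (by omega) (by omega))
        (hp.adj k (by omega) hk)
    rw [hl.height j (by omega) (by omega)]
    have hmul : (c k + 1) * (j - p j) ≤ c j * (j - p j) := Nat.mul_le_mul_right _ hc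
    rw [add_mul, one_mul] at hmul
    rcases hge.eq_or_lt with he | hlt
    · rw [← he] at hmul hpj ⊢
      omega
    · have := ih (p j) hpj hlt (by omega)
      have hs : c k * (j - p k) = c k * (p j - p k) + c k * (j - p j) := by
        rw [← mul_add]; congr 1; omega
      omega

/-- A tree edge over i with its upper end at or before j would cross the edge ik. -/
theorem slope_le_of_nontree (hE : ChordOrder n E) (hp : IsMinNeighbour n E p)
    (hl : IsLayout n p c y) {i j k : ℕ} (h : E i k) (h0 : 1 ≤ i) (h1 : i < j) (h2 : j < k) :
    c i ≤ c j := by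
  have hk := hE.lt _ _ h
  rw [hl.slope i h0 (by omega), hl.slope j (by omega) (by omega)]
  refine Finset.card_le_card fun v hv => ?_
  simp only [Finset.mem_filter, Finset.mem_range] at hv ⊢
  refine ⟨hv.1, ?_, by omega⟩
  by_contra hcon
  exact hE.nc _ _ _ _ hv.2.2 hv.2.1 (by omega) (hp.adj v (by omega) hv.1) h

/-- The parents of j lead down to i without leaving the range of the edge ik, and no slope on the
way is smaller than c i. -/
theorem above_nontree (hE : ChordOrder n E) (hp : IsMinNeighbour n E p)
    (hl : IsLayout n p c y) {i j k : ℕ} (h : E i k) (h0 : 1 ≤ i) (h1 : i ≤ j) (h2 : j < k) :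
    y i + c i * (j - i) ≤ y j := by
  have hk := hE.lt _ _ h
  induction j using Nat.strong_induction_on with
  | _ j ih =>
    rcases h1.eq_or_lt with rfl | h1
    · simp
    have hc := slope_le_of_nontree hE hp hl h h0 h1 h2
    have hpj := hp.lt hE (j := j) (by omega) (by omega)
    have hge : i ≤ p j := by
      by_contra hcon
      exact hE.nc _ _ _ _ (by omega) h1 h2 (hp.adj j (by omega) (by omega)) h
    rw [hl.height j (by omega) (by omega)]
    have hmul : c i * (j - p j) ≤ c j * (j - p j) := Nat.mul_le_mul_right _ hc
    have := ih (p j) hpj hge (by omega)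
    have hs : c i * (j - i) = c i * (p j - i) + c i * (j - p j) := by
      rw [← mul_add]; congr 1; omega
    omega

/-- Vertices under an edge of the order are drawn above the segment of this edge. -/
theorem above_edge (hE : ChordOrder n E) (hp : IsMinNeighbour n E p)
    (hl : IsLayout n p c y) {i j k : ℕ} (h : E i k) (h1 : i < j) (h2 : j < k) :
    ((y k : ℝ) - y i) * (j - i) < (y j - y i) * (k - i) := by
  have hk := hE.lt _ _ h
  have hji : (0 : ℝ) < (j : ℝ) - i := by rw [sub_pos]; exact_mod_cast h1
  have hki : (0 : ℝ) < (k : ℝ) - i := by rw [sub_pos]; exact_mod_cast h1.trans h2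
  rcases hp.tree_or_unique hE (h1.trans h2) h with ht | ⟨ht, h0, -, -⟩
  · subst ht
    have hj := above_tree hE hp hl hk h1 h2
    have hy := hl.height k (by omega) hk
    have hj' : (y (p k) : ℝ) + c k * (j - p k) < y j := by
      rw [← Nat.cast_sub h1.le]; exact_mod_cast hj
    have hy' : (y k : ℝ) = y (p k) + c k * (k - p k) := by
      rw [← Nat.cast_sub (h1.trans h2).le]; exact_mod_cast hy
    calc ((y k : ℝ) - y (p k)) * (j - p k) = (c k * (j - p k)) * (k - p k) := by rw [hy']; ring
      _ < (y j - y (p k)) * (k - p k) := by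
        apply mul_lt_mul_of_pos_right _ hki
        linarith
  -- The vertex i is above the tree edge to k, whose slope is smaller than c i; hence the edge ik
  -- has slope less than c i. The vertex j is on or above the ray of slope c i that starts at i.
  · have hj := above_nontree hE hp hl h h0 h1.le h2
    have hi := above_tree hE hp hl hk ht (h1.trans h2)
    have hc := slope_lt_of_tree hE hp hl hk ht (h1.trans h2)
    have hy := hl.height k (by omega) hk
    have hj' : (y i : ℝ) + c i * (j - i) ≤ y j := by
      rw [← Nat.cast_sub h1.le]; exact_mod_cast hj
    have hi' : (y (p k) : ℝ) + c k * (i - p k) < y i := by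
      rw [← Nat.cast_sub ht.le]; exact_mod_cast hi
    have hy' : (y k : ℝ) = y (p k) + c k * (k - p k) := by
      rw [← Nat.cast_sub (by omega)]; exact_mod_cast hy
    have hc' : (c k : ℝ) + 1 ≤ c i := by exact_mod_cast hc
    have hlt : (y k : ℝ) - y i < c i * (k - i) := by nlinarith
    calc ((y k : ℝ) - y i) * (j - i) < (c i * (k - i)) * (j - i) :=
          mul_lt_mul_of_pos_right hlt hji
      _ = (c i * (j - i)) * (k - i) := by ring
      _ ≤ (y j - y i) * (k - i) := mul_le_mul_of_nonneg_right (by linarith) hki.le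

theorem IsLayout.slope_le (hl : IsLayout n p c y) {j : ℕ} (h1 : 1 ≤ j) (hj : j < n) :
    c j ≤ n := by
  rw [hl.slope j h1 hj]
  exact (Finset.card_filter_le _ _).trans (by simp)

/-- Slopes are at most n and the horizontal steps from 0 to j along the tree add up to j. This is
the quadratic side of the grid. -/
theorem IsLayout.height_le (hE : ChordOrder n E) (hp : IsMinNeighbour n E p)
    (hl : IsLayout n p c y) {j : ℕ} (hj : j < n) : y j ≤ n * j := by
  induction j using Nat.strong_induction_on with
  | _ j ih =>
    rcases Nat.eq_zero_or_pos j with rfl | h1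
    · simp [hl.zero]
    · have hpj := hp.lt hE h1 hj
      have := ih (p j) hpj (by omega)
      have hm := Nat.mul_le_mul_right (j - p j) (hl.slope_le h1 hj)
      have hs : n * j = n * p j + n * (j - p j) := by
        rw [← mul_add]; congr 1; omega
      rw [hl.height j h1 hj]
      omega

/-! ### Aligned tree edges and the number of vertices with children -/

/-- The largest tree child of `i` is drawn in the direction of the tree edge to `i`. -/
theorem slope_eq_of_last_child (hE : ChordOrder n E) (hp : IsMinNeighbour n E p)
    (hl : IsLayout n p c y) {i m : ℕ} (h0 : 1 ≤ i) (hm : m < n) (him : i < m) (hpm : p m = i)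
    (hlast : ∀ j, m < j → j < n → p j ≠ i) : c m = c i := by
  rw [hl.slope i h0 (by omega), hl.slope m (by omega) hm]
  congr 1
  ext v
  simp only [Finset.mem_filter, Finset.mem_range]
  have ha := hp.adj m (by omega) hm
  rw [hpm] at ha
  -- A tree edge over m starts before i, and a tree edge over i ends after m; otherwise it would
  -- cross the edge im. Edges that start at i itself are excluded because m is the last child.
  constructor
  · rintro ⟨h1, h2, h3⟩
    refine ⟨h1, by omega, ?_⟩
    have hv := hp.adj v (by omega) h1
    have hne := hlast v h2 h1
    by_contra hcon
    exact hE.nc _ _ _ _ (by omega) h3 h2 ha hv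
  · rintro ⟨h1, h2, h3⟩
    have hv := hp.adj v (by omega) h1
    refine ⟨h1, ?_, by omega⟩
    have hne : v ≠ m := by rintro rfl; omega
    by_contra hcon
    exact hE.nc _ _ _ _ h3 h2 (by omega) hv ha

/-- Reading the cycle backwards gives a second tree; together the two trees have at least `n - 3`
vertices, not counting the ends of the order, that have children. -/
theorem card_inner_add_card_inner (hE : ChordOrder n E) {E' : ℕ → ℕ → Prop} {p' : ℕ → ℕ}
    (hE' : ChordOrder n E') (hrev : ∀ i < n, ∀ j < n, E' i j → E (n - 1 - i) (n - 1 - j))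
    (hp : IsMinNeighbour n E p) (hp' : IsMinNeighbour n E' p') :
    n - 3 ≤ {a ∈ Finset.range (n - 2) | p (a + 2) = a + 1}.card +
      {a ∈ Finset.range (n - 2) | p' (a + 2) = a + 1}.card := by
  have h3 := hE.three_le
  have e1 := Finset.card_filter_add_card_filter_not (s := Finset.range (n - 2))
    (fun a => p (a + 2) = a + 1)
  have e2 := Finset.card_filter_add_card_filter_not (s := Finset.range (n - 2))
    (fun a => p' (a + 2) = a + 1)
  rw [Finset.card_range] at e1 e2
  set A := {a ∈ Finset.range (n - 2) | ¬ p (a + 2) = a + 1} with hA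
  set B := {a ∈ Finset.range (n - 2) | ¬ p' (a + 2) = a + 1} with hB
  have hAc : (A.image fun a => a + 1).card = A.card :=
    Finset.card_image_of_injective _ (add_left_injective 1)
  have hBc : (B.image fun a => n - 3 - a).card = B.card := by
    refine Finset.card_image_of_injOn fun a ha b hb hab => ?_
    simp only [hB, Finset.coe_filter, Set.mem_ofPred_eq, Finset.mem_range] at ha hb
    omega
  -- Consider the gap between t and t + 1. It comes from `A` if t + 1 has a neighbour before t, and
  -- from `B`, read in the original order, if t has a neighbour after t + 1; both together are
  -- crossing chords. So |A| + |B| is at most the number n - 1 of gaps, out of 2 (n - 2).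
  have hdis : Disjoint (A.image fun a => a + 1) (B.image fun a => n - 3 - a) := by
    rw [Finset.disjoint_left]
    rintro t ht ht'
    obtain ⟨a, ha, rfl⟩ := Finset.mem_image.1 ht
    obtain ⟨b, hb, hab⟩ := Finset.mem_image.1 ht'
    simp only [hA, hB, Finset.mem_filter, Finset.mem_range] at ha hb
    have l1 := hp.lt hE (j := a + 2) (by omega) (by omega)
    have l2 := hp'.lt hE' (j := b + 2) (by omega) (by omega)
    have hadj := hp.adj (a + 2) (by omega) (by omega)
    have hadj' := hrev _ (by omega) _ (by omega) (hp'.adj (b + 2) (by omega) (by omega))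
    have hadj2 := hE.symm _ _ hadj'
    rw [show n - 1 - (b + 2) = a + 1 by omega] at hadj2
    exact hE.nc (p (a + 2)) (a + 1) (a + 2) (n - 1 - p' (b + 2)) (by omega) (by omega) (by omega)
      hadj hadj2
  have hle : ((A.image fun a => a + 1) ∪ (B.image fun a => n - 3 - a)).card ≤ n - 1 := by
    refine (Finset.card_le_card (t := Finset.range (n - 1)) fun t ht => ?_).trans (by simp)
    rw [Finset.mem_union, Finset.mem_image, Finset.mem_image] at ht
    rw [Finset.mem_range]
    rcases ht with ⟨a, ha, rfl⟩ | ⟨a, ha, rfl⟩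
    · simp only [hA, Finset.mem_filter, Finset.mem_range] at ha; omega
    · omega
  rw [Finset.card_union_of_disjoint hdis, hAc, hBc] at hle
  omega

end Layout

/-! ## The drawing of a graph -/

section Drawing

theorem mem_segment_line {a b z : ℝ × ℝ} (hab : a.1 < b.1) (hz : z ∈ segment ℝ a b) :
    a.1 ≤ z.1 ∧ z.1 ≤ b.1 ∧ (b.1 - a.1) * (z.2 - a.2) = (b.2 - a.2) * (z.1 - a.1) := by
  obtain ⟨s, t, hs, ht, hst, rfl⟩ := hz
  have hs' : s = 1 - t := by linarith
  subst hs'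
  simp only [Prod.fst_add, Prod.smul_fst, smul_eq_mul, Prod.snd_add, Prod.smul_snd]
  refine ⟨by nlinarith, by nlinarith, by ring⟩

/-- Straight-line drawings in which the vertices have distinct first coordinates, vertices under
an edge are above its segment, and edges do not cross in the order of the first coordinates. -/
theorem isPlanarStraightLine_of_above {V : Type*} {G : SimpleGraph V} {P : V → ℝ × ℝ}
    (hinj : ∀ u v, (P u).1 = (P v).1 → u = v)
    (habove : ∀ u v w, G.Adj u v → (P u).1 < (P w).1 → (P w).1 < (P v).1 →
      ((P v).2 - (P u).2) * ((P w).1 - (P u).1) < ((P w).2 - (P u).2) * ((P v).1 - (P u).1))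
    (hnc : ∀ a b c d, (P a).1 < (P b).1 → (P b).1 < (P c).1 → (P c).1 < (P d).1 →
      G.Adj a c → G.Adj b d → False) : IsPlanarStraightLine G P := by
  have key : ∀ e ∈ G.edgeSet, ∃ u v, e = s(u, v) ∧ G.Adj u v ∧ (P u).1 < (P v).1 := by
    intro e he
    induction e with | _ u v =>
    have hne : (P u).1 ≠ (P v).1 := fun h => (G.ne_of_adj he) (hinj _ _ h)
    rcases lt_or_gt_of_ne hne with h | h
    · exact ⟨u, v, rfl, he, h⟩
    · exact ⟨v, u, Sym2.eq_swap, SimpleGraph.Adj.symm he, h⟩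
  have arc_eq : ∀ u v, straightArc P s(u, v) = segment ℝ (P u) (P v) := fun u v => rfl
  have left_end : ∀ u v z, (P u).1 < (P v).1 → z ∈ segment ℝ (P u) (P v) → z.1 = (P u).1 →
      z = P u := by
    intro u v z huv hz h1
    obtain ⟨-, -, h⟩ := mem_segment_line huv hz
    rw [h1, sub_self, mul_zero, mul_eq_zero] at h
    refine Prod.ext h1 ?_
    rcases h with h | h <;> linarith
  have right_end : ∀ u v z, (P u).1 < (P v).1 → z ∈ segment ℝ (P u) (P v) → z.1 = (P v).1 →
      z = P v := by
    intro u v z huv hz h1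
    obtain ⟨-, -, h⟩ := mem_segment_line huv hz
    rw [h1, mul_comm] at h
    have := mul_right_cancel₀ (sub_ne_zero.2 huv.ne') h
    exact Prod.ext h1 (by linarith)
  have weak : ∀ u v w, G.Adj u v → (P u).1 < (P v).1 → (P u).1 ≤ (P w).1 → (P w).1 ≤ (P v).1 →
      ((P v).2 - (P u).2) * ((P w).1 - (P u).1) ≤ ((P w).2 - (P u).2) * ((P v).1 - (P u).1) := by
    intro u v w huv hlt h1 h2
    rcases h1.eq_or_lt with h1 | h1
    · rw [hinj _ _ h1]; simp
    · rcases h2.eq_or_lt with h2 | h2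
      · rw [hinj _ _ h2]
      · exact (habove u v w huv h1 h2).le
  -- For nested ranges, both ends of the inner edge are on or above the outer line and, as the edges
  -- differ, one of them strictly. So a common point must be a common end.
  have nested : ∀ u v u' v' z, G.Adj u v → G.Adj u' v' → (P u).1 < (P v).1 →
      (P u').1 < (P v').1 → (P u).1 ≤ (P u').1 → (P v').1 ≤ (P v).1 →
      z ∈ segment ℝ (P u) (P v) → z ∈ segment ℝ (P u') (P v') → s(u, v) ≠ s(u', v') →
      ∃ w, z = P w ∧ w ∈ s(u, v) ∧ w ∈ s(u', v') := by
    intro u v u' v' z huv huv' hlt hlt' h1 h2 hz hz' hne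
    obtain ⟨a1, a2, a3⟩ := mem_segment_line hlt hz
    obtain ⟨b1, b2, b3⟩ := mem_segment_line hlt' hz'
    have w1 := weak u v u' huv hlt h1 (hlt'.le.trans h2)
    have w2 := weak u v v' huv hlt (h1.trans hlt'.le) h2
    by_cases c1 : z.1 = (P u').1
    · rcases h1.eq_or_lt with h1 | h1
      · have := hinj _ _ h1
        subst this
        exact ⟨u, left_end _ _ _ hlt hz c1, by simp, by simp⟩
      · exfalso
        have := habove u v u' huv h1 (by linarith)
        have hzu := left_end _ _ _ hlt' hz' c1
        rw [hzu] at a3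
        nlinarith
    · by_cases c2 : z.1 = (P v').1
      · rcases h2.eq_or_lt with h2 | h2
        · have := hinj _ _ h2
          subst this
          exact ⟨v', right_end _ _ _ hlt hz c2, by simp, by simp⟩
        · exfalso
          have := habove u v v' huv (by linarith) h2
          have hzu := right_end _ _ _ hlt' hz' c2
          rw [hzu] at a3
          nlinarith
      · exfalso
        have c1' : (P u').1 < z.1 := lt_of_le_of_ne b1 (Ne.symm c1)
        have c2' : z.1 < (P v').1 := lt_of_le_of_ne b2 c2
        have hstrict : ((P v).2 - (P u).2) * ((P u').1 - (P u).1) <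
              ((P u').2 - (P u).2) * ((P v).1 - (P u).1) ∨
            ((P v).2 - (P u).2) * ((P v').1 - (P u).1) <
              ((P v').2 - (P u).2) * ((P v).1 - (P u).1) := by
          rcases h1.eq_or_lt with h1 | h1
          · rcases h2.eq_or_lt with h2 | h2
            · exact absurd (by rw [hinj _ _ h1, hinj _ _ h2]) hne
            · exact Or.inr (habove u v v' huv (by linarith) h2)
          · exact Or.inl (habove u v u' huv h1 (by linarith))
        set D := (P v).1 - (P u).1
        set F := (P v).2 - (P u).2
        -- The height of z above the outer line is the weighted mean of the heights of the two inner
        -- ends.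
        have hid : ((P v').1 - (P u').1) * (D * (z.2 - (P u).2) - F * (z.1 - (P u).1)) =
            ((P v').1 - z.1) * (((P u').2 - (P u).2) * D - F * ((P u').1 - (P u).1)) +
            (z.1 - (P u').1) * (((P v').2 - (P u).2) * D - F * ((P v').1 - (P u).1)) := by
          linear_combination D * b3
        rw [a3, sub_self, mul_zero] at hid
        rcases hstrict with hs | hs
        · have m1 := mul_pos (sub_pos.2 c2') (sub_pos.2 hs)
          have m2 := mul_nonneg (sub_pos.2 c1').le (sub_nonneg.2 w2)
          linarith
        · have m1 := mul_pos (sub_pos.2 c1') (sub_pos.2 hs)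
          have m2 := mul_nonneg (sub_pos.2 c2').le (sub_nonneg.2 w1)
          linarith
  refine ⟨fun u v h => hinj u v (by rw [h]), ?_, ?_, ?_⟩
  · intro u v huv
    rw [arc_eq]
    exact PolygonalArc.single fun h => (G.ne_of_adj huv) (hinj _ _ (by rw [h]))
  · intro e he w hw
    obtain ⟨u, v, rfl, huv, hlt⟩ := key e he
    rw [arc_eq] at hw
    obtain ⟨a1, a2, a3⟩ := mem_segment_line hlt hw
    rcases a1.eq_or_lt with h1 | h1
    · rw [hinj _ _ h1]; simp
    rcases a2.eq_or_lt with h2 | h2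
    · rw [hinj _ _ h2]; simp
    have := habove u v w huv h1 h2
    nlinarith
  · intro e he f hf hne z hz
    obtain ⟨u, v, rfl, huv, hlt⟩ := key e he
    obtain ⟨u', v', rfl, huv', hlt'⟩ := key f hf
    rw [arc_eq, arc_eq] at hz
    obtain ⟨hz, hz'⟩ := hz
    suffices ∃ w, z = P w ∧ w ∈ s(u, v) ∧ w ∈ s(u', v') by
      obtain ⟨w, hw, h1, h2⟩ := this
      exact ⟨w, ⟨h1, h2⟩, hw.symm⟩
    obtain ⟨a1, a2, a3⟩ := mem_segment_line hlt hz
    obtain ⟨b1, b2, b3⟩ := mem_segment_line hlt' hz'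
    rcases le_total (P u).1 (P u').1 with h1 | h1 <;> rcases le_total (P v).1 (P v').1 with h2 | h2
    · rcases le_or_gt (P v).1 (P u').1 with h3 | h3
      · have hv : z.1 = (P v).1 := by linarith
        have := hinj v u' (by linarith)
        subst this
        exact ⟨v, right_end _ _ _ hlt hz hv, by simp, by simp⟩
      · rcases h1.eq_or_lt with h1 | h1
        · obtain ⟨w, hw1, hw2, hw3⟩ := nested u' v' u v z huv' huv hlt' hlt h1.ge h2 hz' hz hne.symm
          exact ⟨w, hw1, hw3, hw2⟩
        · rcases h2.eq_or_lt with h2 | h2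
          · exact nested u v u' v' z huv huv' hlt hlt' h1.le h2.ge hz hz' hne
          · exact (hnc u u' v v' h1 h3 h2 huv huv').elim
    · exact nested u v u' v' z huv huv' hlt hlt' h1 h2 hz hz' hne
    · obtain ⟨w, hw1, hw2, hw3⟩ := nested u' v' u v z huv' huv hlt' hlt h1 h2 hz' hz hne.symm
      exact ⟨w, hw1, hw3, hw2⟩
    · rcases le_or_gt (P v').1 (P u).1 with h3 | h3
      · have hv : z.1 = (P v').1 := by linarith
        have := hinj v' u (by linarith)
        subst this
        exact ⟨v', right_end _ _ _ hlt' hz' hv, by simp, by simp⟩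
      · rcases h1.eq_or_lt with h1 | h1
        · exact nested u v u' v' z huv huv' hlt hlt' h1.ge h2 hz hz' hne
        · rcases h2.eq_or_lt with h2 | h2
          · obtain ⟨w, hw1, hw2, hw3⟩ :=
              nested u' v' u v z huv' huv hlt' hlt h1.le h2.ge hz' hz hne.symm
            exact ⟨w, hw1, hw3, hw2⟩
          · exact (hnc u' u v' v h1 h3 h2 huv' huv).elim

/-- A drawing is monotone if there is a Hamiltonian path along which the first coordinates
increase. -/
theorem isMonotoneDrawing_of_path {V : Type*} {G : SimpleGraph V} {P : V → ℝ × ℝ} {n : ℕ}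
    {o : ℕ → V} (hsurj : ∀ v, ∃ i < n, o i = v) (hadj : ∀ i, i + 1 < n → G.Adj (o i) (o (i + 1)))
    (hx : ∀ i < n, (P (o i)).1 = i) : IsMonotoneDrawing G P := by
  have key : ∀ j, j < n → ∀ i, i ≤ j → ∃ w : G.Walk (o i) (o j),
      w.support.Pairwise (fun a b => (P a).1 < (P b).1) ∧ ∀ v ∈ w.support, (P v).1 ≤ j := by
    intro j
    induction j with
    | zero =>
      intro hn i hi
      obtain rfl : i = 0 := by omega
      exact ⟨SimpleGraph.Walk.nil, by simp, by simp [hx 0 hn]⟩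
    | succ j ih =>
      intro hn i hi
      rcases hi.eq_or_lt with rfl | hi
      · exact ⟨SimpleGraph.Walk.nil, by simp, by simp [hx _ hn]⟩
      · obtain ⟨w, hw1, hw2⟩ := ih (by omega) i (by omega)
        refine ⟨w.concat (hadj j hn), ?_, ?_⟩
        · rw [SimpleGraph.Walk.support_concat, List.pairwise_append]
          refine ⟨hw1, by simp, fun a ha b hb => ?_⟩
          rw [List.mem_singleton] at hb
          subst hb
          rw [hx _ hn]
          push_cast
          linarith [hw2 a ha]
        · intro v hv
          rw [SimpleGraph.Walk.support_concat, List.mem_append,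
            List.mem_singleton] at hv
          rcases hv with hv | rfl
          · push_cast; linarith [hw2 v hv]
          · rw [hx _ hn]
  intro u v
  obtain ⟨i, hi, rfl⟩ := hsurj u
  obtain ⟨j, hj, rfl⟩ := hsurj v
  rcases le_total i j with h | h
  · obtain ⟨w, hw, -⟩ := key j hj i h
    refine ⟨w, ?_, (1, 0), by simp, ?_⟩
    · rw [SimpleGraph.Walk.isPath_def]
      exact hw.imp fun {a b} hab => fun he => by rw [he] at hab; exact lt_irrefl _ hab
    · simpa using hw
  · obtain ⟨w, hw, -⟩ := key i hi j h
    refine ⟨w.reverse, ?_, (-1, 0), by simp, ?_⟩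
    · rw [SimpleGraph.Walk.isPath_reverse_iff, SimpleGraph.Walk.isPath_def]
      exact hw.imp fun {a b} hab => fun he => by rw [he] at hab; exact lt_irrefl _ hab
    · rw [SimpleGraph.Walk.support_reverse, List.pairwise_reverse]
      simpa using hw

/-! ### Transfer to the graph and count of segments -/

/-- A numbering of the vertices of a graph that makes it a cycle with non-crossing chords. -/
structure IsNumbering {n : ℕ} (G : SimpleGraph (Fin n)) (E : ℕ → ℕ → Prop) (o : ℕ → Fin n)
    (pos : Fin n → ℕ) : Prop where
  order : ChordOrder n E
  adj_iff : ∀ u v, G.Adj u v ↔ E (pos u) (pos v)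
  pos_lt : ∀ v, pos v < n
  o_pos : ∀ v, o (pos v) = v
  pos_o : ∀ i < n, pos (o i) = i

variable {n : ℕ} {G : SimpleGraph (Fin n)} {E : ℕ → ℕ → Prop} {o : ℕ → Fin n} {pos : Fin n → ℕ}
  {p c y : ℕ → ℕ}

/-- Every edge is a tree edge or belongs to a vertex in `{1, …, n - 2}`. -/
theorem IsNumbering.exists_tokens (h : IsNumbering G E o pos) (hp : IsMinNeighbour n E p) :
    ∃ f : ℕ → Sym2 (Fin n), ∀ e ∈ G.edgeSet, (∃ j, 1 ≤ j ∧ j < n ∧ e = s(o (p j), o j)) ∨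
      ∃ i, 1 ≤ i ∧ i < n - 1 ∧ e = f i := by
  -- The only non-tree edge with lower position i; if there is none, the degenerate pair is a
  -- default value that no edge equals.
  have : ∀ i, ∃ e : Sym2 (Fin n), ∀ k, E i k → i < k → p k < i → e = s(o i, o k) := by
    intro i
    by_cases hi : ∃ k, E i k ∧ i < k ∧ p k < i
    · obtain ⟨k, h1, h2, h3⟩ := hi
      refine ⟨s(o i, o k), fun k' h1' h2' h3' => ?_⟩
      rcases hp.tree_or_unique h.order h2 h1 with ht | ⟨-, -, -, ht⟩
      · omega
      · rw [ht k' h1' h2' h3']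
    · exact ⟨s(o i, o i), fun k h1 h2 h3 => absurd ⟨k, h1, h2, h3⟩ hi⟩
  choose f hf using this
  refine ⟨f, fun e he => ?_⟩
  have key : ∀ u v, pos u < pos v → G.Adj u v →
      (∃ j, 1 ≤ j ∧ j < n ∧ s(u, v) = s(o (p j), o j)) ∨ ∃ i, 1 ≤ i ∧ i < n - 1 ∧ s(u, v) = f i := by
    intro u v huv hadj
    rw [h.adj_iff] at hadj
    rcases hp.tree_or_unique h.order huv hadj with ht | ⟨h1, h2, h3, -⟩
    · exact Or.inl ⟨pos v, by omega, h.pos_lt v, by rw [ht, h.o_pos, h.o_pos]⟩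
    · exact Or.inr ⟨pos u, h2, h3, by rw [hf _ _ hadj huv h1, h.o_pos, h.o_pos]⟩
  induction e with | _ u v =>
  have hne : pos u ≠ pos v := fun hc => (G.ne_of_adj he) (by rw [← h.o_pos u, hc, h.o_pos])
  rcases lt_or_gt_of_ne hne with hlt | hlt
  · exact key u v hlt he
  · rw [Sym2.eq_swap]
    exact key v u hlt (SimpleGraph.Adj.symm he)

/-- A biconnected outerplanar graph has at most `2 n - 3` edges. -/
theorem IsNumbering.length_edgeList_le (h : IsNumbering G E o pos) (hp : IsMinNeighbour n E p)
    {L : List (Fin n × Fin n)} (hL : IsEdgeList G L) : L.length ≤ (n - 1) + (n - 2) := by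
  classical
  obtain ⟨f, hf⟩ := h.exists_tokens hp
  have hcard : (L.map fun x => s(x.1, x.2)).toFinset.card = L.length := by
    rw [List.toFinset_card_of_nodup hL.1, List.length_map]
  rw [← hcard]
  have hsub : (L.map fun x => s(x.1, x.2)).toFinset ⊆
      (Finset.Ico 1 n).image (fun j => s(o (p j), o j)) ∪ (Finset.Ico 1 (n - 1)).image f := by
    intro e he
    rw [List.mem_toFinset, ← hL.2] at he
    rw [Finset.mem_union, Finset.mem_image, Finset.mem_image]
    rcases hf e he with ⟨j, h1, h2, rfl⟩ | ⟨i, h1, h2, rfl⟩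
    · exact Or.inl ⟨j, Finset.mem_Ico.2 ⟨h1, h2⟩, rfl⟩
    · exact Or.inr ⟨i, Finset.mem_Ico.2 ⟨h1, h2⟩, rfl⟩
  refine (Finset.card_le_card hsub).trans ((Finset.card_union_le _ _).trans ?_)
  refine add_le_add (Finset.card_image_le.trans ?_) (Finset.card_image_le.trans ?_)
  · simp
  · simp; omega

theorem IsNumbering.planar (h : IsNumbering G E o pos) (hp : IsMinNeighbour n E p)
    (hl : IsLayout n p c y) : IsPlanarStraightLine G (gridPos fun v => (pos v, y (pos v))) := by
  refine isPlanarStraightLine_of_above ?_ ?_ ?_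
  · intro u v huv
    have : pos u = pos v := by simpa [gridPos] using huv
    rw [← h.o_pos u, this, h.o_pos]
  · intro u v w huv h1 h2
    simp only [gridPos, Nat.cast_lt] at h1 h2 ⊢
    exact above_edge h.order hp hl ((h.adj_iff u v).1 huv) h1 h2
  · intro a b c d h1 h2 h3 hac hbd
    simp only [gridPos, Nat.cast_lt] at h1 h2 h3
    exact h.order.nc _ _ _ _ h1 h2 h3 ((h.adj_iff _ _).1 hac) ((h.adj_iff _ _).1 hbd)

theorem IsNumbering.monotone (h : IsNumbering G E o pos) :
    IsMonotoneDrawing G (gridPos fun v => (pos v, y (pos v))) := by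
  refine isMonotoneDrawing_of_path (n := n) (o := o) (fun v => ⟨pos v, h.pos_lt v, h.o_pos v⟩) ?_ ?_
  · intro i hi
    rw [h.adj_iff, h.pos_o _ hi, h.pos_o _ (by omega)]
    exact h.order.cons i hi
  · intro i hi
    simp [gridPos, h.pos_o i hi]

/-- Both tree edges have slope c i, by `slope_eq_of_last_child`, and the positions satisfy p i < i <
m; so the middle vertex is inside the segment. -/
theorem IsNumbering.continuesStraight (h : IsNumbering G E o pos) (hp : IsMinNeighbour n E p)
    (hl : IsLayout n p c y) {i m : ℕ} (h0 : 1 ≤ i) (hm : m < n) (him : i < m) (hpm : p m = i)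
    (hlast : ∀ j, m < j → j < n → p j ≠ i) (he : s(o (p i), o i) ∈ G.edgeSet)
    (hf : s(o (p m), o m) ∈ G.edgeSet) :
    ContinuesStraight G (gridPos fun v => (pos v, y (pos v))) ⟨_, he⟩ ⟨_, hf⟩ := by
  refine ⟨o (p i), o i, o m, rfl, by simp only [hpm], ?_⟩
  have hpi := hp.lt h.order h0 (him.trans hm)
  have hc := slope_eq_of_last_child h.order hp hl h0 hm him hpm hlast
  have y1 := hl.height i h0 (him.trans hm)
  have y2 := hl.height m (by omega) hm
  rw [hpm, hc] at y2
  have y1' : (y i : ℝ) = y (p i) + c i * (i - p i) := by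
    rw [← Nat.cast_sub hpi.le]; exact_mod_cast y1
  have y2' : (y m : ℝ) = y i + c i * (m - i) := by
    rw [← Nat.cast_sub him.le]; exact_mod_cast y2
  have a1 : (0 : ℝ) < (i : ℝ) - p i := by rw [sub_pos]; exact_mod_cast hpi
  have a2 : (0 : ℝ) < (m : ℝ) - i := by rw [sub_pos]; exact_mod_cast him
  have a3 : (0 : ℝ) < (m : ℝ) - p i := by linarith
  refine ⟨(m - i) / (m - p i), (i - p i) / (m - p i), div_pos a2 a3, div_pos a1 a3, ?_, ?_⟩
  · field_simp; ring
  · simp only [gridPos, h.pos_o _ hm, h.pos_o _ (him.trans hm), h.pos_o _ (hpi.trans (him.trans hm))]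
    ext
    · simp only [Prod.fst_add, Prod.smul_fst, smul_eq_mul]
      field_simp
      ring
    · simp only [Prod.snd_add, Prod.smul_snd, smul_eq_mul]
      rw [y2', y1']
      field_simp
      ring

/-- Each vertex i ≥ 1 with a child saves one segment, because the tree edge to its largest child
continues the tree edge to i. Vertices with a child are recognised by p (i + 1) = i. -/
theorem IsNumbering.segmentCount_le (h : IsNumbering G E o pos) (hp : IsMinNeighbour n E p)
    (hl : IsLayout n p c y) :
    segmentCount G (gridPos fun v => (pos v, y (pos v))) +
      {a ∈ Finset.range (n - 2) | p (a + 2) = a + 1}.card ≤ (n - 1) + (n - 2) := by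
  classical
  have h3 := h.order.three_le
  set P := gridPos fun v => (pos v, y (pos v)) with hP
  obtain ⟨f, hf⟩ := h.exists_tokens hp
  have hte : ∀ j, 1 ≤ j → j < n → s(o (p j), o j) ∈ G.edgeSet := by
    intro j h1 hj
    rw [SimpleGraph.mem_edgeSet, h.adj_iff, h.pos_o _ hj,
      h.pos_o _ ((hp.lt h.order h1 hj).trans hj)]
    exact hp.adj j h1 hj
  let e0 : G.edgeSet := ⟨_, hte 1 le_rfl (by omega)⟩
  let cls : Sym2 (Fin n) → Quot (ContinuesStraight G P) := fun e =>
    if he : e ∈ G.edgeSet then Quot.mk _ ⟨e, he⟩ else Quot.mk _ e0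
  -- Tree edges that may begin a segment: those from the root 0 and those to a child that is not the
  -- largest one.
  let A : Finset ℕ := {j ∈ Finset.Ico 1 n | p j = 0 ∨ ∃ j', j < j' ∧ j' < n ∧ p j' = p j}
  -- From a tree edge outside `A` one passes to the tree edge of the parent, on the same segment,
  -- until `A` is reached.
  have hA : ∀ j, 1 ≤ j → j < n → ∃ j' ∈ A, cls s(o (p j), o j) = cls s(o (p j'), o j') := by
    intro j
    induction j using Nat.strong_induction_on with
    | _ j ih =>
      intro h1 hj
      by_cases hjA : j ∈ A
      · exact ⟨j, hjA, rfl⟩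
      · simp only [A, Finset.mem_filter, Finset.mem_Ico, not_and, not_or, not_exists] at hjA
        obtain ⟨g1, g2⟩ := hjA ⟨h1, hj⟩
        have hlt := hp.lt h.order h1 hj
        obtain ⟨j', hj', heq⟩ := ih (p j) hlt (by omega) (by omega)
        refine ⟨j', hj', Eq.trans ?_ heq⟩
        simp only [cls, dif_pos (hte j h1 hj), dif_pos (hte (p j) (by omega) (by omega))]
        exact (Quot.sound (h.continuesStraight hp hl (by omega) hj hlt rfl g2 _ _)).symm
  have hcount : segmentCount G P ≤ A.card + (n - 2) := by
    have huniv : (Set.univ : Set (Quot (ContinuesStraight G P))) ⊆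
        ((A.image fun j => cls s(o (p j), o j)) ∪
          ((Finset.Ico 1 (n - 1)).image fun i => cls (f i)) : Finset _) := by
      rintro q -
      induction q using Quot.ind with | mk e =>
      obtain ⟨e, he⟩ := e
      have hcls : (Quot.mk _ ⟨e, he⟩ : Quot (ContinuesStraight G P)) = cls e := by
        simp only [cls, dif_pos he]
      rw [hcls, Finset.mem_coe, Finset.mem_union, Finset.mem_image, Finset.mem_image]
      rcases hf e he with ⟨j, h1, h2, rfl⟩ | ⟨i, h1, h2, rfl⟩
      · obtain ⟨j', hj', heq⟩ := hA j h1 h2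
        exact Or.inl ⟨j', hj', heq.symm⟩
      · exact Or.inr ⟨i, Finset.mem_Ico.2 ⟨h1, h2⟩, rfl⟩
    rw [segmentCount, ← Set.ncard_univ]
    refine (Set.ncard_le_ncard huniv (Finset.finite_toSet _)).trans ?_
    rw [Set.ncard_coe_finset]
    refine (Finset.card_union_le _ _).trans (add_le_add Finset.card_image_le
      (Finset.card_image_le.trans ?_))
    simp; omega
  have hinner : {a ∈ Finset.range (n - 2) | p (a + 2) = a + 1}.card + A.card ≤ n - 1 := by
    -- The largest child of a + 1 is not in `A`, and it determines a through its parent.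
    have hM : ∀ a ∈ ({a ∈ Finset.range (n - 2) | p (a + 2) = a + 1} : Finset ℕ),
        ∃ m ∈ Finset.Ico 1 n \ A, p m = a + 1 := by
      intro a ha
      simp only [Finset.mem_filter, Finset.mem_range] at ha
      let S : Finset ℕ := {m ∈ Finset.Ico 1 n | p m = a + 1}
      have hS : S.Nonempty := ⟨a + 2, by simp [S, ha.2]; omega⟩
      have hmax := S.max'_mem hS
      set m := S.max' hS with hm
      simp only [S, Finset.mem_filter, Finset.mem_Ico] at hmax
      refine ⟨m, ?_, hmax.2⟩
      rw [Finset.mem_sdiff]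
      refine ⟨Finset.mem_Ico.2 hmax.1, fun hmA => ?_⟩
      simp only [A, Finset.mem_filter, Finset.mem_Ico] at hmA
      rcases hmA.2 with h0 | ⟨j', h1, h2, h4⟩
      · omega
      · have : j' ≤ m := S.le_max' j' (by
          simp only [S, Finset.mem_filter, Finset.mem_Ico]
          exact ⟨⟨by omega, h2⟩, h4.trans hmax.2⟩)
        omega
    choose! M hM1 hM2 using hM
    have hle := Finset.card_le_card_of_injOn M (fun a ha => hM1 a ha) (by
      intro a ha b hb hab
      have h1 := hM2 a ha
      have h2 := hM2 b hb
      rw [hab] at h1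
      omega)
    have hAs : A ⊆ Finset.Ico 1 n := Finset.filter_subset _ _
    have := Finset.card_sdiff_add_card_eq_card hAs
    rw [Nat.card_Ico] at this
    omega
  omega

end Drawing

/-! ## Reduction by removing vertices of degree two -/

section Reduction

/-- The adjacency relation of a graph given by its neighbour sets. -/
abbrev NbRel (Nb : ℕ → Finset ℕ) : ℕ → ℕ → Prop := fun x y => y ∈ Nb x

/-- Removes `v` with neighbours `u`, `w` and makes `u`, `w` adjacent. -/
def suppress (v u w : ℕ) (Nb : ℕ → Finset ℕ) : ℕ → Finset ℕ := fun x =>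
  if x = u then insert w ((Nb u).erase v) else if x = w then insert u ((Nb w).erase v) else Nb x

/-- Rotation of an index in a cycle of length `k`. -/
abbrev rotIdx (k r i : ℕ) : ℕ := if i + r < k then i + r else i + r - k

/-- The next index in a cycle of length `k`. -/
abbrev nextIdx (k i : ℕ) : ℕ := if i + 1 < k then i + 1 else 0

variable {Nb : ℕ → Finset ℕ} {k n : ℕ} {o : ℕ → ℕ}

/-- Crossing is a property of the cyclic order. The cases are given by how many of the four indices
wrap around. -/
theorem CycOrder.rotate {V : Type*} {R : V → V → Prop} {o : ℕ → V} (h : CycOrder R k o) {r : ℕ}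
    (hr : r < k) : CycOrder R k fun i => o (rotIdx k r i) := by
  have hlt : ∀ i < k, rotIdx k r i < k := fun i hi => by simp only [rotIdx]; split_ifs <;> omega
  refine ⟨h.toIsCyc.rotate hr, fun i hi j hj => h.symm _ (hlt i hi) _ (hlt j hj),
    fun i hi => h.irrefl _ (hlt i hi), fun i hi x hx => ?_, fun a b c d hab hbc hcd hd => ?_⟩
  · obtain ⟨j, hj, rfl⟩ := h.closed _ (hlt i hi) x hx
    refine ⟨if r ≤ j then j - r else j + k - r, by split_ifs <;> omega, ?_⟩
    congr 1
    simp only [rotIdx]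
    split_ifs <;> omega
  · rintro ⟨h1, h2⟩
    have h1' := h.symm _ (hlt a (by omega)) _ (hlt c (by omega)) h1
    have h2' := h.symm _ (hlt b (by omega)) _ (hlt d (by omega)) h2
    simp only [rotIdx] at h1 h2 h1' h2'
    by_cases ca : a + r < k
    · by_cases cb : b + r < k
      · by_cases cc : c + r < k
        · by_cases cd : d + r < k
          · simp only [ca, cb, cc, cd, if_true] at h1 h2
            exact h.nc _ _ _ _ (by omega) (by omega) (by omega) (by omega) ⟨h1, h2⟩
          · simp only [ca, cb, cc, cd, if_true, if_false] at h1 h2'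
            exact h.nc _ _ _ _ (by omega) (by omega) (by omega) (by omega) ⟨h2', h1⟩
        · have cd : ¬ d + r < k := by omega
          simp only [ca, cb, cc, cd, if_true, if_false] at h1' h2'
          exact h.nc _ _ _ _ (by omega) (by omega) (by omega) (by omega) ⟨h1', h2'⟩
      · have cc : ¬ c + r < k := by omega
        have cd : ¬ d + r < k := by omega
        simp only [ca, cb, cc, cd, if_true, if_false] at h1' h2
        exact h.nc _ _ _ _ (by omega) (by omega) (by omega) (by omega) ⟨h2, h1'⟩
    · have cb : ¬ b + r < k := by omega
      have cc : ¬ c + r < k := by omega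
      have cd : ¬ d + r < k := by omega
      simp only [ca, cb, cc, cd, if_false] at h1 h2
      exact h.nc _ _ _ _ (by omega) (by omega) (by omega) (by omega) ⟨h1, h2⟩

theorem CycOrder.reverse {V : Type*} {R : V → V → Prop} {o : ℕ → V} (h : CycOrder R k o) :
    CycOrder R k fun i => o (k - 1 - i) := by
  have h2 := h.two_le
  refine ⟨⟨h2, fun i hi j hj hij => ?_, fun i hi => ?_, ?_⟩,
    fun i hi j hj => h.symm _ (by omega) _ (by omega),
    fun i hi => h.irrefl _ (by omega), fun i hi x hx => ?_, fun a b c d hab hbc hcd hd => ?_⟩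
  · have := h.inj _ (by omega) _ (by omega) hij
    omega
  · have := h.cons (k - 1 - (i + 1)) (by omega)
    rw [show k - 1 - (i + 1) + 1 = k - 1 - i by omega] at this
    exact h.symm _ (by omega) _ (by omega) this
  · have := h.symm _ (by omega) _ (by omega) h.close
    simpa using this
  · obtain ⟨j, hj, rfl⟩ := h.closed _ (by omega) x hx
    exact ⟨k - 1 - j, by omega, by congr 1; omega⟩
  · rintro ⟨h1, h2⟩
    exact h.nc (k - 1 - d) (k - 1 - c) (k - 1 - b) (k - 1 - a) (by omega) (by omega) (by omega)
      (by omega) ⟨h.symm _ (by omega) _ (by omega) h2, h.symm _ (by omega) _ (by omega) h1⟩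

/-- In a cycle of length at least three with non-crossing chords, some vertex has degree two. -/
theorem CycOrder.exists_degree_two {V : Type*} {R : V → V → Prop} {o : ℕ → V}
    (h : CycOrder R k o) (hk : 3 ≤ k) :
    ∃ i, 0 < i ∧ i + 1 < k ∧ ∀ x, R (o i) x → x = o (i - 1) ∨ x = o (i + 1) := by
  -- Descent under a chord from a to b: either a + 1 has degree two, or it has a chord into the same
  -- range, with a shorter span.
  have key : ∀ m a b, b - a = m → a + 1 < b → b < k → R (o a) (o b) →
      ∃ i, 0 < i ∧ i + 1 < k ∧ ∀ x, R (o i) x → x = o (i - 1) ∨ x = o (i + 1) := by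
    intro m
    induction m using Nat.strong_induction_on with
    | _ m ih =>
      intro a b hm hab hb hR
      by_cases hdeg : ∀ x, R (o (a + 1)) x → x = o (a + 1 - 1) ∨ x = o (a + 1 + 1)
      · exact ⟨a + 1, by omega, by omega, hdeg⟩
      · push Not at hdeg
        obtain ⟨x, hx, hx1, hx2⟩ := hdeg
        obtain ⟨j, hj, rfl⟩ := h.closed _ (by omega) x hx
        have j1 : j ≠ a := by rintro rfl; exact hx1 rfl
        have j2 : j ≠ a + 1 + 1 := by rintro rfl; exact hx2 rfl
        have j3 : j ≠ a + 1 := by rintro rfl; exact h.irrefl _ hj hx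
        have j4 : a ≤ j := by
          by_contra hcon
          exact h.nc j a (a + 1) b (by omega) (by omega) hab hb
            ⟨h.symm _ (by omega) _ hj hx, hR⟩
        have j5 : j ≤ b := by
          by_contra hcon
          exact h.nc a (a + 1) b j (by omega) (by omega) (by omega) hj ⟨hR, hx⟩
        exact ih (j - (a + 1)) (by omega) (a + 1) j rfl (by omega) hj hx
  exact key _ 0 (k - 1) rfl (by omega) (by omega) (h.symm _ (by omega) _ (by omega) h.close)

theorem CycOrder.two_le_card (h : CycOrder (NbRel Nb) k o) (hk : 3 ≤ k) {i : ℕ} (hi : i < k) :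
    2 ≤ (Nb (o i)).card := by
  have h1 : o (nextIdx k i) ∈ Nb (o i) := by
    simp only [nextIdx]
    split_ifs with hc
    · exact h.cons i hc
    · have := h.close
      rwa [show k - 1 = i by omega] at this
  have h2 : o (if i = 0 then k - 1 else i - 1) ∈ Nb (o i) := by
    split_ifs with hc
    · rw [hc]; exact h.symm _ (by omega) _ (by omega) h.close
    · have := h.cons (i - 1) (by omega)
      rw [show i - 1 + 1 = i by omega] at this
      exact h.symm _ (by omega) _ (by omega) this
  have hne : o (nextIdx k i) ≠ o (if i = 0 then k - 1 else i - 1) := by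
    intro hc
    have := h.inj _ (by simp only [nextIdx]; split_ifs <;> omega) _ (by split_ifs <;> omega) hc
    simp only [nextIdx] at this
    split_ifs at this <;> omega
  exact Finset.one_lt_card.2 ⟨_, h1, _, h2, hne⟩

theorem CycOrder.exists_card_eq_two (h : CycOrder (NbRel Nb) k o) (hk : 3 ≤ k) :
    ∃ i < k, (Nb (o i)).card = 2 := by
  obtain ⟨i, h0, h1, h2⟩ := h.exists_degree_two hk
  refine ⟨i, by omega, le_antisymm ?_ (h.two_le_card hk (by omega))⟩
  have hsub : Nb (o i) ⊆ {o (i - 1), o (i + 1)} := fun x hx => by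
    rw [Finset.mem_insert, Finset.mem_singleton]
    exact h2 x hx
  exact (Finset.card_le_card hsub).trans Finset.card_le_two

/-- The neighbours of a vertex of degree two are its neighbours on the cycle. -/
theorem CycOrder.nb_last (h : CycOrder (NbRel Nb) k o) (hk : 3 ≤ k) {u w : ℕ}
    (hv : Nb (o (k - 1)) = {u, w}) :
    (u = o (k - 2) ∧ w = o 0) ∨ (u = o 0 ∧ w = o (k - 2)) := by
  have h1 : o 0 ∈ Nb (o (k - 1)) := h.close
  have h2 : o (k - 2) ∈ Nb (o (k - 1)) := by
    have := h.cons (k - 2) (by omega)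
    rw [show k - 2 + 1 = k - 1 by omega] at this
    exact h.symm _ (by omega) _ (by omega) this
  have hne : o 0 ≠ o (k - 2) := fun hc => by
    have := h.inj _ (by omega) _ (by omega) hc
    omega
  rw [hv, Finset.mem_insert, Finset.mem_singleton] at h1 h2
  rcases h1 with h1 | h1 <;> rcases h2 with h2 | h2
  · exact absurd (h1.trans h2.symm) hne
  · exact Or.inr ⟨h1.symm, h2.symm⟩
  · exact Or.inl ⟨h2.symm, h1.symm⟩
  · exact absurd (h1.trans h2.symm) hne

theorem mem_suppress {v u w x y : ℕ} (huw : u ≠ w) (hsymm : v ∈ Nb x → x = u ∨ x = w) :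
    y ∈ suppress v u w Nb x ↔ (y ∈ Nb x ∧ y ≠ v) ∨ (x = u ∧ y = w) ∨ (x = w ∧ y = u) := by
  simp only [suppress]
  split_ifs with h1 h2
  · subst h1
    simp only [Finset.mem_insert, Finset.mem_erase]
    tauto
  · subst h2
    simp only [Finset.mem_insert, Finset.mem_erase]
    tauto
  · constructor
    · intro hy
      refine Or.inl ⟨hy, ?_⟩
      rintro rfl
      exact (hsymm hy).elim h1 h2
    · rintro (⟨hy, -⟩ | ⟨h, -⟩ | ⟨h, -⟩)
      · exact hy
      · exact absurd h h1
      · exact absurd h h2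

/-- The only new adjacency is between `o (k - 2)` and `o 0`, the first and last vertices of the
shorter cycle; it closes the cycle and crosses nothing. -/
theorem CycOrder.suppress_last (h : CycOrder (NbRel Nb) k o) (hk : 3 ≤ k) {u w : ℕ} (huw : u ≠ w)
    (hv : Nb (o (k - 1)) = {u, w}) :
    CycOrder (NbRel (suppress (o (k - 1)) u w Nb)) (k - 1) o := by
  have hends := h.nb_last hk hv
  have hmem : ∀ i < k - 1, ∀ y, y ∈ suppress (o (k - 1)) u w Nb (o i) ↔
      (y ∈ Nb (o i) ∧ y ≠ o (k - 1)) ∨ (o i = u ∧ y = w) ∨ (o i = w ∧ y = u) := by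
    intro i hi y
    refine mem_suppress huw fun hx => ?_
    have := h.symm _ (by omega) _ (by omega) hx
    simpa [NbRel, hv] using this
  have hmem' : ∀ i < k - 1, ∀ j < k - 1, o j ∈ suppress (o (k - 1)) u w Nb (o i) ↔
      o j ∈ Nb (o i) ∨ (i = 0 ∧ j = k - 2) ∨ (i = k - 2 ∧ j = 0) := by
    intro i hi j hj
    rw [hmem i hi]
    have hne : o j ≠ o (k - 1) := fun hc => by
      have := h.inj _ (by omega) _ (by omega) hc; omega
    have eq : ∀ a < k, ∀ b < k, o a = o b ↔ a = b := fun a ha b hb =>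
      ⟨h.inj a ha b hb, fun hab => by rw [hab]⟩
    rcases hends with ⟨rfl, rfl⟩ | ⟨rfl, rfl⟩
    · rw [eq _ (by omega) _ (by omega), eq _ (by omega) _ (by omega), eq _ (by omega) _ (by omega),
        eq _ (by omega) _ (by omega)]
      tauto
    · rw [eq _ (by omega) _ (by omega), eq _ (by omega) _ (by omega), eq _ (by omega) _ (by omega),
        eq _ (by omega) _ (by omega)]
      tauto
  refine ⟨⟨by omega, fun i hi j hj => h.inj i (by omega) j (by omega), fun i hi => ?_, ?_⟩,
    fun i hi j hj hij => ?_, fun i hi hii => ?_, fun i hi x hx => ?_,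
    fun a b c d hab hbc hcd hd => ?_⟩
  · exact (hmem' _ (by omega) _ (by omega)).2 (Or.inl (h.cons i (by omega)))
  · refine (hmem' _ (by omega) _ (by omega)).2 (Or.inr (Or.inr ⟨by omega, rfl⟩))
  · rw [NbRel, hmem' _ hi _ hj] at hij
    rw [NbRel, hmem' _ hj _ hi]
    rcases hij with hij | hij | hij
    · exact Or.inl (h.symm _ (by omega) _ (by omega) hij)
    · exact Or.inr (Or.inr ⟨hij.2, hij.1⟩)
    · exact Or.inr (Or.inl ⟨hij.2, hij.1⟩)
  · rw [NbRel, hmem' _ hi _ hi] at hii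
    rcases hii with hij | hij | hij
    · exact h.irrefl _ (by omega) hij
    · omega
    · omega
  · rw [NbRel, hmem i hi] at hx
    rcases hx with ⟨hx, hne⟩ | ⟨-, rfl⟩ | ⟨-, rfl⟩
    · obtain ⟨j, hj, rfl⟩ := h.closed _ (by omega) x hx
      refine ⟨j, ?_, rfl⟩
      have : j ≠ k - 1 := by rintro rfl; exact hne rfl
      omega
    · rcases hends with ⟨-, rfl⟩ | ⟨-, rfl⟩
      · exact ⟨0, by omega, rfl⟩
      · exact ⟨k - 2, by omega, rfl⟩
    · rcases hends with ⟨rfl, -⟩ | ⟨rfl, -⟩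
      · exact ⟨k - 2, by omega, rfl⟩
      · exact ⟨0, by omega, rfl⟩
  · rw [NbRel, NbRel, hmem' _ (by omega) _ (by omega), hmem' _ (by omega) _ (by omega)]
    rintro ⟨h1 | h1 | h1, h2 | h2 | h2⟩ <;> try omega
    exact h.nc a b c d hab hbc hcd (by omega) ⟨h1, h2⟩

/-! ### Reinsertion into a cyclic successor function -/

/-- `nx` is the successor function of the cycle `o`. -/
def IsNext (k : ℕ) (o nx : ℕ → ℕ) : Prop := ∀ i < k, nx (o i) = o (nextIdx k i)

/-- `nx` is the predecessor function of the cycle `o`. -/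
def IsPrev (k : ℕ) (o nx : ℕ → ℕ) : Prop := ∀ i < k, nx (o (nextIdx k i)) = o i

/-- Inserts `v` between the neighbours `u`, `w` of the cycle with the successor function `nx`. -/
def insertBetween (v u w : ℕ) (nx : ℕ → ℕ) : ℕ → ℕ :=
  if nx u = w then Function.update (Function.update nx u v) v w
  else Function.update (Function.update nx w v) v u

theorem isNext_of_rotate {nx : ℕ → ℕ} {r : ℕ} (hr : r < k)
    (h : IsNext k (fun i => o (rotIdx k r i)) nx) : IsNext k o nx := by
  intro i hi
  have := h (if r ≤ i then i - r else i + k - r) (by split_ifs <;> omega)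
  simp only [rotIdx, nextIdx] at this ⊢
  convert this using 2
  · congr 1
    split_ifs <;> omega
  · split_ifs <;> omega

theorem isPrev_of_rotate {nx : ℕ → ℕ} {r : ℕ} (hr : r < k)
    (h : IsPrev k (fun i => o (rotIdx k r i)) nx) : IsPrev k o nx := by
  intro i hi
  have := h (if r ≤ i then i - r else i + k - r) (by split_ifs <;> omega)
  simp only [rotIdx, nextIdx] at this ⊢
  convert this using 2
  · congr 1
    split_ifs <;> omega
  · split_ifs <;> omega

/-- The test `nx u = w` tells which of the two neighbours comes first. When there are only two old
vertices, each is the successor of the other and the orientation may flip, so the statement allows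
both orientations. -/
theorem IsNext.insertBetween {nx : ℕ → ℕ} {u w : ℕ} (hk : 3 ≤ k)
    (hinj : ∀ i < k, ∀ j < k, o i = o j → i = j)
    (hends : (u = o (k - 2) ∧ w = o 0) ∨ (u = o 0 ∧ w = o (k - 2)))
    (hnx : IsNext (k - 1) o nx ∨ IsPrev (k - 1) o nx) :
    IsNext k o (insertBetween (o (k - 1)) u w nx) ∨
      IsPrev k o (insertBetween (o (k - 1)) u w nx) := by
  have ne : ∀ a < k, ∀ b < k, a ≠ b → o a ≠ o b := fun a ha b hb hab hc => hab (hinj a ha b hb hc)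
  have fwd : ∀ f : ℕ → ℕ, IsNext (k - 1) o nx → f (o (k - 2)) = o (k - 1) → f (o (k - 1)) = o 0 →
      (∀ i < k - 2, f (o i) = nx (o i)) → IsNext k o f := by
    intro f hn h1 h2 h3 i hi
    rcases lt_trichotomy i (k - 2) with hc | hc | hc
    · rw [h3 i hc, hn i (by omega)]
      simp only [nextIdx]
      rw [if_pos (by omega), if_pos (by omega)]
    · subst hc
      rw [h1]
      simp only [nextIdx]
      rw [if_pos (by omega)]
      congr 1; omega
    · obtain rfl : i = k - 1 := by omega
      rw [h2]
      simp only [nextIdx]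
      rw [if_neg (by omega)]
  have bwd : ∀ f : ℕ → ℕ, IsPrev (k - 1) o nx → f (o 0) = o (k - 1) → f (o (k - 1)) = o (k - 2) →
      (∀ i, 0 < i → i < k - 1 → f (o i) = nx (o i)) → IsPrev k o f := by
    intro f hn h1 h2 h3 i hi
    simp only [nextIdx]
    rcases lt_trichotomy i (k - 2) with hc | hc | hc
    · have := hn i (by omega)
      simp only [nextIdx] at this
      rw [if_pos (by omega)] at this
      rw [if_pos (by omega), h3 (i + 1) (by omega) (by omega), this]
    · subst hc
      rw [if_pos (by omega), show k - 2 + 1 = k - 1 by omega, h2]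
    · obtain rfl : i = k - 1 := by omega
      rw [if_neg (by omega), h1]
  rcases hnx with hnx | hnx
  · have hlast : nx (o (k - 2)) = o 0 := by
      rw [hnx (k - 2) (by omega)]; simp only [nextIdx]; rw [if_neg (by omega)]
    have hfirst : nx (o 0) = o 1 := by
      rw [hnx 0 (by omega)]; simp only [nextIdx]; rw [if_pos (by omega)]
    rcases hends with ⟨rfl, rfl⟩ | ⟨rfl, rfl⟩
    · left
      rw [_root_.insertBetween, if_pos hlast]
      refine fwd _ hnx ?_ ?_ fun i hi => ?_
      · rw [Function.update_of_ne (ne _ (by omega) _ (by omega) (by omega)), Function.update_self]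
      · rw [Function.update_self]
      · rw [Function.update_of_ne (ne _ (by omega) _ (by omega) (by omega)),
          Function.update_of_ne (ne _ (by omega) _ (by omega) (by omega))]
    · rw [_root_.insertBetween]
      split_ifs with hc
      · right
        rw [hfirst] at hc
        have hk3 : 1 = k - 2 := hinj _ (by omega) _ (by omega) hc
        obtain rfl : k = 3 := by omega
        have hprev : IsPrev 2 o nx := by
          intro i hi
          interval_cases i <;> simp [nextIdx, hfirst]
          simpa using hlast
        refine bwd _ hprev ?_ ?_ fun i h0 hi => ?_
        · rw [Function.update_of_ne (ne _ (by omega) _ (by omega) (by omega)), Function.update_self]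
        · rw [Function.update_self]
        · rw [Function.update_of_ne (ne _ (by omega) _ (by omega) (by omega)),
            Function.update_of_ne (ne _ (by omega) _ (by omega) (by omega))]
      · left
        refine fwd _ hnx ?_ ?_ fun i hi => ?_
        · rw [Function.update_of_ne (ne _ (by omega) _ (by omega) (by omega)), Function.update_self]
        · rw [Function.update_self]
        · rw [Function.update_of_ne (ne _ (by omega) _ (by omega) (by omega)),
            Function.update_of_ne (ne _ (by omega) _ (by omega) (by omega))]
  · have hlast : nx (o 0) = o (k - 2) := by
      have := hnx (k - 2) (by omega)
      simp only [nextIdx] at this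
      rwa [if_neg (by omega)] at this
    have hpre : nx (o (k - 2)) = o (k - 3) := by
      have := hnx (k - 3) (by omega)
      simp only [nextIdx] at this
      rwa [if_pos (by omega), show k - 3 + 1 = k - 2 by omega] at this
    rcases hends with ⟨rfl, rfl⟩ | ⟨rfl, rfl⟩
    · rw [_root_.insertBetween]
      split_ifs with hc
      · left
        rw [hpre] at hc
        have hk3 : k - 3 = 0 := hinj _ (by omega) _ (by omega) hc
        obtain rfl : k = 3 := by omega
        have hnext : IsNext 2 o nx := by
          intro i hi
          interval_cases i
          · simpa [nextIdx] using hlast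
          · simpa [nextIdx] using hpre
        refine fwd _ hnext ?_ ?_ fun i hi => ?_
        · rw [Function.update_of_ne (ne _ (by omega) _ (by omega) (by omega)), Function.update_self]
        · rw [Function.update_self]
        · rw [Function.update_of_ne (ne _ (by omega) _ (by omega) (by omega)),
            Function.update_of_ne (ne _ (by omega) _ (by omega) (by omega))]
      · right
        refine bwd _ hnx ?_ ?_ fun i h0 hi => ?_
        · rw [Function.update_of_ne (ne _ (by omega) _ (by omega) (by omega)), Function.update_self]
        · rw [Function.update_self]
        · rw [Function.update_of_ne (ne _ (by omega) _ (by omega) (by omega)),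
            Function.update_of_ne (ne _ (by omega) _ (by omega) (by omega))]
    · right
      rw [_root_.insertBetween, if_pos hlast]
      refine bwd _ hnx ?_ ?_ fun i h0 hi => ?_
      · rw [Function.update_of_ne (ne _ (by omega) _ (by omega) (by omega)), Function.update_self]
      · rw [Function.update_self]
      · rw [Function.update_of_ne (ne _ (by omega) _ (by omega) (by omega)),
          Function.update_of_ne (ne _ (by omega) _ (by omega) (by omega))]

end Reduction

/-! ## Sequences of reductions -/

section RemovalChain

variable {n : ℕ} {Q U W : ℕ → ℕ}

/-- After the removal of `Q 0, …, Q (s - 1)` the other vertices form a cycle with non-crossing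
chords. -/
def IsStage (n s : ℕ) (Q : ℕ → ℕ) (Nb : ℕ → Finset ℕ) : Prop :=
  ∃ o : ℕ → ℕ, CycOrder (NbRel Nb) (n - s) o ∧
    ∀ x, (∃ i < n - s, o i = x) ↔ (x < n ∧ ∀ a < s, Q a ≠ x)

/-- The vertices `Q 0, …, Q (s - 1)` are removed one by one; `U a`, `W a` are the neighbours of
`Q a` at the time of its removal. -/
structure RemovalChain (n : ℕ) (Nbs : ℕ → ℕ → Finset ℕ) (Q U W : ℕ → ℕ) (s : ℕ) : Prop where
  lt : ∀ a < s, Q a < n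
  ne : ∀ a b, a < b → b < s → Q a ≠ Q b
  nb : ∀ a < s, Nbs a (Q a) = {U a, W a} ∧ U a ≠ W a ∧
    Nbs (a + 1) = suppress (Q a) (U a) (W a) (Nbs a)

theorem CycOrder.rotate_to_last {V : Type*} {R : V → V → Prop} {k : ℕ} {o : ℕ → V}
    (h : CycOrder R k o) {i : ℕ} (hi : i < k) :
    ∃ r < k, CycOrder R k (fun i => o (rotIdx k r i)) ∧ o (rotIdx k r (k - 1)) = o i ∧
      ∀ x, (∃ i < k, o (rotIdx k r i) = x) ↔ ∃ i < k, o i = x := by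
  have hr : (if i = k - 1 then 0 else i + 1) < k := by split_ifs <;> omega
  generalize hrd : (if i = k - 1 then 0 else i + 1) = r at hr
  refine ⟨r, hr, h.rotate hr, ?_, fun x => ⟨?_, ?_⟩⟩
  · congr 1
    simp only [rotIdx]
    split_ifs at hrd ⊢ <;> omega
  · rintro ⟨j, hj, rfl⟩
    exact ⟨rotIdx k r j, by simp only [rotIdx]; split_ifs <;> omega, rfl⟩
  · rintro ⟨j, hj, rfl⟩
    refine ⟨if r ≤ j then j - r else j + k - r, by split_ifs <;> omega, ?_⟩
    congr 1
    simp only [rotIdx]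
    split_ifs <;> omega

theorem alive_succ {k s : ℕ} {o : ℕ → ℕ} (hk : n - s = k + 1)
    (hinj : ∀ i < k + 1, ∀ j < k + 1, o i = o j → i = j) (hlast : o k = Q s)
    (hal : ∀ x, (∃ i < n - s, o i = x) ↔ (x < n ∧ ∀ a < s, Q a ≠ x)) :
    ∀ x, (∃ i < n - (s + 1), o i = x) ↔ (x < n ∧ ∀ a < s + 1, Q a ≠ x) := by
  intro x
  rw [show n - (s + 1) = k by omega]
  have hx := hal x
  rw [hk] at hx
  constructor
  · rintro ⟨i, hi, rfl⟩
    obtain ⟨h1, h2⟩ := hx.1 ⟨i, Nat.lt_succ_of_lt hi, rfl⟩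
    refine ⟨h1, fun a ha => ?_⟩
    rcases Nat.lt_succ_iff_lt_or_eq.1 ha with ha | rfl
    · exact h2 a ha
    · rw [← hlast]
      intro hc
      have := hinj _ (by omega) _ (by omega) hc
      omega
  · rintro ⟨h1, h2⟩
    obtain ⟨i, hi, rfl⟩ := hx.2 ⟨h1, fun a ha => h2 a (by omega)⟩
    refine ⟨i, ?_, rfl⟩
    have : i ≠ k := by
      rintro rfl
      exact h2 s (by omega) hlast.symm
    omega

/-- Removal of a vertex of degree two, with the vertex moved to the end of the cycle. -/
theorem CycOrder.remove {Nb : ℕ → Finset ℕ} {s k u w : ℕ} {o : ℕ → ℕ} (hk : n - s = k + 1)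
    (hk2 : 2 ≤ k) (h : CycOrder (NbRel Nb) (n - s) o)
    (hal : ∀ x, (∃ i < n - s, o i = x) ↔ (x < n ∧ ∀ a < s, Q a ≠ x))
    (hQ : Q s < n) (hne : ∀ a < s, Q a ≠ Q s) (hnb : Nb (Q s) = {u, w}) (huw : u ≠ w) :
    ∃ r < k + 1, CycOrder (NbRel (suppress (Q s) u w Nb)) k (fun i => o (rotIdx (k + 1) r i)) ∧
      (∀ i < k + 1, ∀ j < k + 1, o (rotIdx (k + 1) r i) = o (rotIdx (k + 1) r j) → i = j) ∧
      (∀ x, (∃ i < n - (s + 1), o (rotIdx (k + 1) r i) = x) ↔ (x < n ∧ ∀ a < s + 1, Q a ≠ x)) ∧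
      o (rotIdx (k + 1) r k) = Q s ∧
      ((u = o (rotIdx (k + 1) r (k - 1)) ∧ w = o (rotIdx (k + 1) r 0)) ∨
        (u = o (rotIdx (k + 1) r 0) ∧ w = o (rotIdx (k + 1) r (k - 1)))) := by
  obtain ⟨i, hi, hoi⟩ := (hal (Q s)).2 ⟨hQ, hne⟩
  rw [hk] at h hi hal
  obtain ⟨r, hr, h', hl, hal'⟩ := h.rotate_to_last hi
  rw [show k + 1 - 1 = k by omega, hoi] at hl
  refine ⟨r, hr, ?_, h'.inj, ?_, hl, ?_⟩
  · have := h'.suppress_last (by omega) huw (by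
      rw [show k + 1 - 1 = k by omega]; simp only [hl]; exact hnb)
    rw [show k + 1 - 1 = k by omega] at this
    simp only [hl] at this
    exact this
  · refine alive_succ hk h'.inj hl fun x => ?_
    rw [hk, hal', hal]
  · have := h'.nb_last (u := u) (w := w) (by omega) (by
      rw [show k + 1 - 1 = k by omega]; simp only [hl]; exact hnb)
    rwa [show k + 1 - 2 = k - 1 by omega] at this

theorem IsStage.succ {Nb : ℕ → Finset ℕ} {s u w : ℕ} (h : IsStage n s Q Nb) (hs : s + 3 ≤ n)
    (hQ : Q s < n) (hne : ∀ a < s, Q a ≠ Q s) (hnb : Nb (Q s) = {u, w}) (huw : u ≠ w) :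
    IsStage n (s + 1) Q (suppress (Q s) u w Nb) := by
  obtain ⟨o, ho, hal⟩ := h
  obtain ⟨r, hr, h1, -, h2, -⟩ := ho.remove (k := n - (s + 1)) (by omega) (by omega) hal hQ hne
    hnb huw
  exact ⟨_, h1, h2⟩

/-- The successor function that is obtained by inserting the last `r` of the `m` removed vertices
in the reverse order. -/
def chainNext (nx : ℕ → ℕ) (Q U W : ℕ → ℕ) (m : ℕ) : ℕ → ℕ → ℕ
  | 0 => nx
  | r + 1 => insertBetween (Q (m - 1 - r)) (U (m - 1 - r)) (W (m - 1 - r)) (chainNext nx Q U W m r)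

/-- Induction on the number of reinserted vertices. It ranges over all enumerations `o` of the
current cycle, since the step passes to a rotation of `o` that ends with the removed vertex. -/
theorem RemovalChain.isNext_or_isPrev {Nbs : ℕ → ℕ → Finset ℕ} {m : ℕ} (hn : n = m + 2)
    (h : RemovalChain n Nbs Q U W m) {nx : ℕ → ℕ} (h1 : nx (U (m - 1)) = W (m - 1))
    (h2 : nx (W (m - 1)) = U (m - 1)) (r : ℕ) :
    r + 1 ≤ m → ∀ o : ℕ → ℕ, CycOrder (NbRel (Nbs (m - (r + 1)))) (n - (m - (r + 1))) o →
      (∀ x, (∃ i < n - (m - (r + 1)), o i = x) ↔ (x < n ∧ ∀ a < m - (r + 1), Q a ≠ x)) →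
      IsNext (r + 3) o (chainNext nx Q U W m (r + 1)) ∨
        IsPrev (r + 3) o (chainNext nx Q U W m (r + 1)) := by
  induction r with
  | zero =>
    intro hr o ho hal
    obtain ⟨g1, g2, g3⟩ := h.nb (m - 1) (by omega)
    obtain ⟨t, ht, c1, c2, c3, c4, c5⟩ := ho.remove (k := 2) (by omega) (by omega) hal
      (h.lt _ (by omega)) (fun a ha => h.ne _ _ ha (by omega)) g1 g2
    have hbase : IsNext 2 (fun i => o (rotIdx (2 + 1) t i)) nx := by
      intro i hi
      interval_cases i
      · show nx (o (rotIdx (2 + 1) t 0)) = o (rotIdx (2 + 1) t 1)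
        rcases c5 with ⟨e1, e2⟩ | ⟨e1, e2⟩
        · rw [← e2, h2, e1]
        · rw [← e1, h1, e2]
      · show nx (o (rotIdx (2 + 1) t 1)) = o (rotIdx (2 + 1) t 0)
        rcases c5 with ⟨e1, e2⟩ | ⟨e1, e2⟩
        · rw [← e2, ← h1, e1]
        · rw [← e1, ← h2, e2]
    have := IsNext.insertBetween (k := 3) (by omega) c2 c5 (Or.inl hbase)
    simp only [show (3 : ℕ) - 1 = 2 from rfl, c4] at this
    exact this.imp (isNext_of_rotate ht) (isPrev_of_rotate ht)
  | succ r ih =>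
    intro hr o ho hal
    have hs : m - (r + 1 + 1) + 1 = m - (r + 1) := by omega
    have hs' : m - 1 - (r + 1) = m - (r + 1 + 1) := by omega
    obtain ⟨g1, g2, g3⟩ := h.nb (m - (r + 1 + 1)) (by omega)
    obtain ⟨t, ht, c1, c2, c3, c4, c5⟩ := ho.remove (k := r + 3) (by omega) (by omega) hal
      (h.lt _ (by omega)) (fun a ha => h.ne _ _ ha (by omega)) g1 g2
    rw [← g3, hs] at c1
    rw [hs] at c3
    have hrec := ih (by omega) _ (by rwa [show n - (m - (r + 1)) = r + 3 by omega]) c3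
    have := IsNext.insertBetween (k := r + 4) (by omega) c2 c5 hrec
    simp only [show r + 4 - 1 = r + 3 from rfl, c4] at this
    rw [chainNext, hs']
    exact this.imp (isNext_of_rotate ht) (isPrev_of_rotate ht)

theorem IsNext.rotate {k r : ℕ} {o nx : ℕ → ℕ} (hr : r < k) (h : IsNext k o nx) :
    IsNext k (fun i => o (rotIdx k r i)) nx := by
  intro i hi
  have := h (rotIdx k r i) (by simp only [rotIdx]; split_ifs <;> omega)
  simp only [rotIdx, nextIdx] at this ⊢
  rw [this]
  congr 1
  split_ifs <;> omega

/-- The reinsertion yields the successor function of a Hamiltonian cycle with non-crossing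
chords. -/
theorem RemovalChain.exists_next {Nbs : ℕ → ℕ → Finset ℕ} {m : ℕ} (hn : n = m + 2) (hm : 1 ≤ m)
    (h : RemovalChain n Nbs Q U W m) (h0 : IsStage n 0 Q (Nbs 0)) {nx : ℕ → ℕ}
    (h1 : nx (U (m - 1)) = W (m - 1)) (h2 : nx (W (m - 1)) = U (m - 1)) :
    ∃ o : ℕ → ℕ, CycOrder (NbRel (Nbs 0)) n o ∧ o 0 = 0 ∧ (∀ i < n, o i < n) ∧
      ∀ i, i + 1 < n → chainNext nx Q U W m m (o i) = o (i + 1) := by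
  obtain ⟨o, ho, hal⟩ := h0
  have hz : m - (m - 1 + 1) = 0 := by omega
  have hmain := h.isNext_or_isPrev hn h1 h2 (m - 1) (by omega) o (by rwa [hz]) (by rwa [hz])
  rw [show m - 1 + 1 = m by omega, show m - 1 + 3 = n by omega] at hmain
  rw [Nat.sub_zero] at ho hal
  have key : ∃ o : ℕ → ℕ, CycOrder (NbRel (Nbs 0)) n o ∧ (∃ i < n, o i = 0) ∧
      (∀ i < n, o i < n) ∧ IsNext n o (chainNext nx Q U W m m) := by
    obtain ⟨i, hi, hi0⟩ := (hal 0).2 ⟨by omega, by simp⟩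
    have hlt : ∀ i < n, o i < n := fun i hi => ((hal (o i)).1 ⟨i, hi, rfl⟩).1
    rcases hmain with hx | hx
    · exact ⟨o, ho, ⟨i, hi, hi0⟩, hlt, hx⟩
    -- A predecessor function is the successor function of the reversed enumeration.
    · refine ⟨_, ho.reverse, ⟨n - 1 - i, by omega, ?_⟩, fun i _ => hlt _ (by omega), ?_⟩
      · rw [show n - 1 - (n - 1 - i) = i by omega, hi0]
      · intro j hj
        simp only [nextIdx]
        split_ifs with hc
        · have := hx (n - 1 - (j + 1)) (by omega)
          simp only [nextIdx] at this
          rwa [if_pos (by omega), show n - 1 - (j + 1) + 1 = n - 1 - j by omega] at this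
        · have := hx (n - 1) (by omega)
          simp only [nextIdx] at this
          rw [if_neg (by omega)] at this
          rwa [show n - 1 - j = 0 by omega]
  obtain ⟨o, ho, ⟨r, hr, hr0⟩, hlt, hx⟩ := key
  refine ⟨_, ho.rotate hr, ?_, fun i hi => hlt _ ?_, fun i hi => ?_⟩
  · simpa [rotIdx, hr] using hr0
  · simp only [rotIdx]; split_ifs <;> omega
  · have := hx.rotate hr i (by omega)
    simp only [nextIdx] at this
    rwa [if_pos hi] at this

/-! ### The queue of vertices of degree two -/

/-- The entries `s, …, tail - 1` of the queue are the remaining vertices of degree two, possibly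
except for elements of `X`. -/
structure QueueInv (n s tail : ℕ) (Q : ℕ → ℕ) (Nb : ℕ → Finset ℕ) (X : Finset ℕ) : Prop where
  le : s ≤ tail
  lt : ∀ a < tail, Q a < n
  ne : ∀ a b, a < b → b < tail → Q a ≠ Q b
  mem : s + 3 ≤ n → ∀ x < n, (∀ a < s, Q a ≠ x) → (Nb x).card = 2 → x ∉ X → ∃ a < tail, Q a = x
  card : s + 3 ≤ n → ∀ a, s ≤ a → a < tail → (Nb (Q a)).card = 2
  fresh : ∀ x ∈ X, (Nb x).card = 2 → ∀ a < tail, Q a ≠ x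

/-- No vertex is queued twice, so the queue fits into one field of the n records. -/
theorem QueueInv.tail_le {s tail : ℕ} {Nb : ℕ → Finset ℕ} {X : Finset ℕ}
    (h : QueueInv n s tail Q Nb X) : tail ≤ n := by
  have := Finset.card_le_card_of_injOn (s := Finset.range tail) (t := Finset.range n) Q
    (fun a ha => Finset.mem_coe.2 (Finset.mem_range.2 (h.lt a (Finset.mem_range.1 ha)))) (by
      intro a ha b hb hab
      have ha' := Finset.mem_range.1 ha
      have hb' := Finset.mem_range.1 hb
      rcases lt_trichotomy a b with hlt | heq | hlt
      · exact absurd hab (h.ne _ _ hlt hb')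
      · exact heq
      · exact absurd hab.symm (h.ne _ _ hlt ha'))
  simpa using this

/-- A cycle with at least three vertices and non-crossing chords has a vertex of degree two, and
with `X = ∅` all of these are queued. With two vertices left the degrees drop to one, hence the
condition `s + 3 ≤ n` here and in the invariant. -/
theorem QueueInv.lt_tail {s tail : ℕ} {Nb : ℕ → Finset ℕ} (h : QueueInv n s tail Q Nb ∅)
    (hst : IsStage n s Q Nb) (hs : s + 3 ≤ n) : s < tail := by
  obtain ⟨o, ho, hal⟩ := hst
  obtain ⟨i, hi, hi2⟩ := ho.exists_card_eq_two (by omega)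
  obtain ⟨h1, h2⟩ := (hal (o i)).1 ⟨i, hi, rfl⟩
  obtain ⟨a, ha, hao⟩ := h.mem hs (o i) h1 h2 hi2 (by simp)
  by_contra hcon
  exact h2 a (by omega) hao

theorem QueueInv.skip {s tail x : ℕ} {Nb : ℕ → Finset ℕ} {X : Finset ℕ}
    (h : QueueInv n s tail Q Nb (insert x X)) (hx : (Nb x).card ≠ 2) :
    QueueInv n s tail Q Nb X := by
  refine ⟨h.le, h.lt, h.ne, fun hs z hz hz1 hz2 hz3 => h.mem hs z hz hz1 hz2 ?_, h.card,
    fun z hz => h.fresh z (Finset.mem_insert_of_mem hz)⟩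
  rw [Finset.mem_insert]
  rintro (rfl | hc)
  · exact hx hz2
  · exact hz3 hc

theorem QueueInv.push {s tail x : ℕ} {Nb : ℕ → Finset ℕ} {X : Finset ℕ}
    (h : QueueInv n s tail Q Nb (insert x X)) (hxX : x ∉ X) (hxn : x < n)
    (hx : (Nb x).card = 2) :
    QueueInv n s (tail + 1) (Function.update Q tail x) Nb X := by
  have hfr := h.fresh x (Finset.mem_insert_self _ _) hx
  have hle := h.le
  have hold : ∀ a < tail, Function.update Q tail x a = Q a := fun a ha =>
    Function.update_of_ne (by omega) _ _
  have hnew : Function.update Q tail x tail = x := Function.update_self _ _ _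
  have hsplit : ∀ a < tail + 1, a < tail ∨ a = tail := fun a ha => by omega
  refine ⟨by omega, fun a ha => ?_, fun a b hab hb => ?_, fun hs z hz hz1 hz2 hz3 => ?_,
    fun hs a ha1 ha2 => ?_, fun z hz hz2 a ha => ?_⟩
  · rcases hsplit a ha with ha | rfl
    · rw [hold a ha]; exact h.lt a ha
    · rwa [hnew]
  · rcases hsplit b hb with hb | rfl
    · rw [hold a (by omega), hold b hb]; exact h.ne a b hab hb
    · rw [hold a hab, hnew]; exact hfr a hab
  · by_cases hzx : z = x
    · exact ⟨tail, by omega, by rw [hnew, hzx]⟩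
    · obtain ⟨a, ha, haz⟩ := h.mem hs z hz (fun a ha => by
        have := hz1 a ha; rwa [hold a (by omega)] at this) hz2 (by simp [hzx, hz3])
      exact ⟨a, by omega, by rwa [hold a ha]⟩
  · rcases hsplit a ha2 with ha | rfl
    · rw [hold a ha]; exact h.card hs a ha1 ha
    · rwa [hnew]
  · rcases hsplit a ha with ha | rfl
    · rw [hold a ha]; exact h.fresh z (Finset.mem_insert_of_mem hz) hz2 a ha
    · rw [hnew]; rintro rfl; exact hxX hz

/-- The queue after a removal. -/
theorem QueueInv.suppress {s tail u w : ℕ} {Nb : ℕ → Finset ℕ} (h : QueueInv n s tail Q Nb ∅)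
    (hst : IsStage n s Q Nb) (hs : s + 3 ≤ n) (hnb : Nb (Q s) = {u, w}) (huw : u ≠ w) :
    QueueInv n (s + 1) tail Q (suppress (Q s) u w Nb) (if w ∈ Nb u then {u, w} else ∅) := by
  have hlt := h.lt_tail hst hs
  have hQ := h.lt s hlt
  have hne : ∀ a < s, Q a ≠ Q s := fun a ha => h.ne a s ha hlt
  obtain ⟨o', ho', hal'⟩ := hst.succ hs hQ hne hnb huw
  obtain ⟨o, ho, hal⟩ := hst
  obtain ⟨i, hi, hoi⟩ := (hal (Q s)).2 ⟨hQ, hne⟩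
  have hsymm : ∀ x ∈ Nb (Q s), Q s ∈ Nb x ∧ x < n ∧ x ≠ Q s ∧ ∀ a < s, Q a ≠ x := by
    intro x hx
    rw [← hoi] at hx
    obtain ⟨j, hj, rfl⟩ := ho.closed i hi x hx
    have := (hal (o j)).1 ⟨j, hj, rfl⟩
    refine ⟨by rw [← hoi]; exact ho.symm i hi j hj hx, this.1, ?_, this.2⟩
    rintro hc
    rw [hc, ← hoi] at hx
    exact ho.irrefl i hi hx
  obtain ⟨su, un, uv, ua⟩ := hsymm u (by rw [hnb]; simp)
  obtain ⟨sw, wn, wv, wa⟩ := hsymm w (by rw [hnb]; simp)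
  have huwsymm : u ∈ Nb w ↔ w ∈ Nb u := by
    obtain ⟨a, ha, hau⟩ := (hal u).2 ⟨un, ua⟩
    obtain ⟨b, hb, hbw⟩ := (hal w).2 ⟨wn, wa⟩
    rw [← hau, ← hbw]
    exact ⟨ho.symm _ hb _ ha, ho.symm _ ha _ hb⟩
  have cother : ∀ x, x ≠ u → x ≠ w → _root_.suppress (Q s) u w Nb x = Nb x := fun x h1 h2 => by
    rw [_root_.suppress, if_neg h1, if_neg h2]
  -- The neighbour Q s is lost and w is gained unless it was there already; so the degree drops by
  -- one exactly if u and w were adjacent.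
  have cu : (_root_.suppress (Q s) u w Nb u).card + (if w ∈ Nb u then 1 else 0) = (Nb u).card := by
    have h1 := Finset.card_erase_add_one su
    rw [_root_.suppress, if_pos rfl]
    split_ifs with hc
    · rw [Finset.insert_eq_of_mem (Finset.mem_erase.2 ⟨wv, hc⟩)]; exact h1
    · rw [Finset.card_insert_of_notMem (fun hh => hc (Finset.mem_of_mem_erase hh))]; exact h1
  have cw : (_root_.suppress (Q s) u w Nb w).card + (if w ∈ Nb u then 1 else 0) = (Nb w).card := by
    have h1 := Finset.card_erase_add_one sw
    rw [_root_.suppress, if_neg huw.symm, if_pos rfl]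
    split_ifs with hc
    · rw [Finset.insert_eq_of_mem (Finset.mem_erase.2 ⟨uv, huwsymm.2 hc⟩)]; exact h1
    · rw [Finset.card_insert_of_notMem
        (fun hh => hc (huwsymm.1 (Finset.mem_of_mem_erase hh)))]; exact h1
  have hidx : ∀ a < tail, (Q a = u ∨ Q a = w) → s < a := by
    intro a ha hau
    by_contra hcon
    rcases (show a < s ∨ a = s by omega) with h1 | rfl
    · exact hau.elim (ua a h1) (wa a h1)
    · exact hau.elim (fun h => uv h.symm) (fun h => wv h.symm)
  refine ⟨hlt, h.lt, h.ne, fun hs' x hx hxa hx2 hxX => ?_, fun hs' a ha1 ha2 => ?_,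
    fun x hx hx2 a ha hax => ?_⟩
  · refine h.mem hs x hx (fun a ha => hxa a (by omega)) ?_ (by simp)
    by_cases hadj : w ∈ Nb u
    · rw [if_pos hadj, Finset.mem_insert, Finset.mem_singleton, not_or] at hxX
      rwa [cother x hxX.1 hxX.2] at hx2
    · rw [if_neg hadj] at cu cw
      by_cases h1 : x = u
      · subst h1; omega
      · by_cases h2 : x = w
        · subst h2; omega
        · rwa [cother x h1 h2] at hx2
  · have hold := h.card hs a (by omega) ha2
    -- A queued vertex cannot lose its degree two: in the new cycle, which still has three vertices,
    -- every degree is at least two.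
    have hge : 2 ≤ (_root_.suppress (Q s) u w Nb (Q a)).card := by
      obtain ⟨j, hj, hja⟩ := (hal' (Q a)).2 ⟨h.lt a ha2, fun b hb => h.ne b a (by omega) ha2⟩
      rw [← hja]
      exact ho'.two_le_card (by omega) hj
    by_cases h1 : Q a = u
    · rw [h1] at hold hge ⊢; omega
    · by_cases h2 : Q a = w
      · rw [h2] at hold hge ⊢; omega
      · rwa [cother _ h1 h2]
  -- A vertex that has just dropped to degree two had degree three, so it was not queued before.
  · split_ifs at hx with hadj
    · rw [if_pos hadj] at cu cw
      rw [Finset.mem_insert, Finset.mem_singleton] at hx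
      have hi := hidx a ha (by rw [hax]; exact hx)
      have hold := h.card hs a hi.le ha
      rw [hax] at hold
      rcases hx with rfl | rfl <;> omega
    · simp at hx

/-- Only the removed entries of the queue matter; pushing vertices changes later entries. -/
theorem IsStage.congr {Nb : ℕ → Finset ℕ} {Q' : ℕ → ℕ} {s : ℕ} (h : IsStage n s Q Nb)
    (hQ : ∀ a < s, Q' a = Q a) : IsStage n s Q' Nb := by
  obtain ⟨o, ho, hal⟩ := h
  refine ⟨o, ho, fun x => ?_⟩
  rw [hal]
  exact and_congr_right fun _ => forall₂_congr fun a ha => by rw [hQ a ha]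

end RemovalChain

/-! ## Verified programs on structured states -/

namespace WordRAM

infixr:67 " ;; " => Program.seq

/-- A state in which the memory is split into an array `A` of records, indexed by a field and a
vertex, a matrix `M`, a table `T` and the input and output cells `I`. -/
structure HState where
  reg : ℕ → ℕ
  A : ℕ → ℕ → ℕ
  M : ℕ → ℕ → ℕ
  T : ℕ → ℕ
  I : ℕ → ℕ

namespace HState

def setR (h : HState) (x a : ℕ) : HState := { h with reg := Function.update h.reg x a }
-- The algorithm uses these fields: 0 to 3 degree and sums over neighbours, 4 queue, 5 and 6 the two
-- neighbours at removal (indexed by the time of removal), 7 successor, 8 position, 9 smallest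
-- neighbour, 10 number of children, 11 height (the last three indexed by position).
def setA (h : HState) (f i a : ℕ) : HState :=
  { h with A := Function.update h.A f (Function.update (h.A f) i a) }
def setM (h : HState) (i j a : ℕ) : HState :=
  { h with M := Function.update h.M i (Function.update (h.M i) j a) }
def setT (h : HState) (i a : ℕ) : HState := { h with T := Function.update h.T i a }
def setI (h : HState) (i a : ℕ) : HState := { h with I := Function.update h.I i a }

variable (h : HState) (x y f g i j a b : ℕ)

@[simp] theorem setR_reg : (h.setR x a).reg y = if y = x then a else h.reg y := by
  simp [setR, Function.update_apply]
@[simp] theorem setR_A : (h.setR x a).A = h.A := rfl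
@[simp] theorem setR_M : (h.setR x a).M = h.M := rfl
@[simp] theorem setR_T : (h.setR x a).T = h.T := rfl
@[simp] theorem setR_I : (h.setR x a).I = h.I := rfl
@[simp] theorem setA_reg : (h.setA f i a).reg = h.reg := rfl
@[simp] theorem setA_A : (h.setA f i a).A g =
    if g = f then Function.update (h.A f) i a else h.A g := by
  simp [setA, Function.update_apply]
@[simp] theorem setA_M : (h.setA f i a).M = h.M := rfl
@[simp] theorem setA_T : (h.setA f i a).T = h.T := rfl
@[simp] theorem setA_I : (h.setA f i a).I = h.I := rfl
@[simp] theorem setM_reg : (h.setM i j a).reg = h.reg := rfl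
@[simp] theorem setM_A : (h.setM i j a).A = h.A := rfl
@[simp] theorem setM_M : (h.setM i j a).M x y = if x = i ∧ y = j then a else h.M x y := by
  simp only [setM, Function.update_apply]
  by_cases h1 : x = i <;> by_cases h2 : y = j <;> simp [h1, h2]
@[simp] theorem setM_T : (h.setM i j a).T = h.T := rfl
@[simp] theorem setM_I : (h.setM i j a).I = h.I := rfl
@[simp] theorem setT_reg : (h.setT i a).reg = h.reg := rfl
@[simp] theorem setT_A : (h.setT i a).A = h.A := rfl
@[simp] theorem setT_M : (h.setT i a).M = h.M := rfl
@[simp] theorem setT_T : (h.setT i a).T j = if j = i then a else h.T j := by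
  simp [setT, Function.update_apply]
@[simp] theorem setT_I : (h.setT i a).I = h.I := rfl
@[simp] theorem setI_reg : (h.setI i a).reg = h.reg := rfl
@[simp] theorem setI_A : (h.setI i a).A = h.A := rfl
@[simp] theorem setI_M : (h.setI i a).M = h.M := rfl
@[simp] theorem setI_T : (h.setI i a).T = h.T := rfl
@[simp] theorem setI_I : (h.setI i a).I j = if j = i then a else h.I j := by
  simp [setI, Function.update_apply]

end HState

/-! ### An expression language and its compilation -/

/-- Expressions; `n` is the number of vertices and `r i` the register `i`. -/
inductive Ex
  | n
  | r (i : ℕ)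
  | c (k : ℕ)
  | op (o : Op) (a b : Ex)
  | A (f : ℕ) (e : Ex)
  | M (a b : Ex)
  | T (e : Ex)
  | I (e : Ex)

instance : Add Ex := ⟨Ex.op .add⟩
instance : Sub Ex := ⟨Ex.op .sub⟩
instance : Mul Ex := ⟨Ex.op .mul⟩
instance : Div Ex := ⟨Ex.op .div⟩
instance (k : ℕ) : OfNat Ex k := ⟨.c k⟩

/-- Value of an operation without overflow. -/
def Op.val : Op → ℕ → ℕ → ℕ
  | .add, x, y => x + y
  | .sub, x, y => x - y
  | .mul, x, y => x * y
  | .div, x, y => x / y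

namespace Ex

def eval (n : ℕ) (h : HState) : Ex → ℕ
  | .n => n
  | .r i => h.reg i
  | .c k => k
  | .op o a b => o.val (eval n h a) (eval n h b)
  | .A f e => h.A f (eval n h e)
  | .M a b => h.M (eval n h a) (eval n h b)
  | .T e => h.T (eval n h e)
  | .I e => h.I (eval n h e)

/-- Evaluation produces no number `≥ B` by additions and multiplications and no index out of
range. -/
def Ok (B n : ℕ) (h : HState) : Ex → Prop
  | .n => True
  | .r i => i < 20
  | .c k => k < B
  | .op .add a b => Ok B n h a ∧ Ok B n h b ∧ eval n h a + eval n h b < B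
  | .op .mul a b => Ok B n h a ∧ Ok B n h b ∧ eval n h a * eval n h b < B
  | .op .sub a b => Ok B n h a ∧ Ok B n h b
  | .op .div a b => Ok B n h a ∧ Ok B n h b
  | .A f e => f < 16 ∧ Ok B n h e ∧ eval n h e < n
  | .M a b => Ok B n h a ∧ Ok B n h b ∧ eval n h a < n ∧ eval n h b < n
  | .T e => Ok B n h e ∧ eval n h e < n * n
  | .I e => Ok B n h e ∧ eval n h e < 16 * n

variable (B m : ℕ) (h : HState) (i k f : ℕ) (a b e : Ex)

@[simp] theorem eval_n : Ex.n.eval m h = m := rfl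
@[simp] theorem eval_r : (Ex.r i).eval m h = h.reg i := rfl
@[simp] theorem eval_ofNat : (ofNat(k) : Ex).eval m h = OfNat.ofNat k := rfl
@[simp] theorem eval_add : (a + b).eval m h = a.eval m h + b.eval m h := rfl
@[simp] theorem eval_sub : (a - b).eval m h = a.eval m h - b.eval m h := rfl
@[simp] theorem eval_mul : (a * b).eval m h = a.eval m h * b.eval m h := rfl
@[simp] theorem eval_div : (a / b).eval m h = a.eval m h / b.eval m h := rfl
@[simp] theorem eval_A : (Ex.A f e).eval m h = h.A f (e.eval m h) := rfl
@[simp] theorem eval_M : (Ex.M a b).eval m h = h.M (a.eval m h) (b.eval m h) := rfl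
@[simp] theorem eval_T : (Ex.T e).eval m h = h.T (e.eval m h) := rfl
@[simp] theorem eval_I : (Ex.I e).eval m h = h.I (e.eval m h) := rfl
@[simp] theorem ok_n : Ex.n.Ok B m h := trivial
@[simp] theorem ok_r : (Ex.r i).Ok B m h ↔ i < 20 := Iff.rfl
@[simp] theorem ok_ofNat : (ofNat(k) : Ex).Ok B m h ↔ OfNat.ofNat k < B := Iff.rfl
@[simp] theorem ok_add : (a + b).Ok B m h ↔
    a.Ok B m h ∧ b.Ok B m h ∧ a.eval m h + b.eval m h < B := Iff.rfl
@[simp] theorem ok_mul : (a * b).Ok B m h ↔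
    a.Ok B m h ∧ b.Ok B m h ∧ a.eval m h * b.eval m h < B := Iff.rfl
@[simp] theorem ok_sub : (a - b).Ok B m h ↔ a.Ok B m h ∧ b.Ok B m h := Iff.rfl
@[simp] theorem ok_div : (a / b).Ok B m h ↔ a.Ok B m h ∧ b.Ok B m h := Iff.rfl
@[simp] theorem ok_A : (Ex.A f e).Ok B m h ↔ f < 16 ∧ e.Ok B m h ∧ e.eval m h < m := Iff.rfl
@[simp] theorem ok_M : (Ex.M a b).Ok B m h ↔
    a.Ok B m h ∧ b.Ok B m h ∧ a.eval m h < m ∧ b.eval m h < m := Iff.rfl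
@[simp] theorem ok_T : (Ex.T e).Ok B m h ↔ e.Ok B m h ∧ e.eval m h < m * m := Iff.rfl
@[simp] theorem ok_I : (Ex.I e).Ok B m h ↔ e.Ok B m h ∧ e.eval m h < 16 * m := Iff.rfl

end Ex

/-- A sequence of elementary instructions. -/
def block : List Instr → Program
  | [] => .skip
  | i :: l => .seq (.instr i) (block l)

/-- A bound for the running time of a program whose loops are not nested and make at most `N`
iterations. -/
def timeBound : ℕ → Program → ℕ
  | _, .skip => 0
  | _, .instr _ => 1
  | N, .seq p q => timeBound N p + timeBound N q
  | N, .ifLt _ _ p q => 1 + (timeBound N p + timeBound N q)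
  | N, .whileLt _ _ p => N * (1 + timeBound 0 p) + 1

/-- The coefficient of `N` in the bound `timeBound N`. -/
def timeSlope : Program → ℕ
  | .skip => 0
  | .instr _ => 0
  | .seq p q => timeSlope p + timeSlope q
  | .ifLt _ _ p q => timeSlope p + timeSlope q
  | .whileLt _ _ p => 1 + timeBound 0 p

/-- The program is fixed, so its bound is linear in the number of iterations; this is where linear
running time comes from. -/
theorem timeBound_eq (N : ℕ) (p : Program) : timeBound N p = timeBound 0 p + N * timeSlope p := by
  induction p with
  | skip => simp [timeBound, timeSlope]
  | instr i => simp [timeBound, timeSlope]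
  | seq p q hp hq => simp only [timeBound, timeSlope, hp, hq]; ring
  | ifLt a b p q hp hq => simp only [timeBound, timeSlope, hp, hq]; ring
  | whileLt a b p hp => simp only [timeBound, timeSlope]; ring

theorem timeBound_mono (N : ℕ) (p : Program) : timeBound 0 p ≤ timeBound N p := by
  rw [timeBound_eq N]; omega

theorem runs_block (w : ℕ) (l : List Instr) (s : State) :
    Runs w (block l) s (timeBound 0 (block l)) (l.foldl (fun s i => i.run w s) s) := by
  induction l generalizing s with
  | nil => exact .skip
  | cons i l ih => exact .seq .instr (ih _)

/-- Instructions that turn an index in register `t` into the address of a record field. -/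
def addrA (f t : ℕ) : List Instr :=
  [.arith .add t t 20, .const (t + 1) 16, .arith .mul t t (t + 1), .const (t + 1) f,
    .arith .add t t (t + 1)]

/-- Instructions that turn indices in the registers `t`, `t + 1` into the address of a matrix
entry. -/
def addrM (t : ℕ) : List Instr :=
  [.arith .mul t t 20, .arith .add t t (t + 1), .const (t + 1) 32, .arith .mul (t + 1) (t + 1) 20,
    .arith .add t t (t + 1)]

/-- Instructions that turn an index in register `t` into the address of a table entry. -/
def addrT (t : ℕ) : List Instr :=
  [.const (t + 1) 32, .arith .mul (t + 1) (t + 1) 20, .arith .add t t (t + 1),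
    .arith .mul (t + 1) 20 20, .arith .add t t (t + 1)]

/-- A program that puts the value of an expression into register `t`, using only registers from
`t` on. -/
def Ex.comp : Ex → ℕ → Program
  | .n, t => block [.const t 0, .arith .add t t 20]
  | .r i, t => block [.const (t + 1) 0, .arith .sub t i (t + 1)]
  | .c k, t => block [.const t k]
  | .op o a b, t => a.comp t ;; b.comp (t + 1) ;; .instr (.arith o t t (t + 1))
  | .A f e, t => e.comp t ;; block (addrA f t) ;; .instr (.load t t)
  | .M a b, t => a.comp t ;; b.comp (t + 1) ;; block (addrM t) ;; .instr (.load t t)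
  | .T e, t => e.comp t ;; block (addrT t) ;; .instr (.load t t)
  | .I e, t => e.comp t ;; .instr (.load t t)

/-- The state `s` holds the structured state `h` for `n` vertices. -/
structure Sim (n : ℕ) (h : HState) (s : State) : Prop where
  reg : ∀ i < 20, s.reg i = h.reg i
  size : s.reg 20 = n
  A : ∀ f < 16, ∀ i < n, s.mem ((i + n) * 16 + f) = h.A f i
  M : ∀ i < n, ∀ j < n, s.mem (i * n + j + 32 * n) = h.M i j
  T : ∀ i < n * n, s.mem (i + 32 * n + n * n) = h.T i
  I : ∀ i < 16 * n, s.mem i = h.I i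

/-- The words are long enough for the addresses. -/
structure Fits (w n : ℕ) : Prop where
  pos : 1 ≤ n
  le : 100 * (n * n) ≤ 2 ^ w

theorem Fits.lin {w n : ℕ} (h : Fits w n) : 100 * n ≤ 2 ^ w := by
  have := h.le
  have := Nat.le_mul_self n
  omega

theorem Fits.ne_zero {w n : ℕ} (h : Fits w n) : w ≠ 0 := by
  rintro rfl
  have := h.lin
  have := h.pos
  omega

variable {w n : ℕ}

/-- The memory consists of cells below 16 n for `I`, then n records of 16 cells, then the n² matrix
entries and the n² table entries. All addresses are below 32 n + 2 n², so `Fits` excludes any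
reduction modulo `2 ^ w`. -/
theorem foldl_addrA (hw : Fits w n) {s : State} {f t i : ℕ} (hs : s.reg 20 = n)
    (hi : s.reg t = i) (hin : i < n) (hf : f < 16) :
    ∃ s', (addrA f t).foldl (fun s i => i.run w s) s = s' ∧ s'.mem = s.mem ∧
      (∀ x < t, s'.reg x = s.reg x) ∧ s'.reg t = (i + n) * 16 + f := by
  have h1 := hw.lin
  have h2 := hw.pos
  refine ⟨_, rfl, rfl, fun x hx => ?_, ?_⟩
  · simp [addrA, Instr.run, Op.eval, hx.ne, (show x ≠ t + 1 by omega)]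
  · have e1 : (i + n) % 2 ^ w = i + n := Nat.mod_eq_of_lt (by omega)
    have e2 : 16 % 2 ^ w = 16 := Nat.mod_eq_of_lt (by omega)
    have e3 : f % 2 ^ w = f := Nat.mod_eq_of_lt (by omega)
    have e4 : (i + n) * 16 % 2 ^ w = (i + n) * 16 := Nat.mod_eq_of_lt (by omega)
    have e5 : ((i + n) * 16 + f) % 2 ^ w = (i + n) * 16 + f := Nat.mod_eq_of_lt (by omega)
    simp [addrA, Instr.run, Op.eval, hs, hi,
      e1, e2, e3, e4, e5, -Nat.add_mod_mod, -Nat.mod_add_mod, -Nat.mod_mul_mod, -Nat.mul_mod_mod]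

theorem foldl_addrM (hw : Fits w n) {s : State} {t i j : ℕ} (ht : 21 ≤ t) (hs : s.reg 20 = n)
    (hi : s.reg t = i) (hj : s.reg (t + 1) = j) (hin : i < n) (hjn : j < n) :
    ∃ s', (addrM t).foldl (fun s i => i.run w s) s = s' ∧ s'.mem = s.mem ∧
      (∀ x < t, s'.reg x = s.reg x) ∧ s'.reg t = i * n + j + 32 * n := by
  have h1 := hw.lin
  have h2 := hw.pos
  have h3 := hw.le
  have h4 : i * n ≤ n * n := Nat.mul_le_mul_right _ hin.le
  have h5 : n ≤ n * n := Nat.le_mul_self n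
  refine ⟨_, rfl, rfl, fun x hx => ?_, ?_⟩
  · simp [addrM, Instr.run, Op.eval, hx.ne, (show x ≠ t + 1 by omega)]
  · have e1 : i * n % 2 ^ w = i * n := Nat.mod_eq_of_lt (by omega)
    have e2 : 32 % 2 ^ w = 32 := Nat.mod_eq_of_lt (by omega)
    have e3 : (i * n + j) % 2 ^ w = i * n + j := Nat.mod_eq_of_lt (by omega)
    have e4 : 32 * n % 2 ^ w = 32 * n := Nat.mod_eq_of_lt (by omega)
    have e5 : (i * n + j + 32 * n) % 2 ^ w = i * n + j + 32 * n := Nat.mod_eq_of_lt (by omega)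
    simp [addrM, Instr.run, Op.eval, hs, hi, hj, (show 20 ≠ t by omega),
      (show 20 ≠ t + 1 by omega),
      e1, e2, e3, e4, e5, -Nat.add_mod_mod, -Nat.mod_add_mod, -Nat.mod_mul_mod, -Nat.mul_mod_mod]

theorem foldl_addrT (hw : Fits w n) {s : State} {t i : ℕ} (ht : 21 ≤ t) (hs : s.reg 20 = n)
    (hi : s.reg t = i) (hin : i < n * n) :
    ∃ s', (addrT t).foldl (fun s i => i.run w s) s = s' ∧ s'.mem = s.mem ∧
      (∀ x < t, s'.reg x = s.reg x) ∧ s'.reg t = i + 32 * n + n * n := by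
  have h1 := hw.lin
  have h2 := hw.pos
  have h3 := hw.le
  have h5 : n ≤ n * n := Nat.le_mul_self n
  refine ⟨_, rfl, rfl, fun x hx => ?_, ?_⟩
  · simp [addrT, Instr.run, Op.eval, Function.update_apply, hx.ne, (show x ≠ t + 1 by omega)]
  · have e2 : 32 % 2 ^ w = 32 := Nat.mod_eq_of_lt (by omega)
    have e1 : n * n % 2 ^ w = n * n := Nat.mod_eq_of_lt (by omega)
    have e4 : 32 * n % 2 ^ w = 32 * n := Nat.mod_eq_of_lt (by omega)
    have e3 : (i + 32 * n) % 2 ^ w = i + 32 * n := Nat.mod_eq_of_lt (by omega)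
    have e5 : (i + 32 * n + n * n) % 2 ^ w = i + 32 * n + n * n := Nat.mod_eq_of_lt (by omega)
    simp [addrT, Instr.run, Op.eval, hs, hi, (show 20 ≠ t by omega),
      (show 20 ≠ t + 1 by omega),
      e1, e2, e3, e4, e5, -Nat.add_mod_mod, -Nat.mod_add_mod, -Nat.mod_mul_mod, -Nat.mul_mod_mod]

/-- `p` stops in time and does not change the memory and the registers below `t`; it leaves `a`
in register `t`. -/
def Computes (w : ℕ) (p : Program) (s : State) (t a : ℕ) : Prop :=
  ∃ s', Runs w p s (timeBound 0 p) s' ∧ s'.mem = s.mem ∧ (∀ x < t, s'.reg x = s.reg x) ∧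
    s'.reg t = a

theorem Sim.of_eq {h : HState} {s s' : State} {t : ℕ} (hS : Sim n h s) (ht : 21 ≤ t)
    (hm : s'.mem = s.mem) (hr : ∀ x < t, s'.reg x = s.reg x) : Sim n h s' := by
  refine ⟨fun i hi => ?_, ?_, ?_, ?_, ?_, ?_⟩
  · rw [hr i (by omega)]; exact hS.reg i hi
  · rw [hr 20 (by omega)]; exact hS.size
  · rw [hm]; exact hS.A
  · rw [hm]; exact hS.M
  · rw [hm]; exact hS.T
  · rw [hm]; exact hS.I

/-- The registers from t on serve as a stack: the first operand waits in t while the second one is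
evaluated from t + 1 on, and memory is never written. -/
theorem Ex.comp_computes (hw : Fits w n) {h : HState} (e : Ex) :
    ∀ {s : State} {t : ℕ}, Sim n h s → 21 ≤ t → e.Ok (2 ^ w) n h →
      Computes w (e.comp t) s t (e.eval n h) := by
  have hlin := hw.lin
  have hpos := hw.pos
  induction e with
  | n =>
    intro s t hS ht _
    refine ⟨_, runs_block w _ s, rfl, fun x hx => ?_, ?_⟩
    · simp [Instr.run, Function.update_apply, hx.ne]
    · have e1 : n % 2 ^ w = n := Nat.mod_eq_of_lt (by omega)
      simp [Instr.run, Op.eval, (show 20 ≠ t by omega), hS.size, e1,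
        Ex.eval]
  | r i =>
    intro s t hS ht hi
    have hi : i < 20 := hi
    refine ⟨_, runs_block w _ s, rfl, fun x hx => ?_, ?_⟩
    · simp [Instr.run, Function.update_apply, hx.ne, (show x ≠ t + 1 by omega)]
    · simp [Instr.run, Op.eval, (show i ≠ t + 1 by omega), hS.reg i hi,
        Ex.eval]
  | c k =>
    intro s t hS ht hk
    refine ⟨_, runs_block w _ s, rfl, fun x hx => ?_, ?_⟩
    · simp [Instr.run, hx.ne]
    · simp [Instr.run, Ex.eval, Nat.mod_eq_of_lt (show k < 2 ^ w from hk)]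
  | op o a b iha ihb =>
    intro s t hS ht hok
    have hok' : a.Ok (2 ^ w) n h ∧ b.Ok (2 ^ w) n h := by
      cases o
      · exact ⟨hok.1, hok.2.1⟩
      · exact hok
      · exact ⟨hok.1, hok.2.1⟩
      · exact hok
    obtain ⟨s1, r1, m1, k1, v1⟩ := iha hS ht hok'.1
    obtain ⟨s2, r2, m2, k2, v2⟩ := ihb (hS.of_eq ht m1 k1) (by omega : 21 ≤ t + 1) hok'.2
    refine ⟨_, .seq r1 (.seq r2 .instr), m2.trans m1, fun x hx => ?_, ?_⟩
    · simp only [Instr.run, Function.update_of_ne hx.ne]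
      rw [k2 x (by omega), k1 x hx]
    · simp only [Instr.run, Function.update_self]
      rw [k2 t (by omega), v1, v2]
      cases o
      · exact Nat.mod_eq_of_lt hok.2.2
      · rfl
      · exact Nat.mod_eq_of_lt hok.2.2
      · rfl
  | A f e ih =>
    intro s t hS ht hok
    obtain ⟨s1, r1, m1, k1, v1⟩ := ih hS ht hok.2.1
    have hS1 := hS.of_eq ht m1 k1
    obtain ⟨s2, e2, m2, k2, v2⟩ := foldl_addrA hw hS1.size v1 hok.2.2 hok.1
    have hb := runs_block w (addrA f t) s1
    rw [e2] at hb
    refine ⟨_, .seq r1 (.seq hb .instr), m2.trans m1, fun x hx => ?_, ?_⟩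
    · simp only [Instr.run, Function.update_of_ne hx.ne]
      rw [k2 x hx, k1 x hx]
    · simp only [Instr.run, Function.update_self]
      rw [v2, (hS1.of_eq ht m2 k2).A f hok.1 _ hok.2.2]
      rfl
  | M a b iha ihb =>
    intro s t hS ht hok
    obtain ⟨s1, r1, m1, k1, v1⟩ := iha hS ht hok.1
    have hS1 := hS.of_eq ht m1 k1
    obtain ⟨s2, r2, m2, k2, v2⟩ := ihb hS1 (by omega : 21 ≤ t + 1) hok.2.1
    have hS2 := hS1.of_eq (by omega : 21 ≤ t + 1) m2 k2
    obtain ⟨s3, e3, m3, k3, v3⟩ := foldl_addrM hw ht hS2.size ((k2 t (by omega)).trans v1) v2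
      hok.2.2.1 hok.2.2.2
    have hb := runs_block w (addrM t) s2
    rw [e3] at hb
    refine ⟨_, .seq r1 (.seq r2 (.seq hb .instr)), m3.trans (m2.trans m1), fun x hx => ?_, ?_⟩
    · simp only [Instr.run, Function.update_of_ne hx.ne]
      rw [k3 x hx, k2 x (by omega), k1 x hx]
    · simp only [Instr.run, Function.update_self]
      rw [v3, (hS2.of_eq ht m3 k3).M _ hok.2.2.1 _ hok.2.2.2]
      rfl
  | T e ih =>
    intro s t hS ht hok
    obtain ⟨s1, r1, m1, k1, v1⟩ := ih hS ht hok.1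
    have hS1 := hS.of_eq ht m1 k1
    obtain ⟨s2, e2, m2, k2, v2⟩ := foldl_addrT hw ht hS1.size v1 hok.2
    have hb := runs_block w (addrT t) s1
    rw [e2] at hb
    refine ⟨_, .seq r1 (.seq hb .instr), m2.trans m1, fun x hx => ?_, ?_⟩
    · simp only [Instr.run, Function.update_of_ne hx.ne]
      rw [k2 x hx, k1 x hx]
    · simp only [Instr.run, Function.update_self]
      rw [v2, (hS1.of_eq ht m2 k2).T _ hok.2]
      rfl
  | I e ih =>
    intro s t hS ht hok
    obtain ⟨s1, r1, m1, k1, v1⟩ := ih hS ht hok.1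
    refine ⟨_, .seq r1 .instr, m1, fun x hx => ?_, ?_⟩
    · simp only [Instr.run, Function.update_of_ne hx.ne]
      rw [k1 x hx]
    · simp only [Instr.run, Function.update_self]
      rw [v1, (hS.of_eq ht m1 k1).I _ hok.2]
      rfl

/-! ### Statements -/

/-- Subtracting 0 copies a register, as there is no instruction for this. -/
def setR (x : ℕ) (e : Ex) : Program := e.comp 21 ;; block [.const 22 0, .arith .sub x 21 22]
-- The address waits in register 21 while the value is computed in register 22.
def setA (f : ℕ) (i e : Ex) : Program :=
  i.comp 21 ;; block (addrA f 21) ;; e.comp 22 ;; .instr (.store 21 22)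
def setM (i j e : Ex) : Program :=
  i.comp 21 ;; j.comp 22 ;; block (addrM 21) ;; e.comp 22 ;; .instr (.store 21 22)
def setT (i e : Ex) : Program :=
  i.comp 21 ;; block (addrT 21) ;; e.comp 22 ;; .instr (.store 21 22)
def setI (i e : Ex) : Program := i.comp 21 ;; e.comp 22 ;; .instr (.store 21 22)
def ifLess (a b : Ex) (p q : Program) : Program := a.comp 21 ;; b.comp 22 ;; .ifLt 21 22 p q

/-- From every state that holds `h`, the program `p` stops in time in a state that holds a
structured state with the property `Q`. -/
def Spec (w n N : ℕ) (p : Program) (h : HState) (Q : HState → Prop) : Prop :=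
  ∀ s, Sim n h s → ∃ t s' h', Runs w p s t s' ∧ t ≤ timeBound N p ∧ Sim n h' s' ∧ Q h'

variable {N : ℕ} {h : HState} {Q : HState → Prop}

theorem Spec.mono {p : Program} {Q' : HState → Prop} (hp : Spec w n N p h Q)
    (hQ : ∀ h', Q h' → Q' h') : Spec w n N p h Q' := by
  intro s hs
  obtain ⟨t, s', h', h1, h2, h3, h4⟩ := hp s hs
  exact ⟨t, s', h', h1, h2, h3, hQ h' h4⟩

theorem spec_skip (hQ : Q h) : Spec w n N .skip h Q := fun s hs =>
  ⟨_, s, h, .skip, le_rfl, hs, hQ⟩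

/-- The postcondition of the first program is the specification of the second, so proofs follow the
program from front to back. -/
theorem spec_seq {p q : Program} (hp : Spec w n N p h fun h' => Spec w n N q h' Q) :
    Spec w n N (p ;; q) h Q := by
  intro s hs
  obtain ⟨t, s', h', h1, h2, h3, h4⟩ := hp s hs
  obtain ⟨t', s'', h'', g1, g2, g3, g4⟩ := h4 s' h3
  exact ⟨_, s'', h'', .seq h1 g1, add_le_add h2 g2, g3, g4⟩

theorem spec_setR (hw : Fits w n) {x : ℕ} {e : Ex} (hx : x < 20) (he : e.Ok (2 ^ w) n h)
    (hQ : Q (h.setR x (e.eval n h))) : Spec w n N (setR x e) h Q := by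
  intro s hS
  obtain ⟨s1, r1, m1, k1, v1⟩ := e.comp_computes hw hS le_rfl he
  have hS1 := hS.of_eq le_rfl m1 k1
  refine ⟨_, _, _, .seq r1 (runs_block w _ s1), timeBound_mono N (setR x e), ?_, hQ⟩
  refine ⟨fun i hi => ?_, ?_, ?_, ?_, ?_, ?_⟩
  · simp only [List.foldl_cons, List.foldl_nil, Instr.run, Op.eval, HState.setR_reg,
      Function.update_apply]
    by_cases hix : i = x
    · simp [hix, v1]
    · simp [hix, (show i ≠ 22 by omega), hS1.reg i hi]
  · simp [Instr.run, (show 20 ≠ x by omega), hS1.size]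
  · exact hS1.A
  · exact hS1.M
  · exact hS1.T
  · exact hS1.I

/-- Memory cells of different kinds or with different indices have different addresses. -/
theorem Sim.store {h h' : HState} {s s' : State} {t ad v : ℕ} (hS : Sim n h s) (ht : 21 ≤ t)
    (hm : s'.mem = Function.update s.mem ad v) (hr : ∀ x < t, s'.reg x = s.reg x)
    (hreg : h'.reg = h.reg)
    (hA : ∀ f < 16, ∀ i < n, h'.A f i = if (i + n) * 16 + f = ad then v else h.A f i)
    (hM : ∀ i < n, ∀ j < n, h'.M i j = if i * n + j + 32 * n = ad then v else h.M i j)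
    (hT : ∀ i < n * n, h'.T i = if i + 32 * n + n * n = ad then v else h.T i)
    (hI : ∀ i < 16 * n, h'.I i = if i = ad then v else h.I i) : Sim n h' s' := by
  refine ⟨fun i hi => ?_, ?_, fun f hf i hi => ?_, fun i hi j hj => ?_, fun i hi => ?_,
    fun i hi => ?_⟩
  · rw [hr i (by omega), hreg]; exact hS.reg i hi
  · rw [hr 20 (by omega)]; exact hS.size
  · rw [hm, Function.update_apply, hA f hf i hi, hS.A f hf i hi]
  · rw [hm, Function.update_apply, hM i hi j hj, hS.M i hi j hj]
  · rw [hm, Function.update_apply, hT i hi, hS.T i hi]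
  · rw [hm, Function.update_apply, hI i hi, hS.I i hi]

theorem matrix_lt {i j : ℕ} (hi : i < n) (hj : j < n) : i * n + j < n * n := by
  have : (i + 1) * n ≤ n * n := Nat.mul_le_mul_right _ hi
  rw [add_mul, one_mul] at this
  omega

theorem spec_setA (hw : Fits w n) {f : ℕ} {i e : Ex} (hf : f < 16) (hi : i.Ok (2 ^ w) n h)
    (hin : i.eval n h < n) (he : e.Ok (2 ^ w) n h)
    (hQ : Q (h.setA f (i.eval n h) (e.eval n h))) : Spec w n N (setA f i e) h Q := by
  intro s hS
  obtain ⟨s1, r1, m1, k1, v1⟩ := i.comp_computes hw hS le_rfl hi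
  have hS1 := hS.of_eq le_rfl m1 k1
  obtain ⟨s2, e2, m2, k2, v2⟩ := foldl_addrA hw hS1.size v1 hin hf
  have hb := runs_block w (addrA f 21) s1
  rw [e2] at hb
  have hS2 := hS1.of_eq le_rfl m2 k2
  obtain ⟨s3, r3, m3, k3, v3⟩ := e.comp_computes hw hS2 (by omega : 21 ≤ 22) he
  refine ⟨_, _, _, .seq r1 (.seq hb (.seq r3 .instr)), timeBound_mono N (setA f i e), ?_, hQ⟩
  refine hS2.store (t := 21) (ad := (i.eval n h + n) * 16 + f) (v := e.eval n h) le_rfl ?_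
    (fun x hx => ?_) rfl (fun g hg j hj => ?_) (fun a ha b hb => ?_) (fun a ha => ?_)
    fun a ha => ?_
  · simp only [Instr.run]
    rw [m3, v3, k3 21 (by omega), v2]
  · simp only [Instr.run]
    exact k3 x (by omega)
  · rw [HState.setA_A]
    by_cases h1 : g = f
    · subst h1
      rw [if_pos rfl, Function.update_apply]
      exact if_congr (by omega) rfl rfl
    · rw [if_neg h1, if_neg (by omega)]
  · rw [if_neg (by omega), HState.setA_M]
  · rw [if_neg (by omega), HState.setA_T]
  · rw [if_neg (by omega), HState.setA_I]

theorem spec_setM (hw : Fits w n) {i j e : Ex} (hi : i.Ok (2 ^ w) n h) (hj : j.Ok (2 ^ w) n h)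
    (hin : i.eval n h < n) (hjn : j.eval n h < n) (he : e.Ok (2 ^ w) n h)
    (hQ : Q (h.setM (i.eval n h) (j.eval n h) (e.eval n h))) : Spec w n N (setM i j e) h Q := by
  intro s hS
  obtain ⟨s1, r1, m1, k1, v1⟩ := i.comp_computes hw hS le_rfl hi
  have hS1 := hS.of_eq le_rfl m1 k1
  obtain ⟨s1', r1', m1', k1', v1'⟩ := j.comp_computes hw hS1 (by omega : 21 ≤ 22) hj
  have hS1' := hS1.of_eq (by omega : 21 ≤ 22) m1' k1'
  obtain ⟨s2, e2, m2, k2, v2⟩ := foldl_addrM hw le_rfl hS1'.size ((k1' 21 (by omega)).trans v1) v1'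
    hin hjn
  have hb := runs_block w (addrM 21) s1'
  rw [e2] at hb
  have hS2 := hS1'.of_eq le_rfl m2 k2
  obtain ⟨s3, r3, m3, k3, v3⟩ := e.comp_computes hw hS2 (by omega : 21 ≤ 22) he
  refine ⟨_, _, _, .seq r1 (.seq r1' (.seq hb (.seq r3 .instr))), timeBound_mono N (setM i j e),
    ?_, hQ⟩
  have hlt := matrix_lt hin hjn
  refine hS2.store (t := 21) (ad := i.eval n h * n + j.eval n h + 32 * n) (v := e.eval n h) le_rfl
    ?_ (fun x hx => ?_) rfl (fun g hg a ha => ?_) (fun a ha b hb => ?_) (fun a ha => ?_)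
    fun a ha => ?_
  · simp only [Instr.run]
    rw [m3, v3, k3 21 (by omega), v2]
  · simp only [Instr.run]
    exact k3 x (by omega)
  · rw [if_neg (by omega), HState.setM_A]
  · rw [HState.setM_M]
    refine if_congr ⟨fun hab => by rw [hab.1, hab.2], fun hab => ?_⟩ rfl rfl
    -- Quotient and remainder by n recover row and column from an address.
    have hab' : a * n + b = i.eval n h * n + j.eval n h := by omega
    have hd := congrArg (· / n) hab'
    have hm := congrArg (· % n) hab'
    simp only [mul_comm _ n, Nat.mul_add_div (show 0 < n from hw.pos), Nat.div_eq_of_lt hb,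
      Nat.div_eq_of_lt hjn, Nat.mul_add_mod, Nat.mod_eq_of_lt hb, Nat.mod_eq_of_lt hjn] at hd hm
    exact ⟨by omega, hm⟩
  · rw [if_neg (by omega), HState.setM_T]
  · rw [if_neg (by omega), HState.setM_I]

theorem spec_setT (hw : Fits w n) {i e : Ex} (hi : i.Ok (2 ^ w) n h)
    (hin : i.eval n h < n * n) (he : e.Ok (2 ^ w) n h)
    (hQ : Q (h.setT (i.eval n h) (e.eval n h))) : Spec w n N (setT i e) h Q := by
  intro s hS
  obtain ⟨s1, r1, m1, k1, v1⟩ := i.comp_computes hw hS le_rfl hi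
  have hS1 := hS.of_eq le_rfl m1 k1
  obtain ⟨s2, e2, m2, k2, v2⟩ := foldl_addrT hw le_rfl hS1.size v1 hin
  have hb := runs_block w (addrT 21) s1
  rw [e2] at hb
  have hS2 := hS1.of_eq le_rfl m2 k2
  obtain ⟨s3, r3, m3, k3, v3⟩ := e.comp_computes hw hS2 (by omega : 21 ≤ 22) he
  refine ⟨_, _, _, .seq r1 (.seq hb (.seq r3 .instr)), timeBound_mono N (setT i e), ?_, hQ⟩
  refine hS2.store (t := 21) (ad := i.eval n h + 32 * n + n * n) (v := e.eval n h) le_rfl ?_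
    (fun x hx => ?_) rfl (fun g hg j hj => ?_) (fun a ha b hb => ?_) (fun a ha => ?_)
    fun a ha => ?_
  · simp only [Instr.run]
    rw [m3, v3, k3 21 (by omega), v2]
  · simp only [Instr.run]
    exact k3 x (by omega)
  · rw [if_neg (by omega), HState.setT_A]
  · have := matrix_lt ha hb
    rw [if_neg (by omega), HState.setT_M]
  · rw [HState.setT_T]
    exact if_congr (by omega) rfl rfl
  · rw [if_neg (by omega), HState.setT_I]

theorem spec_setI (hw : Fits w n) {i e : Ex} (hi : i.Ok (2 ^ w) n h)
    (hin : i.eval n h < 16 * n) (he : e.Ok (2 ^ w) n h)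
    (hQ : Q (h.setI (i.eval n h) (e.eval n h))) : Spec w n N (setI i e) h Q := by
  intro s hS
  obtain ⟨s1, r1, m1, k1, v1⟩ := i.comp_computes hw hS le_rfl hi
  have hS1 := hS.of_eq le_rfl m1 k1
  obtain ⟨s3, r3, m3, k3, v3⟩ := e.comp_computes hw hS1 (by omega : 21 ≤ 22) he
  refine ⟨_, _, _, .seq r1 (.seq r3 .instr), timeBound_mono N (setI i e), ?_, hQ⟩
  refine hS1.store (t := 21) (ad := i.eval n h) (v := e.eval n h) le_rfl ?_
    (fun x hx => ?_) rfl (fun g hg j hj => ?_) (fun a ha b hb => ?_) (fun a ha => ?_)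
    fun a ha => ?_
  · simp only [Instr.run]
    rw [m3, v3, k3 21 (by omega), v1]
  · simp only [Instr.run]
    exact k3 x (by omega)
  · rw [if_neg (by omega), HState.setI_A]
  · rw [if_neg (by omega), HState.setI_M]
  · rw [if_neg (by omega), HState.setI_T]
  · rw [HState.setI_I]

theorem spec_ifLess (hw : Fits w n) {a b : Ex} {p q : Program} (ha : a.Ok (2 ^ w) n h)
    (hb : b.Ok (2 ^ w) n h) (hp : a.eval n h < b.eval n h → Spec w n N p h Q)
    (hq : ¬ a.eval n h < b.eval n h → Spec w n N q h Q) : Spec w n N (ifLess a b p q) h Q := by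
  intro s hS
  obtain ⟨s1, r1, m1, k1, v1⟩ := a.comp_computes hw hS le_rfl ha
  have hS1 := hS.of_eq le_rfl m1 k1
  obtain ⟨s2, r2, m2, k2, v2⟩ := b.comp_computes hw hS1 (by omega : 21 ≤ 22) hb
  have hS2 := hS1.of_eq (by omega : 21 ≤ 22) m2 k2
  have t1 := timeBound_mono N (a.comp 21)
  have t2 := timeBound_mono N (b.comp 22)
  have v1' : s2.reg 21 = a.eval n h := by rw [k2 21 (by omega), v1]
  by_cases hlt : a.eval n h < b.eval n h
  · obtain ⟨t, s', h', g1, g2, g3, g4⟩ := hp hlt s2 hS2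
    refine ⟨_, s', h', .seq r1 (.seq r2 (.ifTrue (by rw [v1', v2]; exact hlt) g1)), ?_, g3, g4⟩
    simp only [ifLess, timeBound]
    omega
  · obtain ⟨t, s', h', g1, g2, g3, g4⟩ := hq hlt s2 hS2
    refine ⟨_, s', h', .seq r1 (.seq r2 (.ifFalse (by rw [v1', v2]; exact hlt) g1)), ?_, g3, g4⟩
    simp only [ifLess, timeBound]
    omega

/-- Loops with the counter `x`, the bound `b` and `K` iterations. -/
theorem spec_while {x b K : ℕ} {p : Program} (hx : x < 20) (hb : b < 20) (Inv : ℕ → HState → Prop)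
    (hreg : ∀ i h, Inv i h → h.reg x = i ∧ h.reg b = K) (hK : K ≤ N) (h0 : Inv 0 h)
    (hstep : ∀ i < K, ∀ h, Inv i h → Spec w n 0 p h (Inv (i + 1))) (hQ : ∀ h, Inv K h → Q h) :
    Spec w n N (.whileLt x b p) h Q := by
  have key : ∀ d i, i + d = K → ∀ h s, Inv i h → Sim n h s → ∃ t s' h',
      Runs w (.whileLt x b p) s t s' ∧ t ≤ d * (1 + timeBound 0 p) + 1 ∧ Sim n h' s' ∧ Q h' := by
    intro d
    induction d with
    | zero =>
      intro i hi h s hinv hS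
      obtain rfl : i = K := by omega
      obtain ⟨g1, g2⟩ := hreg i h hinv
      refine ⟨1, s, h, .whileFalse ?_, by simp, hS, hQ h hinv⟩
      rw [hS.reg x hx, hS.reg b hb, g1, g2]
      exact lt_irrefl _
    | succ d ih =>
      intro i hi h s hinv hS
      obtain ⟨g1, g2⟩ := hreg i h hinv
      obtain ⟨t, s', h', e1, e2, e3, e4⟩ := hstep i (by omega) h hinv s hS
      obtain ⟨t', s'', h'', f1, f2, f3, f4⟩ := ih (i + 1) (by omega) h' s' e4 e3
      refine ⟨_, s'', h'', .whileTrue ?_ e1 f1, ?_, f3, f4⟩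
      · rw [hS.reg x hx, hS.reg b hb, g1, g2]
        omega
      · rw [add_mul, one_mul]
        omega
  intro s hS
  obtain ⟨t, s', h', e1, e2, e3, e4⟩ := key K 0 (by omega) h s h0 hS
  refine ⟨t, s', h', e1, e2.trans ?_, e3, e4⟩
  simp only [timeBound]
  exact Nat.add_le_add_right (Nat.mul_le_mul_right _ hK) 1

end WordRAM

/-! ## The graph representation -/

namespace WordRAM

variable {w n N : ℕ} {h : HState} {Q : HState → Prop}

/-- The arrays hold the graph with the neighbour sets `Nb`: adjacency matrix, degrees, and for
each vertex the sums of `x`, `x ^ 2 / n` and `x ^ 2 % n` over its neighbours `x`. -/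
structure Rep (n : ℕ) (Nb : ℕ → Finset ℕ) (h : HState) : Prop where
  sub : ∀ u < n, Nb u ⊆ Finset.range n
  M : ∀ u < n, ∀ v < n, h.M u v = if v ∈ Nb u then 1 else 0
  deg : ∀ u < n, h.A 0 u = (Nb u).card
  sum : ∀ u < n, h.A 1 u = ∑ x ∈ Nb u, x
  hi : ∀ u < n, h.A 2 u = ∑ x ∈ Nb u, x * x / n
  lo : ∀ u < n, h.A 3 u = ∑ x ∈ Nb u, (x * x - x * x / n * n)

/-- The states agree except for the arrays that hold the graph. -/
structure SameRest (h h' : HState) : Prop where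
  reg : h'.reg = h.reg
  T : h'.T = h.T
  I : h'.I = h.I
  A : ∀ f, 4 ≤ f → h'.A f = h.A f

theorem SameRest.trans {h h' h'' : HState} (h1 : SameRest h h') (h2 : SameRest h' h'') :
    SameRest h h'' :=
  ⟨h2.reg.trans h1.reg, h2.T.trans h1.T, h2.I.trans h1.I, fun f hf => (h2.A f hf).trans (h1.A f hf)⟩

/-- Adds `v` to the neighbours of `u`. -/
def addHalf (u v : ℕ) (Nb : ℕ → Finset ℕ) : ℕ → Finset ℕ := Function.update Nb u (insert v (Nb u))

/-- Removes `v` from the neighbours of `u`. -/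
def delHalf (u v : ℕ) (Nb : ℕ → Finset ℕ) : ℕ → Finset ℕ := Function.update Nb u ((Nb u).erase v)

/-- Increases the loop counter. -/
def incr : Program := setR 0 (.r 0 + 1)

/-- Adds the vertex in register `v` to the neighbours of the vertex in register `u`. -/
def addNb (u v : ℕ) : Program :=
  setM (.r u) (.r v) 1 ;; setA 0 (.r u) (.A 0 (.r u) + 1) ;; setA 1 (.r u) (.A 1 (.r u) + .r v) ;;
  setA 2 (.r u) (.A 2 (.r u) + .r v * .r v / .n) ;;
  setA 3 (.r u) (.A 3 (.r u) + (.r v * .r v - .r v * .r v / .n * .n))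

/-- Removes the vertex in register `v` from the neighbours of the vertex in register `u`. -/
def delNb (u v : ℕ) : Program :=
  setM (.r u) (.r v) 0 ;; setA 0 (.r u) (.A 0 (.r u) - 1) ;; setA 1 (.r u) (.A 1 (.r u) - .r v) ;;
  setA 2 (.r u) (.A 2 (.r u) - .r v * .r v / .n) ;;
  setA 3 (.r u) (.A 3 (.r u) - (.r v * .r v - .r v * .r v / .n * .n))

/-- A sum of squares of neighbours can be of order n³, too large for a word. Quotients and
remainders of the squares by n are at most n, so their separate sums stay within n². -/
theorem sum_le_mul_self {S : Finset ℕ} (hS : S ⊆ Finset.range n) {f : ℕ → ℕ}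
    (hf : ∀ x < n, f x ≤ n) : ∑ x ∈ S, f x ≤ n * n := by
  have h1 : ∑ x ∈ S, f x ≤ S.card * n := by
    rw [← smul_eq_mul]
    exact Finset.sum_le_card_nsmul _ _ _ fun x hx => hf x (Finset.mem_range.1 (hS hx))
  have h2 : S.card ≤ n := by simpa using Finset.card_le_card hS
  exact h1.trans (Nat.mul_le_mul_right _ h2)

theorem sq_div_le {x : ℕ} (hx : x < n) : x * x / n ≤ n := by
  have : x * x ≤ n * n := Nat.mul_le_mul hx.le hx.le
  exact (Nat.div_le_div_right this).trans (Nat.mul_div_cancel _ (by omega)).le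

theorem sq_rest_le {x : ℕ} (hx : x < n) : x * x - x * x / n * n ≤ n := by
  have h1 := Nat.div_add_mod (x * x) n
  have h2 := Nat.mod_lt (x * x) (show n > 0 by omega)
  rw [mul_comm] at h1
  omega

theorem Rep.bounds {Nb : ℕ → Finset ℕ} (hR : Rep n Nb h) {u : ℕ} (hu : u < n) :
    h.A 0 u ≤ n ∧ h.A 1 u ≤ n * n ∧ h.A 2 u ≤ n * n ∧ h.A 3 u ≤ n * n := by
  have hs := hR.sub u hu
  refine ⟨?_, ?_, ?_, ?_⟩
  · rw [hR.deg u hu]; simpa using Finset.card_le_card hs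
  · rw [hR.sum u hu]; exact sum_le_mul_self hs fun x hx => hx.le
  · rw [hR.hi u hu]; exact sum_le_mul_self hs fun x hx => sq_div_le hx
  · rw [hR.lo u hu]; exact sum_le_mul_self hs fun x hx => sq_rest_le hx

theorem Rep.congr {Nb : ℕ → Finset ℕ} {h' : HState} (hR : Rep n Nb h) (hM : h'.M = h.M)
    (hA : ∀ f < 4, h'.A f = h.A f) : Rep n Nb h' := by
  refine ⟨hR.sub, ?_, ?_, ?_, ?_, ?_⟩
  · rw [hM]; exact hR.M
  · rw [hA 0 (by omega)]; exact hR.deg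
  · rw [hA 1 (by omega)]; exact hR.sum
  · rw [hA 2 (by omega)]; exact hR.hi
  · rw [hA 3 (by omega)]; exact hR.lo

theorem update_zero_le {b n : ℕ} (hb : b < n) :
    b * b ≤ n * n ∧ b * b / n ≤ n ∧ b * b / n * n ≤ b * b :=
  ⟨Nat.mul_le_mul hb.le hb.le, sq_div_le hb, Nat.div_mul_le_self _ _⟩

/-- The condition `b ∉ Nb a` keeps degree and sums exact; the matrix alone would tolerate a second
insertion. -/
theorem spec_addNb (hw : Fits w n) {Nb : ℕ → Finset ℕ} (hR : Rep n Nb h) {u v : ℕ} (hu : u < 20)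
    (hv : v < 20) {a b : ℕ} (hua : h.reg u = a) (hvb : h.reg v = b) (ha : a < n) (hb : b < n)
    (hab : b ∉ Nb a) :
    Spec w n N (addNb u v) h fun h' => SameRest h h' ∧ Rep n (addHalf a b Nb) h' := by
  have h0 := hw.ne_zero
  have h1 := hw.lin
  have h2 := hw.le
  have h3 := hw.pos
  have h4 : n ≤ n * n := Nat.le_mul_self n
  obtain ⟨b0, b1, b2, b3⟩ := hR.bounds ha
  obtain ⟨c1, c2, c3⟩ := update_zero_le hb
  have c4 := sq_rest_le hb
  refine spec_seq (spec_setM hw (by simpa) (by simpa) (by simpa [hua]) (by simpa [hvb])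
    (by simp; omega) ?_)
  refine spec_seq (spec_setA hw (by omega) (by simpa) (by simpa [hua])
    (by simp [hua, hu, ha]; omega) ?_)
  refine spec_seq (spec_setA hw (by omega) (by simpa) (by simpa [hua])
    (by simp [hua, hvb, hu, hv, ha]; omega) ?_)
  refine spec_seq (spec_setA hw (by omega) (by simpa) (by simpa [hua])
    (by simp [hua, hvb, hu, hv, ha]; omega) ?_)
  refine spec_setA hw (by omega) (by simpa) (by simpa [hua])
    (by simp [hua, hvb, hu, hv, ha]; omega) ?_
  refine ⟨⟨rfl, rfl, rfl, fun f hf => ?_⟩, ?_⟩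
  · simp [(show f ≠ 0 by omega), (show f ≠ 1 by omega), (show f ≠ 2 by omega),
      (show f ≠ 3 by omega)]
  · refine ⟨fun x hx => ?_, fun x hx y hy => ?_, fun x hx => ?_, fun x hx => ?_, fun x hx => ?_,
      fun x hx => ?_⟩
    · by_cases hxa : x = a
      · subst hxa
        rw [addHalf, Function.update_self]
        exact Finset.insert_subset (Finset.mem_range.2 hb) (hR.sub x hx)
      · rw [addHalf, Function.update_of_ne hxa]; exact hR.sub x hx
    · by_cases hxa : x = a
      · subst hxa
        by_cases hyb : y = b
        · simp [hua, hvb, hyb, addHalf]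
        · simp [hua, hvb, hyb, addHalf, hR.M x hx y hy]
      · simp [hua, hxa, addHalf, hR.M x hx y hy]
    · by_cases hxa : x = a
      · subst hxa
        simp [hua, addHalf, hR.deg x hx, Finset.card_insert_of_notMem hab]
      · simp [hua, hxa, addHalf, hR.deg x hx]
    · by_cases hxa : x = a
      · subst hxa
        simp [hua, hvb, addHalf, hR.sum x hx, Finset.sum_insert hab, add_comm]
      · simp [hua, hxa, addHalf, hR.sum x hx]
    · by_cases hxa : x = a
      · subst hxa
        simp [hua, hvb, addHalf, hR.hi x hx, Finset.sum_insert hab, add_comm]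
      · simp [hua, hxa, addHalf, hR.hi x hx]
    · by_cases hxa : x = a
      · subst hxa
        simp [hua, hvb, addHalf, hR.lo x hx, Finset.sum_insert hab, add_comm]
      · simp [hua, hxa, addHalf, hR.lo x hx]

theorem spec_delNb (hw : Fits w n) {Nb : ℕ → Finset ℕ} (hR : Rep n Nb h) {u v : ℕ} (hu : u < 20)
    (hv : v < 20) {a b : ℕ} (hua : h.reg u = a) (hvb : h.reg v = b) (ha : a < n) (hb : b < n)
    (hab : b ∈ Nb a) :
    Spec w n N (delNb u v) h fun h' => SameRest h h' ∧ Rep n (delHalf a b Nb) h' := by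
  have h0 := hw.ne_zero
  have h1 := hw.lin
  have h2 := hw.le
  have h3 := hw.pos
  have h4 : n ≤ n * n := Nat.le_mul_self n
  obtain ⟨c1, c2, c3⟩ := update_zero_le hb
  refine spec_seq (spec_setM hw (by simpa) (by simpa) (by simpa [hua]) (by simpa [hvb])
    (by simp) ?_)
  refine spec_seq (spec_setA hw (by omega) (by simpa) (by simpa [hua])
    (by simp [hua, hu, ha]; omega) ?_)
  refine spec_seq (spec_setA hw (by omega) (by simpa) (by simpa [hua])
    (by simp [hua, hu, hv, ha]) ?_)
  refine spec_seq (spec_setA hw (by omega) (by simpa) (by simpa [hua])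
    (by simp [hua, hvb, hu, hv, ha]; omega) ?_)
  refine spec_setA hw (by omega) (by simpa) (by simpa [hua])
    (by simp [hua, hvb, hu, hv, ha]; omega) ?_
  refine ⟨⟨rfl, rfl, rfl, fun f hf => ?_⟩, ?_⟩
  · simp [(show f ≠ 0 by omega), (show f ≠ 1 by omega), (show f ≠ 2 by omega),
      (show f ≠ 3 by omega)]
  · have hsum : ∀ f : ℕ → ℕ, ∑ x ∈ (Nb a).erase b, f x = ∑ x ∈ Nb a, f x - f b := fun f => by
      rw [← Finset.add_sum_erase _ f hab, Nat.add_sub_cancel_left]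
    refine ⟨fun x hx => ?_, fun x hx y hy => ?_, fun x hx => ?_, fun x hx => ?_, fun x hx => ?_,
      fun x hx => ?_⟩
    · by_cases hxa : x = a
      · subst hxa
        rw [delHalf, Function.update_self]
        exact (Finset.erase_subset _ _).trans (hR.sub x hx)
      · rw [delHalf, Function.update_of_ne hxa]; exact hR.sub x hx
    · by_cases hxa : x = a
      · subst hxa
        by_cases hyb : y = b
        · simp [hua, hvb, hyb, delHalf]
        · simp [hua, hvb, hyb, delHalf, hR.M x hx y hy]
      · simp [hua, hxa, delHalf, hR.M x hx y hy]
    · by_cases hxa : x = a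
      · subst hxa
        simp [hua, delHalf, hR.deg x hx, Finset.card_erase_of_mem hab]
      · simp [hua, hxa, delHalf, hR.deg x hx]
    · by_cases hxa : x = a
      · subst hxa
        simp [hua, hvb, delHalf, hR.sum x hx, hsum]
      · simp [hua, hxa, delHalf, hR.sum x hx]
    · by_cases hxa : x = a
      · subst hxa
        simp [hua, hvb, delHalf, hR.hi x hx, hsum]
      · simp [hua, hxa, delHalf, hR.hi x hx]
    · by_cases hxa : x = a
      · subst hxa
        simp [hua, hvb, delHalf, hR.lo x hx, hsum]
      · simp [hua, hxa, delHalf, hR.lo x hx]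

/-- Branching on equality. -/
def ifEqual (a b : Ex) (p q : Program) : Program := ifLess a b q (ifLess b a q p)

theorem spec_ifEqual (hw : Fits w n) {a b : Ex} {p q : Program} (ha : a.Ok (2 ^ w) n h)
    (hb : b.Ok (2 ^ w) n h) (hp : a.eval n h = b.eval n h → Spec w n N p h Q)
    (hq : a.eval n h ≠ b.eval n h → Spec w n N q h Q) : Spec w n N (ifEqual a b p q) h Q :=
  spec_ifLess hw ha hb (fun h1 => hq (by omega)) fun h1 =>
    spec_ifLess hw hb ha (fun h2 => hq (by omega)) fun h2 => hp (by omega)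

/-- Appends the vertex in register `u` to the queue if its degree is two. -/
def pushIfTwo (u : ℕ) : Program :=
  ifEqual (.A 0 (.r u)) 2 (setA 4 (.r 5) (.r u) ;; setR 5 (.r 5 + 1)) .skip

/-- The states agree except for the queue. -/
structure SameButQueue (h h' : HState) : Prop where
  reg : ∀ x, x ≠ 5 → h'.reg x = h.reg x
  M : h'.M = h.M
  T : h'.T = h.T
  I : h'.I = h.I
  A : ∀ f, f ≠ 4 → h'.A f = h.A f

theorem SameButQueue.trans {h h' h'' : HState} (h1 : SameButQueue h h')
    (h2 : SameButQueue h' h'') : SameButQueue h h'' :=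
  ⟨fun x hx => (h2.reg x hx).trans (h1.reg x hx), h2.M.trans h1.M, h2.T.trans h1.T,
    h2.I.trans h1.I, fun f hf => (h2.A f hf).trans (h1.A f hf)⟩

/-- The set `X` contains the vertices that are still to be tested; the test settles x in either
case. -/
theorem spec_pushIfTwo (hw : Fits w n) {Nb : ℕ → Finset ℕ} {u x s : ℕ} {X : Finset ℕ}
    (hu : u < 20) (hux : h.reg u = x) (hx : x < n) (hxX : x ∉ X) (hR : Rep n Nb h)
    (hq : QueueInv n s (h.reg 5) (h.A 4) Nb (insert x X)) :
    Spec w n N (pushIfTwo u) h fun h' => SameButQueue h h' ∧ Rep n Nb h' ∧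
      QueueInv n s (h'.reg 5) (h'.A 4) Nb X ∧ ∀ a < s, h'.A 4 a = h.A 4 a := by
  have h0 := hw.ne_zero
  have h1 := hw.lin
  have h3 := hw.pos
  refine spec_ifEqual hw (by simp [hu, hux, hx]) (by simp; omega) (fun h2 => ?_) fun h2 => ?_
  · have h2' : (Nb x).card = 2 := by rw [← hR.deg x hx, ← hux]; exact h2
    have hnew := hq.push hxX hx h2'
    have htail := hnew.tail_le
    refine spec_seq (spec_setA hw (by omega) (by simp) (by simp; omega) (by simpa) ?_)
    refine spec_setR hw (by omega) (by simp; omega) ?_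
    refine ⟨⟨fun y hy => by simp [hy], rfl, rfl, rfl, fun f hf => by simp [hf]⟩,
      hR.congr rfl fun f hf => by simp [(show f ≠ 4 by omega)], ?_, fun a ha => ?_⟩
    · simpa [hux] using hnew
    · have := hq.le
      simp [Function.update_of_ne (show a ≠ h.reg 5 by omega)]
  · have h2' : (Nb x).card ≠ 2 := by rw [← hR.deg x hx, ← hux]; exact h2
    exact spec_skip ⟨⟨fun _ _ => rfl, rfl, rfl, rfl, fun _ _ => rfl⟩, hR, hq.skip h2',
      fun _ _ => rfl⟩

theorem spec_incr (hw : Fits w n) (hr : h.reg 0 ≤ 2 * n) (hQ : Q (h.setR 0 (h.reg 0 + 1))) :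
    Spec w n N incr h Q := by
  have h0 := hw.ne_zero
  have h1 := hw.lin
  have h2 := hw.le
  have h3 := hw.pos
  have h4 : n ≤ n * n := Nat.le_mul_self n
  exact spec_setR hw (by omega) (by simp; omega) hQ

/-! ### Reading the edges -/

/-- The neighbour sets of the graph with the edges `eu t, ev t`, `t < i`. -/
def edgeNb (eu ev : ℕ → ℕ) : ℕ → ℕ → Finset ℕ
  | 0 => fun _ => ∅
  | i + 1 => addHalf (ev i) (eu i) (addHalf (eu i) (ev i) (edgeNb eu ev i))

theorem mem_addHalf {a b x y : ℕ} {Nb : ℕ → Finset ℕ} :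
    y ∈ addHalf a b Nb x ↔ (x = a ∧ y = b) ∨ y ∈ Nb x := by
  by_cases hx : x = a
  · subst hx; simp [addHalf]
  · simp [addHalf, hx]

theorem mem_edgeNb {eu ev : ℕ → ℕ} {i x y : ℕ} : y ∈ edgeNb eu ev i x ↔
    ∃ t < i, (x = eu t ∧ y = ev t) ∨ (x = ev t ∧ y = eu t) := by
  induction i with
  | zero => simp [edgeNb]
  | succ i ih =>
    rw [edgeNb, mem_addHalf, mem_addHalf, ih]
    constructor
    · rintro (h | h | ⟨t, ht, h⟩)
      · exact ⟨i, by omega, Or.inr h⟩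
      · exact ⟨i, by omega, Or.inl h⟩
      · exact ⟨t, by omega, h⟩
    · rintro ⟨t, ht, h⟩
      rcases Nat.lt_succ_iff_lt_or_eq.1 ht with ht | rfl
      · exact Or.inr (Or.inr ⟨t, ht, h⟩)
      · tauto

/-- `I` contains the list of the `m` edges `eu t, ev t` of a graph with `n` vertices. -/
structure IsInput (n m : ℕ) (eu ev I : ℕ → ℕ) : Prop where
  length : I 1 = m
  le : m ≤ 2 * n
  left : ∀ t < m, I (2 + t + t) = eu t
  right : ∀ t < m, I (3 + t + t) = ev t
  left_lt : ∀ t < m, eu t < n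
  right_lt : ∀ t < m, ev t < n
  ne : ∀ t < m, eu t ≠ ev t
  nodup : ∀ t < m, ∀ t' < t, ¬ (eu t = eu t' ∧ ev t = ev t') ∧ ¬ (eu t = ev t' ∧ ev t = eu t')

def readEdges : Program :=
  setR 1 (.I 1) ;; setR 0 0 ;; .whileLt 0 1
    (setR 2 (.I (2 + .r 0 + .r 0)) ;; setR 3 (.I (3 + .r 0 + .r 0)) ;; addNb 2 3 ;; addNb 3 2 ;;
      incr)

/-- Zero arrays represent the graph without edges, so the quadratic matrix is never initialised.
Since no edge is listed twice, every insertion is new. -/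
theorem spec_readEdges (hw : Fits w n) (hN : 2 * n ≤ N) {m : ℕ} {eu ev : ℕ → ℕ}
    (hI : IsInput n m eu ev h.I) (hA : ∀ f < 16, ∀ i < n, h.A f i = 0)
    (hM : ∀ i < n, ∀ j < n, h.M i j = 0) :
    Spec w n N readEdges h fun h' => h'.I = h.I ∧ Rep n (edgeNb eu ev m) h' := by
  have h0 := hw.ne_zero
  have h1 := hw.lin
  have h2 := hw.le
  have h3 := hw.pos
  have h4 : n ≤ n * n := Nat.le_mul_self n
  have hm := hI.le
  refine spec_seq (spec_setR hw (by omega) (by simp; omega) ?_)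
  refine spec_seq (spec_setR hw (by omega) (by simp) ?_)
  refine spec_while (K := m) (by omega) (by omega)
    (fun i h' => h'.reg 0 = i ∧ h'.reg 1 = m ∧ h'.I = h.I ∧ Rep n (edgeNb eu ev i) h')
    (fun i h' hi => ⟨hi.1, hi.2.1⟩) (by omega) ?_ ?_ (fun h' hi => hi.2.2)
  · refine ⟨by simp, by simp [hI.length], rfl, ?_⟩
    refine ⟨fun u _ => by simp [edgeNb], fun u hu v hv => ?_, fun u hu => ?_, fun u hu => ?_,
      fun u hu => ?_, fun u hu => ?_⟩
    · simp [edgeNb, hM u hu v hv]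
    · simp [edgeNb, hA 0 (by omega) u hu]
    · simp [edgeNb, hA 1 (by omega) u hu]
    · simp [edgeNb, hA 2 (by omega) u hu]
    · simp [edgeNb, hA 3 (by omega) u hu]
  · rintro i hi h' ⟨g1, g2, g3, g4⟩
    refine spec_seq (spec_setR hw (by omega) (by simp [g1]; omega) ?_)
    refine spec_seq (spec_setR hw (by omega) (by simp [g1]; omega) ?_)
    have e1 := hI.left_lt i hi
    have e2 := hI.right_lt i hi
    have e3 := hI.ne i hi
    refine spec_seq (Spec.mono (spec_addNb hw (u := 2) (v := 3) (Nb := edgeNb eu ev i) (a := eu i) (b := ev i)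
      ?_ (by omega) (by omega) ?_ ?_ e1 e2 ?_) ?_)
    · exact g4.congr rfl fun _ _ => rfl
    · simp [g1, g3, hI.left i hi]
    · simp [g1, g3, hI.right i hi]
    · rw [mem_edgeNb]
      rintro ⟨t, ht, h5 | h5⟩
      · exact (hI.nodup i hi t ht).1 h5
      · exact (hI.nodup i hi t ht).2 h5
    rintro h1' ⟨s1, r1⟩
    refine spec_seq (Spec.mono (spec_addNb hw (u := 3) (v := 2) (a := ev i) (b := eu i) r1 (by omega) (by omega)
      ?_ ?_ e2 e1 ?_) ?_)
    · simp [s1.reg, g1, g3, hI.right i hi]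
    · simp [s1.reg, g1, g3, hI.left i hi]
    · rw [mem_addHalf, mem_edgeNb]
      rintro (h5 | ⟨t, ht, h5 | h5⟩)
      · exact e3 h5.2
      · exact (hI.nodup i hi t ht).2 ⟨h5.2, h5.1⟩
      · exact (hI.nodup i hi t ht).1 ⟨h5.2, h5.1⟩
    rintro h2' ⟨s2, r2⟩
    refine spec_incr hw (by simp [s2.reg, s1.reg, g1]; omega) ⟨?_, ?_, ?_, ?_⟩
    · simp [s2.reg, s1.reg, g1]
    · simp [s2.reg, s1.reg, g2]
    · simp [s2.I, s1.I, g3]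
    · exact r2.congr rfl fun _ _ => rfl

/-- Tabulates square roots. -/
def fillRoots : Program :=
  setR 1 .n ;; setR 0 0 ;; .whileLt 0 1 (setT (.r 0 * .r 0) (.r 0) ;; incr)

theorem spec_fillRoots (hw : Fits w n) (hN : 2 * n ≤ N) {Nb : ℕ → Finset ℕ} (hR : Rep n Nb h) :
    Spec w n N fillRoots h fun h' => h'.I = h.I ∧ Rep n Nb h' ∧ ∀ d < n, h'.T (d * d) = d := by
  have h0 := hw.ne_zero
  have h1 := hw.lin
  have h2 := hw.le
  have h3 := hw.pos
  have h4 : n ≤ n * n := Nat.le_mul_self n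
  refine spec_seq (spec_setR hw (by omega) (by simp) ?_)
  refine spec_seq (spec_setR hw (by omega) (by simp) ?_)
  refine spec_while (K := n) (by omega) (by omega)
    (fun i h' => h'.reg 0 = i ∧ h'.reg 1 = n ∧ h'.I = h.I ∧ Rep n Nb h' ∧
      ∀ d < i, h'.T (d * d) = d)
    (fun i h' hi => ⟨hi.1, hi.2.1⟩) (by omega) ?_ ?_ (fun h' hi => hi.2.2)
  · exact ⟨by simp, by simp, rfl, hR.congr rfl fun _ _ => rfl, by simp⟩
  · rintro i hi h' ⟨g1, g2, g3, g4, g5⟩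
    have hii : i * i < n * n := Nat.mul_self_lt_mul_self hi
    refine spec_seq (spec_setT hw (by simp [g1]; omega) (by simpa [g1]) (by simp) ?_)
    refine spec_incr hw (by simp [g1]; omega) ⟨by simp [g1], by simp [g2], by simp [g3],
      g4.congr rfl fun _ _ => rfl, fun d hd => ?_⟩
    simp only [HState.setR_T, HState.setT_T, Ex.eval_mul, Ex.eval_r, g1]
    by_cases hdi : d = i
    · simp [hdi]
    · rw [if_neg (fun hc => hdi (Nat.mul_self_inj.1 hc))]
      exact g5 d (by omega)

/-- Fills the queue with the vertices of degree two. -/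
def fillQueue : Program :=
  setR 5 0 ;; setR 1 .n ;; setR 0 0 ;; .whileLt 0 1 (pushIfTwo 0 ;; incr)

theorem spec_fillQueue (hw : Fits w n) (hN : 2 * n ≤ N) {Nb : ℕ → Finset ℕ} (hR : Rep n Nb h) :
    Spec w n N fillQueue h fun h' => h'.I = h.I ∧ h'.T = h.T ∧ Rep n Nb h' ∧
      QueueInv n 0 (h'.reg 5) (h'.A 4) Nb ∅ := by
  have h0 := hw.ne_zero
  have h1 := hw.lin
  have h2 := hw.le
  have h3 := hw.pos
  have h4 : n ≤ n * n := Nat.le_mul_self n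
  refine spec_seq (spec_setR hw (by omega) (by simp) ?_)
  refine spec_seq (spec_setR hw (by omega) (by simp) ?_)
  refine spec_seq (spec_setR hw (by omega) (by simp) ?_)
  -- The exceptional set `Finset.Ico i n` consists of the vertices not tested so far.
  refine spec_while (K := n) (by omega) (by omega)
    (fun i h' => h'.reg 0 = i ∧ h'.reg 1 = n ∧ h'.I = h.I ∧ h'.T = h.T ∧ Rep n Nb h' ∧
      QueueInv n 0 (h'.reg 5) (h'.A 4) Nb (Finset.Ico i n))
    (fun i h' hi => ⟨hi.1, hi.2.1⟩) (by omega) ?_ ?_ (fun h' hi => by simpa using hi.2.2)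
  · refine ⟨by simp, by simp, rfl, rfl, hR.congr rfl fun _ _ => rfl, ?_⟩
    refine ⟨le_rfl, ?_, ?_, ?_, ?_, ?_⟩ <;> simp
    exact fun _ x hx _ => hx
  · rintro i hi h' ⟨g1, g2, g3, g4, g5, g6⟩
    rw [← Finset.insert_Ico_add_one_left_eq_Ico hi] at g6
    refine spec_seq (Spec.mono (spec_pushIfTwo hw (u := 0) (by omega) g1 hi (by simp) g5 g6) ?_)
    rintro h2' ⟨s1, r1, q1, -⟩
    refine spec_incr hw (by rw [s1.reg 0 (by omega), g1]; omega) ⟨?_, ?_, ?_, ?_, ?_, ?_⟩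
    · simp [s1.reg 0 (by omega), g1]
    · simp [s1.reg 1 (by omega), g2]
    · simp [s1.I, g3]
    · simp [s1.T, g4]
    · exact r1.congr rfl fun _ _ => rfl
    · simpa using q1

end WordRAM

/-! ### Removing vertices of degree two -/

theorem IsStage.mem_symm {n s : ℕ} {Q : ℕ → ℕ} {Nb : ℕ → Finset ℕ} (h : IsStage n s Q Nb) {x y : ℕ}
    (hx : x < n) (hxa : ∀ a < s, Q a ≠ x) (hy : y ∈ Nb x) :
    x ∈ Nb y ∧ y < n ∧ y ≠ x ∧ ∀ a < s, Q a ≠ y := by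
  obtain ⟨o, ho, hal⟩ := h
  obtain ⟨i, hi, rfl⟩ := (hal x).2 ⟨hx, hxa⟩
  obtain ⟨j, hj, rfl⟩ := ho.closed i hi y hy
  obtain ⟨h1, h2⟩ := (hal (o j)).1 ⟨j, hj, rfl⟩
  refine ⟨ho.symm i hi j hj hy, h1, fun hc => ?_, h2⟩
  rw [hc] at hy
  exact ho.irrefl i hi hy

namespace WordRAM

variable {w n N : ℕ} {h : HState} {Q : HState → Prop}

/-- Puts the two neighbours of the vertex in register 3 into the registers 2 and 4. -/
def findPair : Program :=
  setR 6 (.A 1 (.r 3)) ;; setR 7 (.T (2 * (.A 2 (.r 3) * .n + .A 3 (.r 3)) - .r 6 * .r 6)) ;;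
  setR 2 ((.r 6 + .r 7) / 2) ;; setR 4 (.r 6 - .r 2)

/-- For neighbours a < b one has 2 (a² + b²) - (a + b)² = (b - a)². The table gives b - a, and sum
and difference give a and b, in constant time and without adjacency lists. -/
theorem spec_findPair (hw : Fits w n) {Nb : ℕ → Finset ℕ} (hR : Rep n Nb h)
    (hT : ∀ d < n, h.T (d * d) = d) {v : ℕ} (hv : h.reg 3 = v) (hvn : v < n)
    (hc : (Nb v).card = 2) :
    Spec w n N findPair h fun h' => (∃ x y, x ≠ y ∧ Nb v = {x, y} ∧ h'.reg 2 = x ∧ h'.reg 4 = y) ∧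
      (∀ i, i ≠ 2 → i ≠ 4 → i ≠ 6 → i ≠ 7 → h'.reg i = h.reg i) ∧ h'.A = h.A ∧ h'.M = h.M ∧
      h'.T = h.T ∧ h'.I = h.I := by
  have h0 := hw.ne_zero
  have h1 := hw.lin
  have h2 := hw.le
  have h3 := hw.pos
  obtain ⟨a, b, hab, hNb⟩ : ∃ a b, a < b ∧ Nb v = {a, b} := by
    obtain ⟨a, b, hab, hNb⟩ := Finset.card_eq_two.1 hc
    rcases lt_or_gt_of_ne hab with hlt | hlt
    · exact ⟨a, b, hlt, hNb⟩
    · exact ⟨b, a, hlt, by rw [hNb, Finset.pair_comm]⟩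
  have hbn : b < n := Finset.mem_range.1 (hR.sub v hvn (by rw [hNb]; simp))
  obtain ⟨e, rfl⟩ := Nat.exists_eq_add_of_le hab.le
  have hs : h.A 1 v = a + (a + e) := by rw [hR.sum v hvn, hNb, Finset.sum_pair hab.ne]
  have hsq : h.A 2 v * n + h.A 3 v = a * a + (a + e) * (a + e) := by
    rw [hR.hi v hvn, hR.lo v hvn, hNb, Finset.sum_pair hab.ne, Finset.sum_pair hab.ne, add_mul]
    have := Nat.div_mul_le_self (a * a) n
    have := Nat.div_mul_le_self ((a + e) * (a + e)) n
    omega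
  have q1 : a * a ≤ n * n := Nat.mul_le_mul (by omega) (by omega)
  have q2 : (a + e) * (a + e) ≤ n * n := Nat.mul_le_mul (by omega) (by omega)
  have q3 : e * e < n * n := Nat.mul_self_lt_mul_self (by omega)
  have q4 : 2 * (a * a + (a + e) * (a + e)) = (a + (a + e)) * (a + (a + e)) + e * e := by ring
  have q5 : 2 * (a * a + (a + e) * (a + e)) - (a + (a + e)) * (a + (a + e)) = e * e := by omega
  refine spec_seq (spec_setR hw (by omega) (by simp [hv, hvn]) ?_)
  refine spec_seq (spec_setR hw (by omega) ?_ ?_)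
  · simp only [Ex.ok_T, Ex.ok_sub, Ex.ok_mul, Ex.ok_ofNat, Ex.ok_add, Ex.ok_A, Ex.ok_r, Ex.ok_n,
      Ex.eval_mul, Ex.eval_A, Ex.eval_r, Ex.eval_n, Ex.eval_add, Ex.eval_ofNat, Ex.eval_sub,
      HState.setR_A, HState.setR_reg, hv, hs, if_true, if_neg (show ¬ 3 = 6 by omega), hsq, q5]
    simp only [true_and]
    omega
  refine spec_seq (spec_setR hw (by omega) ?_ ?_)
  · simp only [Ex.ok_div, Ex.ok_ofNat, Ex.ok_add, Ex.ok_r,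
      Ex.eval_mul, Ex.eval_A, Ex.eval_r, Ex.eval_n, Ex.eval_add, Ex.eval_ofNat, Ex.eval_sub,
      HState.setR_A, HState.setR_reg, hv, hs, if_true, if_neg (show ¬ 3 = 6 by omega), hsq, q5,
      Ex.eval_T, HState.setR_T, hT e (by omega), if_neg (show ¬ 6 = 7 by omega)]
    omega
  refine spec_setR hw (by omega) (by simp) ?_
  refine ⟨⟨a + e, a, by omega, by rw [hNb, Finset.pair_comm], ?_, ?_⟩, fun i i1 i2 i3 i4 => ?_, rfl,
    rfl, rfl, rfl⟩
  · simp only [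
      Ex.eval_mul, Ex.eval_A, Ex.eval_r, Ex.eval_n, Ex.eval_add, Ex.eval_ofNat, Ex.eval_sub,
      HState.setR_A, HState.setR_reg, hv, hs, if_true, if_neg (show ¬ 3 = 6 by omega), hsq, q5,
      Ex.eval_T, HState.setR_T, hT e (by omega), if_neg (show ¬ 6 = 7 by omega), Ex.eval_div,
      if_neg (show ¬ 2 = 4 by omega)]
    omega
  · simp only [
      Ex.eval_mul, Ex.eval_A, Ex.eval_r, Ex.eval_n, Ex.eval_add, Ex.eval_ofNat, Ex.eval_sub,
      HState.setR_A, HState.setR_reg, hv, hs, if_true, if_neg (show ¬ 3 = 6 by omega), hsq, q5,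
      Ex.eval_T, HState.setR_T, hT e (by omega), if_neg (show ¬ 6 = 7 by omega), Ex.eval_div,
      if_neg (show ¬ 6 = 2 by omega)]
    omega
  · simp [i1, i2, i3, i4]

/-- Removes the vertex in register 3 with the neighbours in the registers 2 and 4. -/
def suppressPair : Program :=
  delNb 2 3 ;; delNb 4 3 ;;
  ifLess (.M (.r 2) (.r 4)) 1 (addNb 2 4 ;; addNb 4 2) (pushIfTwo 2 ;; pushIfTwo 4)

theorem suppress_eq_of_notMem {u v x : ℕ} {Nb : ℕ → Finset ℕ} (hux : u ≠ x) :
    addHalf x u (addHalf u x (delHalf x v (delHalf u v Nb))) = suppress v u x Nb := by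
  funext y
  by_cases h1 : y = u
  · subst h1
    simp [suppress, addHalf, delHalf, hux]
  · by_cases h2 : y = x
    · subst h2
      simp [suppress, addHalf, delHalf, h1]
    · simp [suppress, addHalf, delHalf, h1, h2]

theorem suppress_eq_of_mem {u v x : ℕ} {Nb : ℕ → Finset ℕ} (hux : u ≠ x) (hu : u ≠ v) (hx : x ≠ v)
    (h1 : x ∈ Nb u) (h2 : u ∈ Nb x) :
    delHalf x v (delHalf u v Nb) = suppress v u x Nb := by
  funext y
  by_cases g1 : y = u
  · subst g1
    simp [suppress, delHalf, hux, hx, h1]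
  · by_cases g2 : y = x
    · subst g2
      simp [suppress, delHalf, g1, hu, h2]
    · simp [suppress, delHalf, g1, g2]

/-- If u and x are not adjacent, the new edge restores their degrees and nothing has to be queued.
If they are, both lose a neighbour and are tested for degree two. -/
theorem spec_suppressPair (hw : Fits w n) {Nb : ℕ → Finset ℕ} (hR : Rep n Nb h) {u v x s : ℕ}
    (hu : h.reg 2 = u) (hv : h.reg 3 = v) (hx : h.reg 4 = x) (hq : QueueInv n s (h.reg 5) (h.A 4) Nb ∅)
    (hst : IsStage n s (h.A 4) Nb) (hs : s + 3 ≤ n) (hsv : h.A 4 s = v) (hnb : Nb v = {u, x})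
    (hux : u ≠ x) :
    Spec w n N suppressPair h fun h' => Rep n (suppress v u x Nb) h' ∧
      QueueInv n (s + 1) (h'.reg 5) (h'.A 4) (suppress v u x Nb) ∅ ∧
      (∀ a < s + 1, h'.A 4 a = h.A 4 a) ∧ (∀ i, i ≠ 5 → h'.reg i = h.reg i) ∧ h'.T = h.T ∧
      h'.I = h.I ∧ ∀ f, 5 ≤ f → h'.A f = h.A f := by
  have h0 := hw.ne_zero
  have hlt := hq.lt_tail hst hs
  have hvn : v < n := hsv ▸ hq.lt s hlt
  have hva : ∀ a < s, h.A 4 a ≠ v := fun a ha => hsv ▸ hq.ne a s ha hlt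
  obtain ⟨u1, u2, u3, u4⟩ := hst.mem_symm hvn hva (y := u) (by rw [hnb]; simp)
  obtain ⟨x1, x2, x3, x4⟩ := hst.mem_symm hvn hva (y := x) (by rw [hnb]; simp)
  have hq' := hq.suppress hst hs (by rw [hsv]; exact hnb) hux
  rw [hsv] at hq'
  refine spec_seq (Spec.mono (spec_delNb hw hR (u := 2) (v := 3) (by omega) (by omega) hu hv u2 hvn
    u1) ?_)
  rintro ha ⟨sa, ra⟩
  refine spec_seq (Spec.mono (spec_delNb hw ra (u := 4) (v := 3) (a := x) (b := v) (by omega)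
    (by omega) ?_ ?_ x2 hvn ?_) ?_)
  · rw [sa.reg, hx]
  · rw [sa.reg, hv]
  · simpa [delHalf, hux.symm] using x1
  rintro hb ⟨sb, rb⟩
  have hbr := (sa.trans sb).reg
  have hbA := (sa.trans sb).A
  have hM := rb.M u u2 x x2
  have hmem : x ∈ delHalf x v (delHalf u v Nb) u ↔ x ∈ Nb u := by simp [delHalf, hux, x3]
  refine spec_ifLess hw (by simp [hbr, hu, hx, u2, x2]) (by simp [h0]) (fun hc => ?_) fun hc => ?_
  · have hxu : x ∉ Nb u := fun hc' => by
      rw [if_pos (hmem.2 hc')] at hM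
      simp [hbr, hu, hx, hM] at hc
    have hux' : u ∉ Nb x := fun hc' => hxu (hst.mem_symm x2 x4 hc').1
    refine spec_seq (Spec.mono (spec_addNb hw rb (u := 2) (v := 4) (a := u) (b := x) (by omega)
      (by omega) ?_ ?_ u2 x2 ?_) ?_)
    · rw [hbr, hu]
    · rw [hbr, hx]
    · rwa [hmem]
    rintro hc' ⟨sc, rc⟩
    refine Spec.mono (spec_addNb hw rc (u := 4) (v := 2) (a := x) (b := u) (by omega)
      (by omega) ?_ ?_ x2 u2 ?_) ?_
    · rw [sc.reg, hbr, hx]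
    · rw [sc.reg, hbr, hu]
    · simp [addHalf, delHalf, hux.symm, hux']
    rintro hd ⟨sd, rd⟩
    have sall := (sa.trans sb).trans (sc.trans sd)
    rw [suppress_eq_of_notMem hux] at rd
    rw [if_neg hxu] at hq'
    refine ⟨rd, ?_, fun a _ => by rw [sall.A 4 le_rfl], fun i _ => by rw [sall.reg], sall.T, sall.I,
      fun f hf => sall.A f (by omega)⟩
    rw [sall.reg, sall.A 4 le_rfl]
    exact hq'
  · have hxu : x ∈ Nb u := by
      by_contra hc'
      rw [if_neg (fun hh => hc' (hmem.1 hh))] at hM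
      simp [hbr, hu, hx, hM] at hc
    have hux' : u ∈ Nb x := (hst.mem_symm u2 u4 hxu).1
    rw [suppress_eq_of_mem hux u3 x3 hxu hux'] at rb
    rw [if_pos hxu] at hq'
    refine spec_seq (Spec.mono (spec_pushIfTwo hw (u := 2) (x := u) (s := s + 1) (X := {x}) (by omega)
      ?_ u2 ?_ rb ?_) ?_)
    · rw [hbr, hu]
    · simpa using hux
    · rw [hbr, hbA 4 le_rfl]; exact hq'
    rintro hc' ⟨sc, rc, qc, kc⟩
    refine Spec.mono (spec_pushIfTwo hw (u := 4) (x := x) (s := s + 1) (X := ∅) (by omega)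
      ?_ x2 (by simp) rc qc) ?_
    · rw [sc.reg 4 (by omega), hbr, hx]
    rintro hd ⟨sd, rd, qd, kd⟩
    have scd := sc.trans sd
    refine ⟨rd, qd, fun a ha => ?_, fun i hi => ?_, ?_, ?_, fun f hf => ?_⟩
    · rw [kd a ha, kc a ha, hbA 4 le_rfl]
    · rw [scd.reg i hi, hbr]
    · rw [scd.T, sb.T, sa.T]
    · rw [scd.I, sb.I, sa.I]
    · rw [scd.A f (by omega), hbA f (by omega)]

def removeAll : Program :=
  setR 1 (.n - 2) ;; setR 0 0 ;; .whileLt 0 1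
    (setR 3 (.A 4 (.r 0)) ;; findPair ;; setA 5 (.r 0) (.r 2) ;; setA 6 (.r 0) (.r 4) ;;
      suppressPair ;; incr)

theorem spec_removeAll (hw : Fits w n) (hN : 2 * n ≤ N) (hn : 3 ≤ n) {Nb : ℕ → Finset ℕ}
    (hR : Rep n Nb h) (hT : ∀ d < n, h.T (d * d) = d) (hst : IsStage n 0 (h.A 4) Nb)
    (hq : QueueInv n 0 (h.reg 5) (h.A 4) Nb ∅) :
    Spec w n N removeAll h fun h' => h'.I = h.I ∧
      ∃ Nbs : ℕ → ℕ → Finset ℕ, Nbs 0 = Nb ∧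
        RemovalChain n Nbs (h'.A 4) (h'.A 5) (h'.A 6) (n - 2) ∧
        IsStage n 0 (h'.A 4) (Nbs 0) ∧ ∀ a < n - 2, h'.A 5 a < n ∧ h'.A 6 a < n := by
  have h0 := hw.ne_zero
  have h1 := hw.lin
  refine spec_seq (spec_setR hw (by omega) (by simp; omega) ?_)
  refine spec_seq (spec_setR hw (by omega) (by simp) ?_)
  refine spec_while (K := n - 2) (by omega) (by omega)
    (fun s h' => h'.reg 0 = s ∧ h'.reg 1 = n - 2 ∧ h'.I = h.I ∧ (∀ d < n, h'.T (d * d) = d) ∧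
      (∀ a < s, h'.A 5 a < n ∧ h'.A 6 a < n) ∧
      ∃ Nbs : ℕ → ℕ → Finset ℕ, Nbs 0 = Nb ∧
        RemovalChain n Nbs (h'.A 4) (h'.A 5) (h'.A 6) s ∧ IsStage n s (h'.A 4) (Nbs s) ∧
        QueueInv n s (h'.reg 5) (h'.A 4) (Nbs s) ∅ ∧ Rep n (Nbs s) h')
    (fun i h' hi => ⟨hi.1, hi.2.1⟩) (by omega) ?_ ?_ ?_
  · refine ⟨by simp, by simp, rfl, hT, by simp, fun _ => Nb, rfl, ⟨by simp, by simp, by simp⟩, hst,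
      hq, hR.congr rfl fun _ _ => rfl⟩
  · rintro s hs h' ⟨g1, g2, g3, g4, g5, Nbs, g6, g7, g8, g9, g10⟩
    have hs3 : s + 3 ≤ n := by omega
    have hlt := g9.lt_tail g8 hs3
    have hvn := g9.lt s hlt
    have hcard := g9.card hs3 s le_rfl hlt
    refine spec_seq (spec_setR hw (by omega) (by simp [g1]; omega) ?_)
    refine spec_seq (Spec.mono (spec_findPair hw (Nb := Nbs s) (v := h'.A 4 s) ?_ ?_ ?_ hvn hcard) ?_)
    · exact g10.congr rfl fun _ _ => rfl
    · exact g4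
    · simp [g1]
    rintro ha ⟨⟨x, y, hxy, hnb, hx, hy⟩, kr, kA, kM, kT, kI⟩
    have hxn : x < n := Finset.mem_range.1 (g10.sub _ hvn (by rw [hnb]; simp))
    have hyn : y < n := Finset.mem_range.1 (g10.sub _ hvn (by rw [hnb]; simp))
    have k0 : ha.reg 0 = s := by rw [kr 0 (by omega) (by omega) (by omega) (by omega)]; simp [g1]
    have k1 : ha.reg 1 = n - 2 := by
      rw [kr 1 (by omega) (by omega) (by omega) (by omega)]; simp [g2]
    have k3 : ha.reg 3 = h'.A 4 s := by
      rw [kr 3 (by omega) (by omega) (by omega) (by omega)]; simp [g1]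
    have k5 : ha.reg 5 = h'.reg 5 := by
      rw [kr 5 (by omega) (by omega) (by omega) (by omega)]; simp
    simp only [HState.setR_A] at kA
    refine spec_seq (spec_setA hw (by omega) (by simp) (by simp [k0]; omega) (by simp) ?_)
    refine spec_seq (spec_setA hw (by omega) (by simp) (by simp [k0]; omega) (by simp) ?_)
    simp only [Ex.eval_r, HState.setA_reg, k0, hx, hy]
    refine spec_seq (Spec.mono (spec_suppressPair hw (Nb := Nbs s) (u := x) (v := h'.A 4 s) (x := y)
      (s := s) ?_ ?_ ?_ ?_ ?_ ?_ hs3 ?_ hnb hxy) ?_)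
    · refine g10.congr (by simp [kM]) fun f hf => ?_
      simp [kA, (show f ≠ 5 by omega), (show f ≠ 6 by omega)]
    · simp [hx]
    · simp [k3]
    · simp [hy]
    · simpa [kA, k5] using g9
    · simpa [kA] using g8
    · simp [kA]
    rintro hb ⟨r1, r2, r3, r4, r5, r6, r7⟩
    have hb4 : ∀ a < s + 1, hb.A 4 a = h'.A 4 a := fun a ha' => by
      rw [r3 a ha']; simp [kA]
    have hb5 : hb.A 5 = Function.update (h'.A 5) s x := by
      rw [r7 5 (by omega)]; simp [kA]
    have hb6 : hb.A 6 = Function.update (h'.A 6) s y := by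
      rw [r7 6 (by omega)]; simp [kA]
    have hb0 : hb.reg 0 = s := by rw [r4 0 (by omega)]; simp [k0]
    refine spec_incr hw (by omega) ⟨?_, ?_, ?_, ?_, ?_, ?_⟩
    · simp [hb0]
    · simp [r4 1, k1]
    · simp [r6, kI, g3]
    · intro d hd
      simp [r5, kT, g4 d hd]
    · intro a ha'
      simp only [HState.setR_A, hb5, hb6]
      by_cases has : a = s
      · simp [has, hxn, hyn]
      · simpa [has] using g5 a (by omega)
    -- The history of neighbour sets exists only in the proof; the memory holds its last member.
    · refine ⟨Function.update Nbs (s + 1) (suppress (h'.A 4 s) x y (Nbs s)), ?_, ?_, ?_, ?_, ?_⟩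
      · simp [g6]
      · simp only [HState.setR_A]
        refine ⟨fun a ha' => ?_, fun a b hab hb' => ?_, fun a ha' => ?_⟩
        · rw [hb4 a ha']
          exact g9.lt a (by omega)
        · rw [hb4 a (by omega), hb4 b hb']
          exact g9.ne a b hab (by omega)
        · rw [hb4 a ha', hb5, hb6]
          by_cases has : a = s
          · subst has
            simp [hnb, hxy]
          · have := g7.nb a (by omega)
            simpa [has, (show a ≠ s + 1 by omega)] using this
      · simp only [HState.setR_A, Function.update_self]
        exact (g8.succ hs3 hvn (fun a ha' => g9.ne a s ha' hlt) hnb hxy).congr hb4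
      · simpa using r2
      · simp only [Function.update_self]
        exact r1.congr rfl fun _ _ => rfl
  · rintro h' ⟨g1, g2, g3, g4, g5, Nbs, g6, g7, g8, g9, g10⟩
    refine ⟨g3, Nbs, g6, g7, ?_, g5⟩
    rw [g6]
    exact hst.congr (by simp)

end WordRAM

/-! ### Recovering the Hamiltonian cycle -/

namespace WordRAM

variable {w n N : ℕ} {h : HState} {Q : HState → Prop}

/-- Reinserts the removed vertices; field 7 is the successor on the current cycle. -/
def insertAll : Program :=
  setR 9 (.n - 3) ;; setA 7 (.A 5 (.r 9)) (.A 6 (.r 9)) ;; setA 7 (.A 6 (.r 9)) (.A 5 (.r 9)) ;;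
  setR 1 (.n - 2) ;; setR 0 0 ;; .whileLt 0 1
    (setR 9 (.n - 3 - .r 0) ;; setR 3 (.A 4 (.r 9)) ;; setR 2 (.A 5 (.r 9)) ;;
      setR 4 (.A 6 (.r 9)) ;;
      ifEqual (.A 7 (.r 2)) (.r 4) (setA 7 (.r 2) (.r 3) ;; setA 7 (.r 3) (.r 4))
        (setA 7 (.r 4) (.r 3) ;; setA 7 (.r 3) (.r 2)) ;; incr)

theorem spec_insertAll (hw : Fits w n) (hN : 2 * n ≤ N) (hn : 3 ≤ n) {Nbs : ℕ → ℕ → Finset ℕ}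
    (hc : RemovalChain n Nbs (h.A 4) (h.A 5) (h.A 6) (n - 2)) (hst : IsStage n 0 (h.A 4) (Nbs 0))
    (hlt : ∀ a < n - 2, h.A 5 a < n ∧ h.A 6 a < n) :
    Spec w n N insertAll h fun h' => h'.I = h.I ∧ ∃ o : ℕ → ℕ, CycOrder (NbRel (Nbs 0)) n o ∧
      o 0 = 0 ∧ (∀ i < n, o i < n) ∧ ∀ i, i + 1 < n → h'.A 7 (o i) = o (i + 1) := by
  have h0 := hw.ne_zero
  have h1 := hw.lin
  obtain ⟨l5, l6⟩ := hlt (n - 3) (by omega)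
  obtain ⟨-, hne, -⟩ := hc.nb (n - 3) (by omega)
  refine spec_seq (spec_setR hw (by omega) (by simp; omega) ?_)
  refine spec_seq (spec_setA hw (by omega) (by simp; omega) (by simpa) (by simp; omega) ?_)
  refine spec_seq (spec_setA hw (by omega) (by simp; omega) (by simpa) (by simp; omega) ?_)
  refine spec_seq (spec_setR hw (by omega) (by simp; omega) ?_)
  refine spec_seq (spec_setR hw (by omega) (by simp) ?_)
  -- The two vertices that remain are the neighbours of the vertex removed last, at time n - 3; they
  -- start as a cycle of length two.
  let nx := Function.update (Function.update (h.A 7) (h.A 5 (n - 3)) (h.A 6 (n - 3)))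
    (h.A 6 (n - 3)) (h.A 5 (n - 3))
  refine spec_while (K := n - 2) (by omega) (by omega)
    (fun i h' => h'.reg 0 = i ∧ h'.reg 1 = n - 2 ∧ h'.I = h.I ∧
      h'.A 4 = h.A 4 ∧ h'.A 5 = h.A 5 ∧ h'.A 6 = h.A 6 ∧
      h'.A 7 = chainNext nx (h.A 4) (h.A 5) (h.A 6) (n - 2) i)
    (fun i h' hi => ⟨hi.1, hi.2.1⟩) (by omega) ?_ ?_ ?_
  · refine ⟨by simp, by simp, rfl, by simp, by simp, by simp, ?_⟩
    simp [chainNext, nx]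
  · rintro i hi h' ⟨g1, g2, g3, g4, g5, g6, g7⟩
    have hv := hc.lt (n - 3 - i) (by omega)
    obtain ⟨hu, hx⟩ := hlt (n - 3 - i) (by omega)
    refine spec_seq (spec_setR hw (by omega) (by simp; omega) ?_)
    refine spec_seq (spec_setR hw (by omega) (by simp [g1]; omega) ?_)
    refine spec_seq (spec_setR hw (by omega) (by simp [g1]; omega) ?_)
    refine spec_seq (spec_setR hw (by omega) (by simp [g1]; omega) ?_)
    have hstep : ∀ f, f = insertBetween (h.A 4 (n - 3 - i)) (h.A 5 (n - 3 - i)) (h.A 6 (n - 3 - i))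
        (h'.A 7) → f = chainNext nx (h.A 4) (h.A 5) (h.A 6) (n - 2) (i + 1) := by
      intro f hf
      rw [hf, chainNext, g7, show n - 2 - 1 - i = n - 3 - i by omega]
    refine spec_seq (spec_ifEqual hw (by simp [g1, g5, hu]) (by simp) (fun he => ?_) fun he => ?_)
    · simp [g1, g5, g6] at he
      refine spec_seq (spec_setA hw (by omega) (by simp) (by simpa [g1, g5]) (by simp) ?_)
      refine spec_setA hw (by omega) (by simp) (by simpa [g1, g4]) (by simp) ?_
      refine spec_incr hw (by simp [g1]; omega) ⟨by simp [g1], by simp [g2], by simp [g3],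
        by simp [g4], by simp [g5], by simp [g6], hstep _ ?_⟩
      simp [insertBetween, g1, g4, g5, g6, he]
    · simp [g1, g5, g6] at he
      refine spec_seq (spec_setA hw (by omega) (by simp) (by simpa [g1, g6]) (by simp) ?_)
      refine spec_setA hw (by omega) (by simp) (by simpa [g1, g4]) (by simp) ?_
      refine spec_incr hw (by simp [g1]; omega) ⟨by simp [g1], by simp [g2], by simp [g3],
        by simp [g4], by simp [g5], by simp [g6], hstep _ ?_⟩
      simp [insertBetween, g1, g4, g5, g6, he]
  · rintro h' ⟨g1, g2, g3, g4, g5, g6, g7⟩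
    refine ⟨g3, ?_⟩
    rw [g7]
    refine hc.exists_next (by omega) (by omega) hst ?_ ?_
    · rw [show n - 2 - 1 = n - 3 by omega]
      simp [nx, Function.update_of_ne hne]
    · rw [show n - 2 - 1 = n - 3 by omega]
      simp [nx]

/-- Numbers the vertices along the cycle. -/
def walk : Program :=
  setR 2 0 ;; setR 1 .n ;; setR 0 0 ;; .whileLt 0 1
    (setA 8 (.r 2) (.r 0) ;; setR 2 (.A 7 (.r 2)) ;; incr)

theorem spec_walk (hw : Fits w n) (hN : 2 * n ≤ N) {o : ℕ → ℕ} (h0 : o 0 = 0)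
    (hlt : ∀ i < n, o i < n) (hinj : ∀ i < n, ∀ j < n, o i = o j → i = j)
    (hnx : ∀ i, i + 1 < n → h.A 7 (o i) = o (i + 1)) :
    Spec w n N walk h fun h' => h'.I = h.I ∧ ∀ i < n, h'.A 8 (o i) = i := by
  have h1 := hw.lin
  have h3 := hw.pos
  refine spec_seq (spec_setR hw (by omega) (by simp) ?_)
  refine spec_seq (spec_setR hw (by omega) (by simp) ?_)
  refine spec_seq (spec_setR hw (by omega) (by simp) ?_)
  -- The current vertex is specified only for i < n: nothing is assumed about the successor of the
  -- last vertex.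
  refine spec_while (K := n) (by omega) (by omega)
    (fun i h' => h'.reg 0 = i ∧ h'.reg 1 = n ∧ h'.I = h.I ∧ h'.A 7 = h.A 7 ∧
      (i < n → h'.reg 2 = o i) ∧ ∀ j < i, h'.A 8 (o j) = j)
    (fun i h' hi => ⟨hi.1, hi.2.1⟩) (by omega) ?_ ?_ (fun h' hi => ⟨hi.2.2.1, hi.2.2.2.2.2⟩)
  · exact ⟨by simp, by simp, rfl, rfl, by simp [h0], by simp⟩
  · rintro i hi h' ⟨g1, g2, g3, g4, g5, g6⟩
    have g5' := g5 hi
    refine spec_seq (spec_setA hw (by omega) (by simp) (by simpa [g5'] using hlt i hi) (by simp) ?_)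
    refine spec_seq (spec_setR hw (by omega) (by simpa [g5'] using hlt i hi) ?_)
    refine spec_incr hw (by simp [g1]; omega) ⟨by simp [g1], by simp [g2], by simp [g3],
      by simp [g4], fun hi' => ?_, fun j hj => ?_⟩
    · simp [g5', g4, hnx i hi']
    · by_cases hji : j = i
      · simp [hji, g5', g1]
      · have : o j ≠ o i := fun hc => hji (hinj j (by omega) i hi hc)
        simpa [g5', this] using g6 j (by omega)

/-! ### Smallest neighbours -/

/-- `p j` is the minimum of `j` and of the `R`-predecessors of `j`. -/
structure IsMinUpTo (n : ℕ) (R : ℕ → ℕ → Prop) (p : ℕ → ℕ) : Prop where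
  le : ∀ j < n, p j ≤ j
  rel : ∀ j < n, p j = j ∨ R (p j) j
  min : ∀ i j, R i j → j < n → p j ≤ i

/-- Takes the vertex in register `a` into account as a neighbour of the one in register `b`. -/
def relax (a b : ℕ) : Program :=
  ifLess (.r a) (.A 9 (.r b)) (setA 9 (.r b) (.r a)) .skip

/-- The states agree except for the field 9. -/
structure SameButMin (h h' : HState) : Prop where
  reg : h'.reg = h.reg
  I : h'.I = h.I
  A : ∀ f, f ≠ 9 → h'.A f = h.A f

theorem spec_relax (hw : Fits w n) {R : ℕ → ℕ → Prop} {a b x y : ℕ} (ha : a < 20) (hb : b < 20)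
    (hax : h.reg a = x) (hby : h.reg b = y) (hy : y < n) (hp : IsMinUpTo n R (h.A 9)) :
    Spec w n N (relax a b) h fun h' => SameButMin h h' ∧
      IsMinUpTo n (fun i j => R i j ∨ (i = x ∧ j = y)) (h'.A 9) := by
  refine spec_ifLess hw (by simpa) (by simp [hb, hby, hy]) (fun hlt => ?_) fun hlt => ?_
  · simp only [Ex.eval_r, Ex.eval_A, hax, hby] at hlt
    refine spec_setA hw (by omega) (by simpa) (by simpa [hby]) (by simpa)
      ⟨⟨rfl, rfl, fun f hf => by simp [hf]⟩, ?_⟩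
    simp only [HState.setA_A, if_true, Ex.eval_r, hax, hby]
    refine ⟨fun j hj => ?_, fun j hj => ?_, fun i j hij hj => ?_⟩
    · have := hp.le j hj
      by_cases hjy : j = y
      · subst hjy; simp; omega
      · simpa [hjy]
    · by_cases hjy : j = y
      · subst hjy; simp
      · simpa [hjy] using hp.rel j hj
    · by_cases hjy : j = y
      · subst hjy
        rw [Function.update_self]
        rcases hij with hij | hij
        · have := hp.min i j hij hj; omega
        · omega
      · rw [Function.update_of_ne hjy]
        rcases hij with hij | hij
        · exact hp.min i j hij hj
        · exact absurd hij.2 hjy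
  · simp only [Ex.eval_r, Ex.eval_A, hax, hby] at hlt
    refine spec_skip ⟨⟨rfl, rfl, fun f hf => rfl⟩, hp.le, fun j hj => ?_, fun i j hij hj => ?_⟩
    · exact (hp.rel j hj).imp_right Or.inl
    · rcases hij with hij | ⟨rfl, rfl⟩
      · exact hp.min i j hij hj
      · omega

/-- Computes the smallest neighbours with respect to the numbering in field 8. -/
def minNb : Program :=
  setR 1 .n ;; setR 0 0 ;; .whileLt 0 1 (setA 9 (.r 0) (.r 0) ;; setA 10 (.r 0) 0 ;; incr) ;;
  setR 1 (.I 1) ;; setR 0 0 ;; .whileLt 0 1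
    (setR 2 (.A 8 (.I (2 + .r 0 + .r 0))) ;; setR 3 (.A 8 (.I (3 + .r 0 + .r 0))) ;;
      relax 2 3 ;; relax 3 2 ;; incr)

theorem spec_minNb (hw : Fits w n) (hN : 2 * n ≤ N) {m : ℕ} {eu ev : ℕ → ℕ}
    (hI : IsInput n m eu ev h.I) (hpos : ∀ v < n, h.A 8 v < n) :
    Spec w n N minNb h fun h' => h'.I = h.I ∧ h'.A 8 = h.A 8 ∧ (∀ j < n, h'.A 10 j = 0) ∧
      IsMinUpTo n (fun x y => ∃ t < m, (x = h.A 8 (eu t) ∧ y = h.A 8 (ev t)) ∨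
        (x = h.A 8 (ev t) ∧ y = h.A 8 (eu t))) (h'.A 9) := by
  have h0 := hw.ne_zero
  have h1 := hw.lin
  have h3 := hw.pos
  have hm := hI.le
  refine spec_seq (spec_setR hw (by omega) (by simp) ?_)
  refine spec_seq (spec_setR hw (by omega) (by simp) ?_)
  refine spec_seq (spec_while (K := n) (by omega) (by omega)
    (fun i h' => h'.reg 0 = i ∧ h'.reg 1 = n ∧ h'.I = h.I ∧ h'.A 8 = h.A 8 ∧
      (∀ j < i, h'.A 10 j = 0) ∧ ∀ j < i, h'.A 9 j = j)
    (fun i h' hi => ⟨hi.1, hi.2.1⟩) (by omega) ?_ ?_ ?_)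
  · exact ⟨by simp, by simp, rfl, rfl, by simp, by simp⟩
  · rintro i hi h' ⟨g1, g2, g3, g4, g5, g6⟩
    refine spec_seq (spec_setA hw (by omega) (by simp) (by simpa [g1]) (by simp) ?_)
    refine spec_seq (spec_setA hw (by omega) (by simp) (by simpa [g1]) (by simp) ?_)
    refine spec_incr hw (by simp [g1]; omega) ⟨by simp [g1], by simp [g2], by simp [g3],
      by simp [g4], fun j hj => ?_, fun j hj => ?_⟩
    · by_cases hji : j = i
      · simp [hji, g1]
      · simpa [hji, g1] using g5 j (by omega)
    · by_cases hji : j = i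
      · simp [hji, g1]
      · simpa [hji, g1] using g6 j (by omega)
  rintro ha ⟨-, -, a3, a4, a5, a6⟩
  have hI1 := hI.length
  refine spec_seq (spec_setR hw (by omega) (by simp; omega) ?_)
  refine spec_seq (spec_setR hw (by omega) (by simp) ?_)
  refine spec_while (K := m) (by omega) (by omega)
    (fun i h' => h'.reg 0 = i ∧ h'.reg 1 = m ∧ h'.I = h.I ∧ h'.A 8 = h.A 8 ∧
      (∀ j < n, h'.A 10 j = 0) ∧
      IsMinUpTo n (fun x y => ∃ t < i, (x = h.A 8 (eu t) ∧ y = h.A 8 (ev t)) ∨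
        (x = h.A 8 (ev t) ∧ y = h.A 8 (eu t))) (h'.A 9))
    (fun i h' hi => ⟨hi.1, hi.2.1⟩) (by omega) ?_ ?_ (fun h' hi => hi.2.2)
  · refine ⟨by simp, by simp [a3, hI1], by simp [a3], by simp [a4], by simpa using a5, ?_⟩
    exact ⟨fun j hj => (a6 j hj).le, fun j hj => Or.inl (a6 j hj), by simp⟩
  · rintro i hi h' ⟨g1, g2, g3, g4, g5, g6⟩
    have e1 := hI.left_lt i hi
    have e2 := hI.right_lt i hi
    have e3 := hI.left i hi
    have e4 := hI.right i hi
    have p1 := hpos _ e1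
    have p2 := hpos _ e2
    refine spec_seq (spec_setR hw (by omega) (by simp [g1, g3, e3]; omega) ?_)
    refine spec_seq (spec_setR hw (by omega) (by simp [g1, g3, e4]; omega) ?_)
    refine spec_seq (Spec.mono (spec_relax hw (a := 2) (b := 3) (x := h.A 8 (eu i))
      (y := h.A 8 (ev i)) (by omega) (by omega) ?_ ?_ p2 g6) ?_)
    · simp [g1, g3, g4, e3]
    · simp [g1, g3, g4, e4]
    rintro hb ⟨sb, rb⟩
    refine spec_seq (Spec.mono (spec_relax hw (a := 3) (b := 2) (x := h.A 8 (ev i))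
      (y := h.A 8 (eu i)) (by omega) (by omega) ?_ ?_ p1 rb) ?_)
    · simp [sb.reg, g1, g3, g4, e4]
    · simp [sb.reg, g1, g3, g4, e3]
    rintro hc ⟨sc, rc⟩
    refine spec_incr hw (by simp [sc.reg, sb.reg, g1]; omega) ⟨by simp [sc.reg, sb.reg, g1],
      by simp [sc.reg, sb.reg, g2], by simp [sc.I, sb.I, g3],
      by simp [sc.A 8, sb.A 8, g4], fun j hj => by simp [sc.A 10, sb.A 10, g5 j hj], ?_⟩
    rw [HState.setR_A]
    convert rc using 3 with x y
    simp only [Nat.lt_succ_iff_lt_or_eq, or_and_right, exists_or, exists_eq_left, or_assoc]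

end WordRAM

/-! ### The layout -/

/-- Among the vertices with a parent, `j + 1` is the only one that is not counted by the slope of
`j + 1` but by the slope of `j` or as a child of `j`. -/
theorem slope_succ {n : ℕ} {p : ℕ → ℕ} (hp : ∀ j, 1 ≤ j → j < n → p j < j) {j : ℕ}
    (hj : j + 1 < n) :
    {v ∈ Finset.range n | j + 1 < v ∧ p v < j + 1}.card + 1 =
      {v ∈ Finset.range n | j < v ∧ p v < j}.card +
        {v ∈ Finset.range n | 1 ≤ v ∧ p v = j}.card := by
  rw [← Finset.card_union_of_disjoint, ← Finset.card_insert_of_notMem (a := j + 1)]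
  · congr 1
    ext v
    simp only [Finset.mem_insert, Finset.mem_filter, Finset.mem_range, Finset.mem_union]
    have := hp v
    have := hp (j + 1)
    constructor
    · rintro (rfl | h) <;> omega
    · rintro (h | h) <;> omega
  · simp
  · rw [Finset.disjoint_left]
    simp only [Finset.mem_filter]
    intro v h1 h2
    omega

namespace WordRAM

variable {w n N : ℕ} {h : HState} {Q : HState → Prop}

/-- Counts the vertices `a + 1` that are the smallest neighbours of `a + 2`. -/
def countInner : Program :=
  setR 8 0 ;; setR 1 (.n - 2) ;; setR 0 0 ;; .whileLt 0 1
    (ifLess (.r 0) (.A 9 (.r 0 + 2)) (setR 8 (.r 8 + 1)) .skip ;; incr)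

theorem spec_countInner (hw : Fits w n) (hN : 2 * n ≤ N) :
    Spec w n N countInner h fun h' => h'.I = h.I ∧ h'.A = h.A ∧
      h'.reg 8 = {a ∈ Finset.range (n - 2) | a < h.A 9 (a + 2)}.card := by
  have h0 := hw.ne_zero
  have h1 := hw.lin
  have h3 := hw.pos
  refine spec_seq (spec_setR hw (by omega) (by simp) ?_)
  refine spec_seq (spec_setR hw (by omega) (by simp; omega) ?_)
  refine spec_seq (spec_setR hw (by omega) (by simp) ?_)
  refine spec_while (K := n - 2) (by omega) (by omega)
    (fun i h' => h'.reg 0 = i ∧ h'.reg 1 = n - 2 ∧ h'.I = h.I ∧ h'.A = h.A ∧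
      h'.reg 8 = {a ∈ Finset.range i | a < h.A 9 (a + 2)}.card)
    (fun i h' hi => ⟨hi.1, hi.2.1⟩) (by omega) ?_ ?_ (fun h' hi => hi.2.2)
  · exact ⟨by simp, by simp, rfl, rfl, by simp⟩
  · rintro i hi h' ⟨g1, g2, g3, g4, g5⟩
    have hle : h'.reg 8 ≤ i := by
      rw [g5]
      exact (Finset.card_filter_le _ _).trans (by simp)
    rw [Finset.range_eq_Ico] at g5
    refine spec_seq (spec_ifLess hw (by simp) (by simp [g1]; omega) (fun hc => ?_) fun hc => ?_)
    · simp only [Ex.eval_r, Ex.eval_A, Ex.eval_add, Ex.eval_ofNat, g1, g4] at hc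
      refine spec_setR hw (by omega) (by simp; omega) ?_
      refine spec_incr hw (by simp [g1]; omega) ⟨by simp [g1], by simp [g2], by simp [g3],
        by simp [g4], ?_⟩
      rw [Finset.range_add_one, Finset.filter_insert, if_pos hc, Finset.card_insert_of_notMem
        (by simp)]
      simp [g5]
    · simp only [Ex.eval_r, Ex.eval_A, Ex.eval_add, Ex.eval_ofNat, g1, g4] at hc
      refine spec_skip ?_
      refine spec_incr hw (by simp [g1]; omega) ⟨by simp [g1], by simp [g2], by simp [g3],
        by simp [g4], ?_⟩
      rw [Finset.range_add_one, Finset.filter_insert, if_neg hc]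
      simp [g5]

/-- Reverses the numbering. -/
def reverseNumbers : Program :=
  setR 1 .n ;; setR 0 0 ;; .whileLt 0 1 (setA 8 (.r 0) (.n - 1 - .A 8 (.r 0)) ;; incr)

theorem spec_reverseNumbers (hw : Fits w n) (hN : 2 * n ≤ N) :
    Spec w n N reverseNumbers h fun h' => h'.I = h.I ∧ ∀ v < n, h'.A 8 v = n - 1 - h.A 8 v := by
  have h0 := hw.ne_zero
  have h1 := hw.lin
  have h3 := hw.pos
  refine spec_seq (spec_setR hw (by omega) (by simp) ?_)
  refine spec_seq (spec_setR hw (by omega) (by simp) ?_)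
  refine spec_while (K := n) (by omega) (by omega)
    (fun i h' => h'.reg 0 = i ∧ h'.reg 1 = n ∧ h'.I = h.I ∧
      ∀ v, h'.A 8 v = if v < i then n - 1 - h.A 8 v else h.A 8 v)
    (fun i h' hi => ⟨hi.1, hi.2.1⟩) (by omega) ?_ ?_
    (fun h' hi => ⟨hi.2.2.1, fun v hv => by rw [hi.2.2.2, if_pos hv]⟩)
  · exact ⟨by simp, by simp, rfl, by simp⟩
  · rintro i hi h' ⟨g1, g2, g3, g4⟩
    refine spec_seq (spec_setA hw (by omega) (by simp) (by simpa [g1]) (by simp [g1, hi, h0]) ?_)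
    refine spec_incr hw (by simp [g1]; omega) ⟨by simp [g1], by simp [g2], by simp [g3],
      fun v => ?_⟩
    by_cases hvi : v = i
    · simp [hvi, g1, g4]
    · simp [hvi, g1, g4, show v < i + 1 ↔ v < i by omega]

/-- Counts the children. -/
def countChildren : Program :=
  setR 1 (.n - 1) ;; setR 0 0 ;; .whileLt 0 1
    (setA 10 (.A 9 (.r 0 + 1)) (.A 10 (.A 9 (.r 0 + 1)) + 1) ;; incr)

/-- The condition `1 ≤ v` leaves out the root, for which field 9 is not a parent. -/
theorem spec_countChildren (hw : Fits w n) (hN : 2 * n ≤ N) (hz : ∀ j < n, h.A 10 j = 0)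
    (hp : ∀ j, 1 ≤ j → j < n → h.A 9 j < j) :
    Spec w n N countChildren h fun h' => h'.I = h.I ∧ h'.A 8 = h.A 8 ∧ h'.A 9 = h.A 9 ∧
      ∀ j < n, h'.A 10 j = {v ∈ Finset.range n | 1 ≤ v ∧ h.A 9 v = j}.card := by
  have h0 := hw.ne_zero
  have h1 := hw.lin
  have h3 := hw.pos
  refine spec_seq (spec_setR hw (by omega) (by simp [h0]) ?_)
  refine spec_seq (spec_setR hw (by omega) (by simp) ?_)
  refine spec_while (K := n - 1) (by omega) (by omega)
    (fun i h' => h'.reg 0 = i ∧ h'.reg 1 = n - 1 ∧ h'.I = h.I ∧ h'.A 8 = h.A 8 ∧ h'.A 9 = h.A 9 ∧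
      ∀ j < n, h'.A 10 j = {v ∈ Finset.range (i + 1) | 1 ≤ v ∧ h.A 9 v = j}.card)
    (fun i h' hi => ⟨hi.1, hi.2.1⟩) (by omega) ?_ ?_ ?_
  · refine ⟨by simp, by simp, rfl, rfl, rfl, fun j hj => ?_⟩
    simp only [HState.setR_A, hz j hj]
    rw [eq_comm, Finset.card_eq_zero, Finset.filter_eq_empty_iff]
    intro v hv
    rw [Finset.mem_range] at hv
    omega
  · rintro i hi h' ⟨g1, g2, g3, g4, g5, g6⟩
    have hlt := hp (i + 1) (by omega) (by omega)
    have hle : h'.A 10 (h.A 9 (i + 1)) ≤ i + 1 := by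
      rw [g6 _ (by omega)]
      exact (Finset.card_filter_le _ _).trans (by simp)
    refine spec_seq (spec_setA hw (by omega) (by simp [g1, h0]; omega) (by simp [g1, g5]; omega)
      (by simp [g1, h0, g5]; omega) ?_)
    refine spec_incr hw (by simp [g1]; omega) ⟨by simp [g1], by simp [g2], by simp [g3],
      by simp [g4], by simp [g5], fun j hj => ?_⟩
    rw [Finset.range_add_one (n := i + 1), Finset.filter_insert]
    by_cases hji : h.A 9 (i + 1) = j
    · rw [if_pos ⟨by omega, hji⟩, Finset.card_insert_of_notMem (by simp), ← g6 j hj]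
      simp [g1, g5, hji]
    · rw [if_neg (fun hc => hji hc.2), ← g6 j hj]
      simp [g1, g5, Ne.symm hji]
  · rintro h' ⟨g1, g2, g3, g4, g5, g6⟩
    rw [Nat.sub_add_cancel h3] at g6
    exact ⟨g3, g4, g5, g6⟩

/-- Computes the heights. -/
def computeHeights : Program :=
  setA 11 0 0 ;; setR 8 0 ;; setR 1 (.n - 1) ;; setR 0 0 ;; .whileLt 0 1
    (setR 8 (.r 8 + .A 10 (.r 0) - 1) ;;
      setA 11 (.r 0 + 1)
        (.A 11 (.A 9 (.r 0 + 1)) + .r 8 * (.r 0 + 1 - .A 9 (.r 0 + 1))) ;; incr)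

/-- Register 8 carries the slope from one position to the next by `slope_succ`, so a single pass
suffices. The bound n * j on the heights is part of the invariant in order to exclude overflow. -/
theorem spec_computeHeights (hw : Fits w n) (hN : 2 * n ≤ N)
    (hp : ∀ j, 1 ≤ j → j < n → h.A 9 j < j)
    (hch : ∀ j < n, h.A 10 j = {v ∈ Finset.range n | 1 ≤ v ∧ h.A 9 v = j}.card) :
    Spec w n N computeHeights h fun h' => h'.I = h.I ∧ h'.A 8 = h.A 8 ∧
      IsLayout n (h.A 9) (fun j => {v ∈ Finset.range n | j < v ∧ h.A 9 v < j}.card) (h'.A 11) := by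
  have h0 := hw.ne_zero
  have h1 := hw.lin
  have h2 := hw.le
  have h3 := hw.pos
  have hc : ∀ P : ℕ → Prop, [DecidablePred P] → {v ∈ Finset.range n | P v}.card ≤ n := fun P _ =>
    (Finset.card_filter_le _ _).trans (by simp)
  refine spec_seq (spec_setA hw (by omega) (by simp) (by simpa) (by simp) ?_)
  refine spec_seq (spec_setR hw (by omega) (by simp) ?_)
  refine spec_seq (spec_setR hw (by omega) (by simp [h0]) ?_)
  refine spec_seq (spec_setR hw (by omega) (by simp) ?_)
  refine spec_while (K := n - 1) (by omega) (by omega)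
    (fun i h' => h'.reg 0 = i ∧ h'.reg 1 = n - 1 ∧ h'.I = h.I ∧ h'.A 8 = h.A 8 ∧ h'.A 9 = h.A 9 ∧
      h'.A 10 = h.A 10 ∧ h'.reg 8 = {v ∈ Finset.range n | i < v ∧ h.A 9 v < i}.card ∧
      h'.A 11 0 = 0 ∧ (∀ j ≤ i, h'.A 11 j ≤ n * j) ∧ ∀ j, 1 ≤ j → j ≤ i → h'.A 11 j =
        h'.A 11 (h.A 9 j) + {v ∈ Finset.range n | j < v ∧ h.A 9 v < j}.card * (j - h.A 9 j))
    (fun i h' hi => ⟨hi.1, hi.2.1⟩) (by omega) ?_ ?_ ?_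
  · exact ⟨by simp, by simp, rfl, by simp, by simp, by simp, by simp, by simp, by simp,
      fun j j1 j2 => by omega⟩
  · rintro i hi h' ⟨g1, g2, g3, g4, g5, g6, g7, g8, g9, g10⟩
    have hlt := hp (i + 1) (by omega) (by omega)
    have hs := slope_succ hp (j := i) (by omega)
    rw [← g7, ← hch i (by omega)] at hs
    have c1 := hc fun v => i < v ∧ h.A 9 v < i
    have c2 := hc fun v => 1 ≤ v ∧ h.A 9 v = i
    have c3 := hc fun v => i + 1 < v ∧ h.A 9 v < i + 1
    rw [← g7] at c1
    rw [← hch i (by omega)] at c2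
    refine spec_seq (spec_setR hw (by omega) (by simp [g1, h0, g6]; omega) ?_)
    -- The truncated subtraction is exact, as `slope_succ` shows the sum to be at least 1.
    have hr8 : h'.reg 8 + h.A 10 i - 1 =
        {v ∈ Finset.range n | i + 1 < v ∧ h.A 9 v < i + 1}.card := by omega
    set c := {v ∈ Finset.range n | i + 1 < v ∧ h.A 9 v < i + 1}.card with hcdef
    clear_value c
    have b1 := g9 (h.A 9 (i + 1)) (by omega)
    have b2 : c * (i + 1 - h.A 9 (i + 1)) ≤ n * (i + 1 - h.A 9 (i + 1)) :=
      Nat.mul_le_mul_right _ c3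
    have b3 : n * h.A 9 (i + 1) + n * (i + 1 - h.A 9 (i + 1)) = n * (i + 1) := by
      rw [← mul_add, Nat.add_sub_of_le hlt.le]
    have b4 : n * (i + 1) ≤ n * n := Nat.mul_le_mul_left _ (by omega)
    refine spec_seq (spec_setA hw (by omega) (by simp [g1, h0]; omega) (by simp [g1]; omega)
      (by simp [g1, h0, g5, g6, hr8]; omega) ?_)
    refine spec_incr hw (by simp [g1]; omega) ⟨by simp [g1], by simp [g2], by simp [g3],
      by simp [g4], by simp [g5], by simp [g6], by simp [g1, g6, hr8], by simp [g1, g8], ?_, ?_⟩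
    · intro j hj
      by_cases hji : j = i + 1
      · simp [hji, g1, g5, g6, hr8]
        omega
      · simpa [hji, g1, g5, g6, hr8] using g9 j (by omega)
    · intro j j1 j2
      by_cases hji : j = i + 1
      · subst hji
        rw [← hcdef]
        simp [g1, g5, g6, hr8, hlt.ne]
      · have := hp j j1 (by omega)
        simpa [hji, g1, g5, g6, hr8, show h.A 9 j ≠ i + 1 by omega] using g10 j j1 (by omega)
  · rintro h' ⟨g1, g2, g3, g4, g5, g6, g7, g8, g9, g10⟩
    exact ⟨g3, g4, fun _ _ _ => rfl, g8, fun j j1 j2 => g10 j j1 (by omega)⟩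

/-- Writes the output. -/
def writeOutput : Program :=
  setR 1 .n ;; setR 0 0 ;; .whileLt 0 1
    (setI (.r 0 + .r 0) (.A 8 (.r 0)) ;; setI (.r 0 + .r 0 + 1) (.A 11 (.A 8 (.r 0))) ;; incr)

theorem spec_writeOutput (hw : Fits w n) (hN : 2 * n ≤ N) (hpos : ∀ v < n, h.A 8 v < n) :
    Spec w n N writeOutput h fun h' => ∀ v < n, h'.I (2 * v) = h.A 8 v ∧
      h'.I (2 * v + 1) = h.A 11 (h.A 8 v) := by
  have h0 := hw.ne_zero
  have h1 := hw.lin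
  have h3 := hw.pos
  refine spec_seq (spec_setR hw (by omega) (by simp) ?_)
  refine spec_seq (spec_setR hw (by omega) (by simp) ?_)
  refine spec_while (K := n) (by omega) (by omega)
    (fun i h' => h'.reg 0 = i ∧ h'.reg 1 = n ∧ h'.A = h.A ∧ ∀ v < i, h'.I (2 * v) = h.A 8 v ∧
      h'.I (2 * v + 1) = h.A 11 (h.A 8 v))
    (fun i h' hi => ⟨hi.1, hi.2.1⟩) (by omega) ?_ ?_ (fun h' hi => hi.2.2.2)
  · exact ⟨by simp, by simp, rfl, by simp⟩
  · rintro i hi h' ⟨g1, g2, g3, g4⟩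
    have := hpos i hi
    refine spec_seq (spec_setI hw (by simp [g1]; omega) (by simp [g1]; omega) (by simpa [g1]) ?_)
    refine spec_seq (spec_setI hw (by simp [g1, h0]; omega) (by simp [g1]; omega)
      (by simp [g1, g3, hi, this]) ?_)
    refine spec_incr hw (by simp [g1]; omega) ⟨by simp [g1], by simp [g2], by simp [g3],
      fun v hv => ?_⟩
    by_cases hvi : v = i
    · simp [hvi, g1, g3, two_mul]
    · have := g4 v (by omega)
      simp [g1, g3, show 2 * v ≠ i + i + 1 by omega, show 2 * v ≠ i + i by omega,
        show 2 * v + 1 ≠ i + i by omega, this]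

end WordRAM

/-! ### The main program -/

/-- The relation between the positions on a cycle. -/
abbrev PosRel {V : Type*} (n : ℕ) (o : ℕ → V) (R : V → V → Prop) : ℕ → ℕ → Prop :=
  fun i j => i < n ∧ j < n ∧ R (o i) (o j)

theorem CycOrder.chordOrder {V : Type*} {R : V → V → Prop} {n : ℕ} {o : ℕ → V}
    (h : CycOrder R n o) (hn : 3 ≤ n) : ChordOrder n (PosRel n o R) where
  three_le := hn
  symm := fun i j ⟨hi, hj, hij⟩ => ⟨hj, hi, h.symm i hi j hj hij⟩
  irrefl := fun i ⟨hi, _, hij⟩ => h.irrefl i hi hij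
  lt := fun _ _ ⟨_, hj, _⟩ => hj
  cons := fun i hi => ⟨by omega, hi, h.cons i hi⟩
  close := ⟨by omega, by omega, h.symm _ (by omega) _ (by omega) h.close⟩
  nc := fun a b c d hab hbc hcd hac hbd => h.nc a b c d hab hbc hcd hbd.2.1 ⟨hac.2.2, hbd.2.2⟩

/-- `pos` is the inverse of the enumeration `o` of `{0, …, n - 1}`. -/
structure IsEnum (n : ℕ) (o pos : ℕ → ℕ) : Prop where
  lt : ∀ i < n, o i < n
  pos_lt : ∀ v < n, pos v < n
  pos_o : ∀ i < n, pos (o i) = i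
  o_pos : ∀ v < n, o (pos v) = v

theorem IsEnum.mk_of_inverse {n : ℕ} {o pos : ℕ → ℕ} (h1 : ∀ i < n, o i < n)
    (h2 : ∀ i < n, pos (o i) = i) : IsEnum n o pos := by
  have hsurj : ∀ v < n, ∃ i < n, o i = v := by
    have := Finset.surj_on_of_inj_on_of_card_le (s := Finset.range n) (t := Finset.range n)
      (fun i _ => o i) (fun i hi => Finset.mem_range.2 (h1 i (Finset.mem_range.1 hi)))
      (fun i j hi hj hij => by
        rw [← h2 i (Finset.mem_range.1 hi), hij, h2 j (Finset.mem_range.1 hj)]) le_rfl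
    intro v hv
    obtain ⟨i, hi, he⟩ := this v (Finset.mem_range.2 hv)
    exact ⟨i, Finset.mem_range.1 hi, he.symm⟩
  refine ⟨h1, fun v hv => ?_, h2, fun v hv => ?_⟩
  · obtain ⟨i, hi, rfl⟩ := hsurj v hv
    rwa [h2 i hi]
  · obtain ⟨i, hi, rfl⟩ := hsurj v hv
    rw [h2 i hi]

theorem IsEnum.reverse {n : ℕ} {o pos pos' : ℕ → ℕ} (h : IsEnum n o pos)
    (hp : ∀ v < n, pos' v = n - 1 - pos v) : IsEnum n (fun i => o (n - 1 - i)) pos' := by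
  refine ⟨fun i hi => h.lt _ (by omega), fun v hv => ?_, fun i hi => ?_, fun v hv => ?_⟩
  · rw [hp v hv]; omega
  · rw [hp _ (h.lt _ (by omega)), h.pos_o _ (by omega)]; omega
  · have := h.pos_lt v hv
    rw [hp v hv, show n - 1 - (n - 1 - pos v) = pos v by omega, h.o_pos v hv]

namespace WordRAM

variable {w n N : ℕ} {h : HState} {Q : HState → Prop}

theorem IsMinUpTo.isMinNeighbour {m : ℕ} {eu ev I o pos p : ℕ → ℕ} (hI : IsInput n m eu ev I)
    (ho : CycOrder (NbRel (edgeNb eu ev m)) n o) (hn : 3 ≤ n) (he : IsEnum n o pos)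
    (hp : IsMinUpTo n (fun x y => ∃ t < m, (x = pos (eu t) ∧ y = pos (ev t)) ∨
        (x = pos (ev t) ∧ y = pos (eu t))) p) :
    IsMinNeighbour n (PosRel n o (NbRel (edgeNb eu ev m))) p := by
  have hE := ho.chordOrder hn
  have key : ∀ i j, PosRel n o (NbRel (edgeNb eu ev m)) i j ↔
      ∃ t < m, (i = pos (eu t) ∧ j = pos (ev t)) ∨ (i = pos (ev t) ∧ j = pos (eu t)) := by
    intro i j
    simp only [PosRel, NbRel, mem_edgeNb]
    constructor
    · rintro ⟨hi, hj, t, ht, ⟨h1, h2⟩ | ⟨h1, h2⟩⟩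
      · exact ⟨t, ht, Or.inl ⟨by rw [← h1, he.pos_o i hi], by rw [← h2, he.pos_o j hj]⟩⟩
      · exact ⟨t, ht, Or.inr ⟨by rw [← h1, he.pos_o i hi], by rw [← h2, he.pos_o j hj]⟩⟩
    · rintro ⟨t, ht, ⟨rfl, rfl⟩ | ⟨rfl, rfl⟩⟩ <;>
        simp only [he.o_pos _ (hI.left_lt t ht), he.o_pos _ (hI.right_lt t ht)]
      · exact ⟨he.pos_lt _ (hI.left_lt t ht), he.pos_lt _ (hI.right_lt t ht), t, ht, by simp⟩
      · exact ⟨he.pos_lt _ (hI.right_lt t ht), he.pos_lt _ (hI.left_lt t ht), t, ht, by simp⟩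
  refine ⟨fun j h1 hj => ?_, fun i j hij => hp.min i j ((key i j).1 hij) (hE.lt i j hij)⟩
  rcases hp.rel j hj with hc | hc
  -- The neighbour j - 1 on the cycle excludes that the initial value j has survived.
  · have h2 := hE.cons (j - 1) (by omega)
    rw [Nat.sub_add_cancel h1] at h2
    have := hp.min _ _ ((key _ _).1 h2) hj
    omega
  · exact (key _ _).2 hc

/-- Counts, reverses the numbering if this makes the number larger, and draws. -/
def draw : Program :=
  countInner ;; ifLess (.r 8 + .r 8 + 3) .n (reverseNumbers ;; minNb) .skip ;; countChildren ;;
  computeHeights ;; writeOutput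

/-- The result of the computation. -/
def IsResult (n : ℕ) (R : ℕ → ℕ → Prop) (I : ℕ → ℕ) : Prop :=
  ∃ o pos p c y : ℕ → ℕ, CycOrder R n o ∧ IsEnum n o pos ∧ IsMinNeighbour n (PosRel n o R) p ∧
    IsLayout n p c y ∧ n ≤ 2 * {a ∈ Finset.range (n - 2) | p (a + 2) = a + 1}.card + 3 ∧
    ∀ v < n, I (2 * v) = pos v ∧ I (2 * v + 1) = y (pos v)

/-- Since p (a + 2) ≤ a + 1 always, the comparison made by the program is a test for equality. -/
theorem filter_inner {E : ℕ → ℕ → Prop} {p : ℕ → ℕ} (hE : ChordOrder n E)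
    (hp : IsMinNeighbour n E p) : {a ∈ Finset.range (n - 2) | a < p (a + 2)} =
      {a ∈ Finset.range (n - 2) | p (a + 2) = a + 1} := by
  refine Finset.filter_congr fun a ha => ?_
  rw [Finset.mem_range] at ha
  have := hp.lt hE (show 1 ≤ a + 2 by omega) (by omega)
  omega

/-- If 2 t + 3 < n for the number t of vertices with children, then t + t' ≥ n - 3 gives n ≤ 2 t' +
3 for the reversed numbering, which is used instead. -/
theorem spec_draw (hw : Fits w n) (hN : 2 * n ≤ N) (hn : 3 ≤ n) {m : ℕ} {eu ev o : ℕ → ℕ}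
    (hI : IsInput n m eu ev h.I) (ho : CycOrder (NbRel (edgeNb eu ev m)) n o)
    (he : IsEnum n o (h.A 8)) (hz : ∀ j < n, h.A 10 j = 0)
    (hp : IsMinNeighbour n (PosRel n o (NbRel (edgeNb eu ev m))) (h.A 9)) :
    Spec w n N draw h fun h' => IsResult n (NbRel (edgeNb eu ev m)) h'.I := by
  have h0 := hw.ne_zero
  have h1 := hw.lin
  have hE := ho.chordOrder hn
  refine spec_seq (Spec.mono (spec_countInner hw hN) ?_)
  rintro ha ⟨aI, aA, a8⟩
  rw [filter_inner hE hp] at a8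
  have hcard : ha.reg 8 ≤ n := by
    rw [a8]; exact (Finset.card_filter_le _ _).trans (by simp)
  have hfinish : ∀ (hb : HState) (o : ℕ → ℕ), CycOrder (NbRel (edgeNb eu ev m)) n o →
      IsEnum n o (hb.A 8) → (∀ j < n, hb.A 10 j = 0) →
      IsMinNeighbour n (PosRel n o (NbRel (edgeNb eu ev m))) (hb.A 9) →
      n ≤ 2 * {a ∈ Finset.range (n - 2) | hb.A 9 (a + 2) = a + 1}.card + 3 →
      Spec w n N (countChildren ;; computeHeights ;; writeOutput) hb
        fun h' => IsResult n (NbRel (edgeNb eu ev m)) h'.I := by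
    intro hb o ho he hz hp hle
    have hlt : ∀ j, 1 ≤ j → j < n → hb.A 9 j < j := fun j j1 j2 => hp.lt (ho.chordOrder hn) j1 j2
    refine spec_seq (Spec.mono (spec_countChildren hw hN hz hlt) ?_)
    rintro hc ⟨-, c8, c9, c10⟩
    refine spec_seq (Spec.mono (spec_computeHeights hw hN (by rwa [c9]) (by rwa [c9])) ?_)
    rintro hd ⟨-, d8, d9⟩
    have d8' := d8.trans c8
    refine Spec.mono (spec_writeOutput hw hN (by rw [d8']; exact he.pos_lt)) fun hf hO => ?_
    rw [d8'] at hO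
    rw [c9] at d9
    exact ⟨o, hb.A 8, hb.A 9, _, hd.A 11, ho, he, hp, d9, hle, hO⟩
  refine spec_seq (spec_ifLess hw (by simp; omega) (by simp) (fun hc => ?_) fun hc => ?_)
  · simp only [Ex.eval_add, Ex.eval_r, Ex.eval_ofNat, Ex.eval_n, a8] at hc
    refine spec_seq (Spec.mono (spec_reverseNumbers hw hN) ?_)
    rintro hb ⟨bI, b8⟩
    rw [aA] at b8
    have he' := he.reverse b8
    refine Spec.mono (spec_minNb hw hN (m := m) (eu := eu) (ev := ev) ?_ he'.pos_lt) ?_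
    · rwa [bI, aI]
    rintro hd ⟨-, d8, d10, d9⟩
    have hp' := d9.isMinNeighbour hI ho.reverse hn he'
    refine hfinish hd _ ho.reverse (by rwa [d8]) d10 hp' ?_
    have := card_inner_add_card_inner hE (ho.reverse.chordOrder hn)
      (fun i hi j hj hij => ⟨by omega, by omega, hij.2.2⟩) hp hp'
    omega
  · simp only [Ex.eval_add, Ex.eval_r, Ex.eval_ofNat, Ex.eval_n, a8] at hc
    refine spec_skip (hfinish ha o ho (by rwa [aA]) (by rwa [aA]) (by rwa [aA]) ?_)
    rw [aA]
    omega

/-- Draws a biconnected outerplanar graph with at least three vertices. -/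
def drawMain : Program :=
  readEdges ;; fillRoots ;; fillQueue ;; removeAll ;; insertAll ;; walk ;; minNb ;; draw

/-- The given enumeration only guarantees that the reductions never get stuck; the program finds an
enumeration of its own. -/
theorem spec_drawMain (hw : Fits w n) (hN : 2 * n ≤ N) (hn : 3 ≤ n) {m : ℕ} {eu ev o : ℕ → ℕ}
    (hI : IsInput n m eu ev h.I) (hA : ∀ f < 16, ∀ i < n, h.A f i = 0)
    (hM : ∀ i < n, ∀ j < n, h.M i j = 0) (ho : CycOrder (NbRel (edgeNb eu ev m)) n o)
    (hlt : ∀ x, (∃ i < n, o i = x) ↔ x < n) :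
    Spec w n N drawMain h fun h' => IsResult n (NbRel (edgeNb eu ev m)) h'.I := by
  have hst : ∀ Q, IsStage n 0 Q (edgeNb eu ev m) := fun Q =>
    ⟨o, ho, fun x => by simpa using hlt x⟩
  refine spec_seq (Spec.mono (spec_readEdges hw hN hI hA hM) ?_)
  rintro ha ⟨aI, aR⟩
  refine spec_seq (Spec.mono (spec_fillRoots hw hN aR) ?_)
  rintro hb ⟨bI, bR, bT⟩
  refine spec_seq (Spec.mono (spec_fillQueue hw hN bR) ?_)
  rintro hc ⟨cI, cT, cR, cQ⟩
  refine spec_seq (Spec.mono (spec_removeAll hw hN hn cR (by rwa [cT]) (hst _) cQ) ?_)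
  rintro hd ⟨dI, Nbs, d0, dC, dS, dlt⟩
  refine spec_seq (Spec.mono (spec_insertAll hw hN hn dC dS dlt) ?_)
  rintro he ⟨eI, o, ho, h0, hlt, hnx⟩
  rw [d0] at ho
  refine spec_seq (Spec.mono (spec_walk hw hN h0 hlt ho.inj hnx) ?_)
  rintro hf ⟨fI, f8⟩
  have hen := IsEnum.mk_of_inverse hlt f8
  have hI' : hf.I = h.I := by rw [fI, eI, dI, cI, bI, aI]
  rw [← hI'] at hI
  refine spec_seq (Spec.mono (spec_minNb hw hN hI hen.pos_lt) ?_)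
  rintro hg ⟨gI, g8, g10, g9⟩
  exact spec_draw hw hN hn (by rwa [gI]) ho (by rwa [g8]) g10 (g9.isMinNeighbour hI ho hn hen)

end WordRAM

/-! ### Input and output -/

/-- A Hamiltonian cycle with non-crossing chords gives a numbering. -/
theorem CycOrder.exists_isNumbering {n : ℕ} {G : SimpleGraph (Fin n)} {o : ℕ → Fin n}
    (h : CycOrder G.Adj n o) (hn : 3 ≤ n) :
    ∃ pos, IsNumbering G (PosRel n o G.Adj) o pos := by
  have hbij : Function.Bijective fun i : Fin n => o i :=
    (Fintype.bijective_iff_injective_and_card _).2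
      ⟨fun i j hij => Fin.ext (h.inj i i.2 j j.2 hij), rfl⟩
  let e := Equiv.ofBijective _ hbij
  have h1 : ∀ v, o (e.symm v) = v := e.apply_symm_apply
  refine ⟨fun v => (e.symm v : ℕ), h.chordOrder hn, fun u v => ?_, fun v => (e.symm v).2, h1,
    fun i hi => ?_⟩
  · simp only [PosRel, h1]
    exact ⟨fun huv => ⟨(e.symm u).2, (e.symm v).2, huv⟩, fun huv => huv.2.2⟩
  · have : e ⟨i, hi⟩ = o i := rfl
    rw [← this, e.symm_apply_apply]

theorem ChordOrder.exists_isMinNeighbour {n : ℕ} {E : ℕ → ℕ → Prop} (hE : ChordOrder n E) :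
    ∃ p, IsMinNeighbour n E p := by
  refine ⟨fun j => sInf {i | E i j}, fun j h1 hj => ?_, fun i j hij => Nat.sInf_le hij⟩
  refine Nat.sInf_mem (s := {i | E i j}) ⟨j - 1, ?_⟩
  have := hE.cons (j - 1) (by omega)
  rwa [Nat.sub_add_cancel h1] at this

namespace WordRAM

variable {n : ℕ} {G : SimpleGraph (Fin n)} {L : List (Fin n × Fin n)}

/-- The first end of the edge with the number `t`. -/
def edgeFst (L : List (Fin n × Fin n)) (t : ℕ) : ℕ := if h : t < L.length then L[t].1 else 0

/-- The second end of the edge with the number `t`. -/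
def edgeSnd (L : List (Fin n × Fin n)) (t : ℕ) : ℕ := if h : t < L.length then L[t].2 else 0

theorem flatMap_getD (L : List (Fin n × Fin n)) (t : ℕ) :
    (L.flatMap fun x => [(x.1 : ℕ), (x.2 : ℕ)]).getD (t + t) 0 = edgeFst L t ∧
      (L.flatMap fun x => [(x.1 : ℕ), (x.2 : ℕ)]).getD (t + t + 1) 0 = edgeSnd L t := by
  induction L generalizing t with
  | nil => simp [edgeFst, edgeSnd]
  | cons x L ih =>
    cases t with
    | zero => simp [edgeFst, edgeSnd]
    | succ t =>
      rw [show t + 1 + (t + 1) = t + t + 1 + 1 by omega]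
      simpa [edgeFst, edgeSnd] using ih t

theorem isInput_inputState (hL : IsEdgeList G L) (hm : L.length ≤ 2 * n) :
    IsInput n L.length (edgeFst L) (edgeSnd L) (inputState L).mem := by
  have hinj : ∀ t (ht : t < L.length) t' (ht' : t' < L.length),
      s(L[t].1, L[t].2) = s(L[t'].1, L[t'].2) → t = t' := by
    intro t ht t' ht' he
    exact (List.Nodup.getElem_inj_iff hL.1 (hi := by simpa) (hj := by simpa)).1 (by simpa using he)
  refine ⟨rfl, hm, fun t _ => ?_, fun t _ => ?_, fun t ht => ?_, fun t ht => ?_, fun t ht => ?_,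
    fun t ht t' ht' => ?_⟩
  · rw [show 2 + t + t = t + t + 1 + 1 by omega]
    exact (flatMap_getD L t).1
  · rw [show 3 + t + t = t + t + 1 + 1 + 1 by omega]
    exact (flatMap_getD L t).2
  · simp [edgeFst, ht]
  · simp [edgeSnd, ht]
  · have : G.Adj L[t].1 L[t].2 := by
      rw [← SimpleGraph.mem_edgeSet, hL.2, List.mem_map]
      exact ⟨L[t], List.getElem_mem ht, rfl⟩
    simpa [edgeFst, edgeSnd, ht, Fin.val_inj] using this.ne
  · have ht2 : t' < L.length := ht'.trans ht
    simp only [edgeFst, edgeSnd, ht, ht2, dif_pos, Fin.val_inj]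
    constructor
    · rintro ⟨h1, h2⟩
      have := hinj t ht t' ht2 (by rw [h1, h2])
      omega
    · rintro ⟨h1, h2⟩
      have := hinj t ht t' ht2 (by rw [h1, h2, Sym2.eq_swap])
      omega

theorem mem_edgeNb_iff (hL : IsEdgeList G L) {x y : ℕ} :
    y ∈ edgeNb (edgeFst L) (edgeSnd L) L.length x ↔
      ∃ u v : Fin n, x = u ∧ y = v ∧ G.Adj u v := by
  rw [mem_edgeNb]
  constructor
  · rintro ⟨t, ht, h⟩
    have : G.Adj L[t].1 L[t].2 := by
      rw [← SimpleGraph.mem_edgeSet, hL.2, List.mem_map]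
      exact ⟨L[t], List.getElem_mem ht, rfl⟩
    simp only [edgeFst, edgeSnd, ht, dif_pos] at h
    rcases h with ⟨rfl, rfl⟩ | ⟨rfl, rfl⟩
    · exact ⟨_, _, rfl, rfl, this⟩
    · exact ⟨_, _, rfl, rfl, this.symm⟩
  · rintro ⟨u, v, rfl, rfl, huv⟩
    rw [← SimpleGraph.mem_edgeSet, hL.2, List.mem_map] at huv
    obtain ⟨z, hz, he⟩ := huv
    obtain ⟨t, ht, rfl⟩ := List.getElem_of_mem hz
    refine ⟨t, ht, ?_⟩
    simp only [edgeFst, edgeSnd, ht, dif_pos, Fin.val_inj]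
    rw [Sym2.eq_iff] at he
    rcases he with ⟨h1, h2⟩ | ⟨h1, h2⟩
    · exact Or.inl ⟨h1.symm, h2.symm⟩
    · exact Or.inr ⟨h2.symm, h1.symm⟩

theorem CycOrder.val {o : ℕ → Fin n} (h : CycOrder G.Adj n o) (hL : IsEdgeList G L) :
    CycOrder (NbRel (edgeNb (edgeFst L) (edgeSnd L) L.length)) n fun i => (o i : ℕ) := by
  have key : ∀ u v : Fin n, NbRel (edgeNb (edgeFst L) (edgeSnd L) L.length) u v ↔ G.Adj u v := by
    intro u v
    rw [NbRel, mem_edgeNb_iff hL]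
    constructor
    · rintro ⟨u', v', h1, h2, h3⟩
      rwa [Fin.ext h1, Fin.ext h2]
    · exact fun h => ⟨u, v, rfl, rfl, h⟩
  refine ⟨⟨h.two_le, fun i hi j hj hij => h.inj i hi j hj (Fin.ext hij), fun i hi => ?_, ?_⟩,
    fun i hi j hj => ?_, fun i hi => ?_, fun i hi x hx => ?_, fun a b c d hab hbc hcd hd => ?_⟩
  · exact (key _ _).2 (h.cons i hi)
  · exact (key _ _).2 h.close
  · rw [key, key]; exact h.symm i hi j hj
  · rw [key]; exact h.irrefl i hi
  · obtain ⟨u, v, h1, rfl, h3⟩ := (mem_edgeNb_iff hL).1 hx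
    rw [← Fin.ext h1] at h3
    obtain ⟨j, hj, rfl⟩ := h.closed i hi v h3
    exact ⟨j, hj, rfl⟩
  · rw [key, key]; exact h.nc a b c d hab hbc hcd hd

/-- The quality of a drawing. -/
def IsGoodDrawing (G : SimpleGraph (Fin n)) (q : Fin n → ℕ × ℕ) : Prop :=
  IsPlanarStraightLine G (gridPos q) ∧ IsMonotoneDrawing G (gridPos q) ∧
    2 * segmentCount G (gridPos q) + 3 ≤ 3 * n

/-- With 2 t ≥ n - 3 the count (2 n - 3) - t of `IsNumbering.segmentCount_le` is at most (3 n - 3) /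
2. -/
theorem IsResult.good (hL : IsEdgeList G L) (hn : 3 ≤ n) {I : ℕ → ℕ}
    (h : IsResult n (NbRel (edgeNb (edgeFst L) (edgeSnd L) L.length)) I) :
    (∀ v : Fin n, I (2 * (v : ℕ)) ≤ n ∧ I (2 * (v : ℕ) + 1) ≤ n * n) ∧
      IsGoodDrawing G fun v => (I (2 * (v : ℕ)), I (2 * (v : ℕ) + 1)) := by
  obtain ⟨o, pos, p, c, y, ho, he, hp, hl, hcard, hI⟩ := h
  have hE := ho.chordOrder hn
  have hnum : IsNumbering G (PosRel n o (NbRel (edgeNb (edgeFst L) (edgeSnd L) L.length)))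
      (fun i => if hi : o i < n then ⟨o i, hi⟩ else ⟨0, by omega⟩) (fun v => pos v) := by
    refine ⟨hE, fun u v => ?_, fun v => he.pos_lt v v.2, fun v => ?_, fun i hi => ?_⟩
    · simp only [PosRel, NbRel, he.o_pos _ u.2, he.o_pos _ v.2, mem_edgeNb_iff hL]
      constructor
      · exact fun h => ⟨he.pos_lt _ u.2, he.pos_lt _ v.2, u, v, rfl, rfl, h⟩
      · rintro ⟨-, -, u', v', h1, h2, h3⟩
        rwa [Fin.ext h1, Fin.ext h2]
    · simp [he.o_pos v v.2]
    · simp [he.lt i hi, he.pos_o i hi]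
  have hq : (fun v : Fin n => (I (2 * (v : ℕ)), I (2 * (v : ℕ) + 1))) =
      fun v : Fin n => (pos v, y (pos v)) := by
    funext v
    rw [(hI v v.2).1, (hI v v.2).2]
  refine ⟨fun v => ?_, ?_⟩
  · have h1 := he.pos_lt v v.2
    rw [(hI v v.2).1, (hI v v.2).2]
    exact ⟨h1.le, (hl.height_le hE hp h1).trans (Nat.mul_le_mul_left _ h1.le)⟩
  · rw [hq]
    refine ⟨hnum.planar hp hl, hnum.monotone, ?_⟩
    have := hnum.segmentCount_le hp hl
    omega

/-! ### Graphs with at most two vertices -/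

theorem eq_or_eq_of_le_two (hn : n ≤ 2) {u v : Fin n} (w : Fin n) (huv : u ≠ v) :
    w = u ∨ w = v := by
  simp only [Ne, Fin.ext_iff] at huv ⊢
  omega

theorem mem_edge_of_le_two (hn : n ≤ 2) {e : Sym2 (Fin n)} (he : e ∈ G.edgeSet) (w : Fin n) :
    w ∈ e := by
  induction e using Sym2.ind with
  | _ u v => exact Sym2.mem_iff.2 (eq_or_eq_of_le_two hn w (G.ne_of_adj he))

theorem edge_eq_of_le_two (hn : n ≤ 2) {e f : Sym2 (Fin n)} (he : e ∈ G.edgeSet)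
    (hf : f ∈ G.edgeSet) : e = f := by
  induction e using Sym2.ind with
  | _ u v =>
    exact ((Sym2.mem_and_mem_iff (G.ne_of_adj he)).1
      ⟨mem_edge_of_le_two hn hf u, mem_edge_of_le_two hn hf v⟩).symm

/-- There is at most one edge, so any injective placement works. For n = 1 the bound on the segments
is 0, and there is no edge at all. -/
theorem isGoodDrawing_of_le_two (hn : n ≤ 2) (hG : G.Connected) {q : Fin n → ℕ × ℕ}
    (hq : Function.Injective q) : IsGoodDrawing G q := by
  have hinj : Function.Injective (gridPos q) := fun u v huv => by
    simp only [gridPos, Prod.mk.injEq, Nat.cast_inj] at huv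
    exact hq (Prod.ext huv.1 huv.2)
  have hpos : 1 ≤ n := by
    obtain ⟨v⟩ := hG.nonempty
    have := v.2
    omega
  refine ⟨⟨hinj, fun u v huv => .single (hinj.ne (G.ne_of_adj huv)),
    fun e he w _ => mem_edge_of_le_two hn he w,
    fun e he f hf hef => absurd (edge_eq_of_le_two hn he hf) hef⟩,
    fun u v => ?_, ?_⟩
  · by_cases huv : u = v
    · subst huv
      exact ⟨.nil, by simp, (1, 0), by simp, by simp⟩
    · have hadj : G.Adj u v := by
        have : Nontrivial (Fin n) := ⟨u, v, huv⟩
        obtain ⟨z, hz⟩ := hG.preconnected.exists_adj_of_nontrivial u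
        rcases eq_or_eq_of_le_two hn z huv with rfl | rfl
        · exact absurd hz (G.irrefl)
        · exact hz
      have hne : gridPos q v - gridPos q u ≠ 0 := sub_ne_zero.2 (hinj.ne (Ne.symm huv))
      refine ⟨hadj.toWalk, by simp [huv], gridPos q v - gridPos q u, hne, ?_⟩
      have hx : 0 < (gridPos q v - gridPos q u).1 ^ 2 + (gridPos q v - gridPos q u).2 ^ 2 := by
        by_contra hc
        have h1 := sq_nonneg (gridPos q v - gridPos q u).1
        have h2 := sq_nonneg (gridPos q v - gridPos q u).2
        exact hne (Prod.ext (pow_eq_zero_iff two_ne_zero |>.1 (by linarith))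
          (pow_eq_zero_iff two_ne_zero |>.1 (by linarith)))
      simp only [Prod.fst_sub, Prod.snd_sub] at hx
      simp only [SimpleGraph.Walk.support_cons, SimpleGraph.Walk.support_nil, List.pairwise_cons,
        List.mem_singleton, forall_eq, List.not_mem_nil, false_imp_iff, implies_true,
        List.Pairwise.nil, and_true, Prod.fst_sub, Prod.snd_sub]
      nlinarith
  · have hs : Subsingleton (Quot (ContinuesStraight G (gridPos q))) := by
      refine ⟨fun a b => ?_⟩
      induction a using Quot.ind
      induction b using Quot.ind
      exact congrArg _ (Subtype.ext (edge_eq_of_le_two hn (Subtype.prop _) (Subtype.prop _)))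
    have h1 : segmentCount G (gridPos q) ≤ 1 := Finite.card_le_one_iff_subsingleton.2 hs
    rcases (show n = 1 ∨ n = 2 by omega) with h2 | h2
    · have : segmentCount G (gridPos q) = 0 := by
        have : IsEmpty (Quot (ContinuesStraight G (gridPos q))) := by
          refine ⟨fun a => ?_⟩
          induction a using Quot.ind with
          | _ e =>
            obtain ⟨e, he⟩ := e
            induction e using Sym2.ind with
            | _ u v =>
              have := G.ne_of_adj he
              rw [Ne, Fin.ext_iff] at this
              omega
        exact Nat.card_of_isEmpty
      omega
    · omega

end WordRAM

/-! ### The algorithm -/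

namespace WordRAM

/-- The algorithm; for at most two vertices the input is a suitable output. -/
def drawAlgorithm : Program :=
  .instr (.load 20 0) ;; .instr (.const 19 3) ;; .ifLt 20 19 .skip drawMain

variable {n w : ℕ} {G : SimpleGraph (Fin n)} {L : List (Fin n × Fin n)}

/-- The structured state describes cells of kind `I` only below 16 n, so the result refers to the
memory cut off there; the output needs 2 n cells. -/
theorem runs_drawAlgorithm_of_three_le (hw : Fits w n) (hG : Biconnected G) (hout : Outerplanar G)
    (hL : IsEdgeList G L) (hn : 3 ≤ n) :
    ∃ t s, Runs w drawAlgorithm (inputState L) t s ∧ t ≤ 3 + timeBound (2 * n) drawMain ∧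
      IsResult n (NbRel (edgeNb (edgeFst L) (edgeSnd L) L.length)) fun i =>
        if i < 16 * n then s.mem i else 0 := by
  obtain ⟨o, ho⟩ := exists_cycOrder (by omega) hG hout
  obtain ⟨pos, hpos⟩ := ho.exists_isNumbering hn
  obtain ⟨p, hp⟩ := hpos.order.exists_isMinNeighbour
  have hm := hpos.length_edgeList_le hp hL
  -- The input has 2 + 2 m words with m ≤ 2 n - 3, so it ends before the records, the matrix and the
  -- table, which are therefore zero.
  have hmem : ∀ i, 16 * n ≤ i → (inputState L).mem i = 0 := by
    intro i hi
    refine List.getD_eq_default _ _ ?_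
    have : (L.flatMap fun x => [(x.1 : ℕ), (x.2 : ℕ)]).length = 2 * L.length := by
      induction L with
      | nil => rfl
      | cons x L ih => simp; omega
    simp only [inputWords, List.length_cons, this]
    omega
  have h3 : 3 % 2 ^ w = 3 := Nat.mod_eq_of_lt (by have := hw.lin; omega)
  let s : State := (Instr.const 19 3).run w ((Instr.load 20 0).run w (inputState L))
  have h20 : s.reg 20 = n := rfl
  have h19 : s.reg 19 = 3 := by simp [s, Instr.run, h3]
  let h : HState := ⟨s.reg, fun f i => s.mem ((i + n) * 16 + f), fun i j => s.mem (i * n + j + 32 * n),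
    fun i => s.mem (i + 32 * n + n * n), s.mem⟩
  have hS : Sim n h s := ⟨fun _ _ => rfl, h20, fun _ _ _ _ => rfl, fun _ _ _ _ => rfl,
    fun _ _ => rfl, fun _ _ => rfl⟩
  have hspec := spec_drawMain (h := h) (o := fun i => (o i : ℕ)) hw le_rfl hn
    (isInput_inputState hL (by omega)) (fun f hf i hi => hmem _ (by omega))
    (fun i hi j hj => hmem _ (by omega)) (CycOrder.val ho hL) (fun x => ⟨?_, fun hx => ?_⟩)
  · obtain ⟨t, s', h', r1, r2, r3, r4⟩ := hspec s hS
    refine ⟨_, s', .seq .instr (.seq .instr (.ifFalse ?_ r1)), by omega, ?_⟩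
    · change ¬ s.reg 20 < s.reg 19
      omega
    · obtain ⟨o, pos, p, c, y, g1, g2, g3, g4, g5, g6⟩ := r4
      refine ⟨o, pos, p, c, y, g1, g2, g3, g4, g5, fun v hv => ?_⟩
      simp only [if_pos (show 2 * v < 16 * n by omega), if_pos (show 2 * v + 1 < 16 * n by omega),
        r3.I _ (show 2 * v < 16 * n by omega), r3.I _ (show 2 * v + 1 < 16 * n by omega)]
      exact g6 v hv
  · rintro ⟨i, hi, rfl⟩
    exact (o i).2
  · refine ⟨pos ⟨x, hx⟩, hpos.pos_lt _, ?_⟩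
    simp only [hpos.o_pos]

theorem runs_drawAlgorithm_of_le_two (hw : 2 ≤ w) (hn : n ≤ 2) :
    Runs w drawAlgorithm (inputState L) 3
      ((Instr.const 19 3).run w ((Instr.load 20 0).run w (inputState L))) := by
  have h3 : 3 % 2 ^ w = 3 := Nat.mod_eq_of_lt (by
    have := Nat.pow_le_pow_right (n := 2) (by omega) hw
    omega)
  refine .seq .instr (.seq .instr (.ifTrue ?_ .skip))
  simp only [Instr.run, Function.update_self, h3]
  change n < 3
  omega

/-- For at most two vertices the input consists of small numbers at distinct points. -/
theorem outputPlacement_inputState (hL : IsEdgeList G L) (hG : G.Connected) (hn : n ≤ 2) {s : State}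
    (hs : s.mem = (inputState L).mem) : Function.Injective (outputPlacement n s) ∧
      ∀ v, (outputPlacement n s v).1 ≤ 2 ∧ (outputPlacement n s v).2 ≤ 2 := by
  have hedge : ∀ x ∈ L, s(x.1, x.2) ∈ G.edgeSet := fun x hx =>
    (hL.2 _).2 (List.mem_map.2 ⟨x, hx, rfl⟩)
  have hout : outputPlacement n s = fun v : Fin n => ((inputWords L).getD (2 * (v : ℕ)) 0,
      (inputWords L).getD (2 * (v : ℕ) + 1) 0) := by
    funext v
    exact Prod.ext (congrFun hs _) (congrFun hs _)
  rw [hout]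
  -- For n = 1 the only point is (1, 0). For n = 2 the first four cells are 2, 1, u, v with {u, v} =
  -- {0, 1}, so the points (2, 1) and (u, v) are distinct.
  match L with
  | [] =>
    have hsub : Subsingleton (Fin n) := by
      by_contra hc
      rw [not_subsingleton_iff_nontrivial] at hc
      obtain ⟨u⟩ := hG.nonempty
      obtain ⟨v, hv⟩ := hG.preconnected.exists_adj_of_nontrivial u
      have := (hL.2 s(u, v)).1 hv
      simp at this
    refine ⟨Function.injective_of_subsingleton _, fun v => ?_⟩
    have hv : (v : ℕ) = 0 := by
      have := Fin.subsingleton_iff_le_one.1 hsub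
      omega
    simp [inputWords, hv, hn]
  | [x] =>
    have hne : (x.1 : ℕ) ≠ x.2 := Fin.val_ne_of_ne (G.ne_of_adj (hedge x (by simp)))
    have hv : ∀ v : Fin n, (v : ℕ) = 0 ∨ (v : ℕ) = 1 := fun v => by omega
    have h1 := x.1.2
    have h2 := x.2.2
    refine ⟨fun u v huv => Fin.ext ?_, fun v => ?_⟩
    · rcases hv u with hu | hu <;> rcases hv v with hv | hv <;>
        simp [inputWords, hu, hv] at huv ⊢ <;> omega
    · rcases hv v with hv | hv <;> simp [inputWords, hv] <;> omega
  | x :: y :: l =>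
    have := edge_eq_of_le_two hn (hedge x (by simp)) (hedge y (by simp))
    have hnd := hL.1
    simp [this] at hnd

end WordRAM

theorem mainTheorem7 :
    ∃ (C : ℕ) (alg : WordRAM.Program),
      ∀ (n : ℕ) (G : SimpleGraph (Fin n)), Biconnected G → Outerplanar G →
        ∀ L : List (Fin n × Fin n), IsEdgeList G L →
          ∀ w : ℕ, C * n ^ 2 ≤ 2 ^ w →
            ∃ (t : ℕ) (s : WordRAM.State) (q : Fin n → ℕ × ℕ),
              WordRAM.Runs w alg (inputState L) t s ∧ t ≤ C * n ∧
              q = outputPlacement n s ∧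
              (∀ v : Fin n, (q v).1 ≤ C * n ∧ (q v).2 ≤ C * n ^ 2) ∧
              IsPlanarStraightLine G (gridPos q) ∧
              IsMonotoneDrawing G (gridPos q) ∧
              (segmentCount G (gridPos q) : ℝ) ≤ (3 * (n : ℝ) - 3) / 2 := by
  classical
  -- The time is at most 3 + a + 2 n b with a, b as below, since no loop exceeds 2 n iterations. The
  -- summand 100 is what `Fits` demands of the word length, and it also covers the initial steps and
  -- the coordinates.
  refine ⟨100 + WordRAM.timeBound 0 WordRAM.drawMain + 2 * WordRAM.timeSlope WordRAM.drawMain,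
    WordRAM.drawAlgorithm, fun n G hG hout L hL w hw => ?_⟩
  set a := WordRAM.timeBound 0 WordRAM.drawMain
  set b := WordRAM.timeSlope WordRAM.drawMain
  have hn : 1 ≤ n := by
    obtain ⟨v⟩ := hG.1.nonempty
    have := v.2
    omega
  have hC : 100 * n ^ 2 ≤ (100 + a + 2 * b) * n ^ 2 := Nat.mul_le_mul_right _ (by omega)
  have hC' : 100 * n ≤ (100 + a + 2 * b) * n := Nat.mul_le_mul_right _ (by omega)
  have hcast : ∀ k : ℕ, 2 * k + 3 ≤ 3 * n → (k : ℝ) ≤ (3 * (n : ℝ) - 3) / 2 := by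
    intro k hk
    have : 2 * (k : ℝ) + 3 ≤ 3 * n := by exact_mod_cast hk
    linarith
  have hfits : WordRAM.Fits w n := ⟨hn, by rw [← sq]; omega⟩
  rcases Nat.lt_or_ge 2 n with h3 | h2
  · obtain ⟨t, s, hrun, ht, hres⟩ :=
      WordRAM.runs_drawAlgorithm_of_three_le hfits hG hout hL h3
    obtain ⟨h4, h5, h6, h7⟩ := hres.good hL h3
    have hq : outputPlacement n s = fun v : Fin n =>
        (if 2 * (v : ℕ) < 16 * n then s.mem (2 * (v : ℕ)) else 0,
          if 2 * (v : ℕ) + 1 < 16 * n then s.mem (2 * (v : ℕ) + 1) else 0) := by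
      funext v
      rw [if_pos (by omega), if_pos (by omega)]
      rfl
    rw [← hq] at h5 h6 h7
    refine ⟨t, s, _, hrun, ?_, rfl, fun v => ?_, h5, h6, hcast _ h7⟩
    · rw [WordRAM.timeBound_eq] at ht
      change t ≤ 3 + (a + 2 * n * b) at ht
      have e1 : a ≤ a * n := Nat.le_mul_of_pos_right _ hn
      have e2 : (100 + a + 2 * b) * n = 100 * n + a * n + 2 * n * b := by ring
      omega
    · obtain ⟨e1, e2⟩ := h4 v
      rw [← sq] at e2
      rw [hq]
      exact ⟨e1.trans (by omega), e2.trans (by omega)⟩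
  · have hw2 : 2 ≤ w := by
      by_contra hc
      have := Nat.pow_le_pow_right (n := 2) (by omega) (show w ≤ 1 by omega)
      have := hfits.lin
      omega
    obtain ⟨h4, h5⟩ := WordRAM.outputPlacement_inputState hL hG.1 h2 (s := (WordRAM.Instr.const 19
      3).run w ((WordRAM.Instr.load 20 0).run w (inputState L))) rfl
    obtain ⟨h6, h7, h8⟩ := WordRAM.isGoodDrawing_of_le_two h2 hG.1 h4
    refine ⟨3, _, _, WordRAM.runs_drawAlgorithm_of_le_two hw2 h2, by omega, rfl, fun v => ?_, h6, h7,
      hcast _ h8⟩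
    obtain ⟨e1, e2⟩ := h5 v
    have : 1 ≤ n ^ 2 := Nat.one_le_pow _ _ hn
    exact ⟨by omega, by omega⟩
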